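/- Setting. Let $\Omega\subset\mathbb R^2$ be a bounded domain with polygonal boundary $\Gamma=\partial\Omega$, and let $\mathcal T_0$ be a conforming triangulation of $\Omega$, regular in the sense of Ciarlet: finitely many nondegenerate closed triangles with union $\overline\Omega$, two different ones being disjoint or sharing exactly one node or one edge. For such a triangulation $\mathcal T_\ell$ let $\mathcal E_\ell$ be its set of edges, $\mathcal E_\ell^\Omega$ the set of interior edges $E=T^+\cap T^-$ with $T^+\ne T^-$ in $\mathcal T_\ell$, and $\mathcal E_\ell^\Gamma=\mathcal E_\ell\setminus\mathcal E_\ell^\Omega$ the set of boundary edges; the boundary edges of $\mathcal T_0$ have union $\Gamma$. Fix a reference edge for each $T\in\mathcal T_0$. For $\ell=0,1,2,\dots$ let $\mathcal M_\ell\subseteq\mathcal E_\ell$ be a set of marked edges, and let $\mathcal T_{\ell+1}$ be obtained from $\mathcal T_\ell$ by newest vertex bisection: the set of marked edges is first enlarged to the smallest set which contains the reference edge of every element that has an edge in the set. Then each element with an edge in the enlarged set is bisected through the midpoint of its reference edge, the reference edges of the sons being opposite to this midpoint; a son is bisected in turn in the same way if its reference edge belongs to the enlarged set. Hence an element is split into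 2, 3 or 4 sons, or not at all. Data and discrete problem. Let $f\in L^2(\Omega)$, let $\chi$ be affine, and let $g\in H^1(\Gamma)$ (identified with its continuous representative) satisfy $\chi\le g$ on $\Gamma$. Let $\mathcal S^1(\mathcal T_\ell)$ be the space of continuous functions on $\overline\Omega$ that are affine on each $T\in\mathcal T_\ell$, and let $g_\ell$ be the continuous function on $\Gamma$ that is affine on each $E\in\mathcal E_\ell^\Gamma$ and equals $g$ at the nodes on $\Gamma$. Let $U_\ell$ be the minimizer of $\mathcal J(V)=\frac12\int_\Omega|\nabla V|^2\,dx-\int_\Omega fV\,dx$ over $$\mathcal A_\ell=\{V\in\mathcal S^1(\mathcal T_\ell):\ V\ge\chi\text{ in }\Omega,\ V=g_\ell\text{ on }\Gamma\},$$ and write $|||v|||^2=\int_\Omega|\nabla v|^2\,dx$. Estimator. Let $h_E$ be the length of $E$ and, for $E=T^+\cap T^-\in\mathcal E_\ell^\Omega$, let $\omega_E=T^+\cup T^-$, let $f_{\omega_E}$ be the integral mean of $f$ over $\omega_E$, and let $[\partial_nU_\ell]$ be the jump of the normal derivative over $E$. For $E\in\mathcal E_\ell^\Gamma$ let $T_E\in\mathcal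 T_\ell$ be the unique element with the edge $E$. Let $(\cdot)'$ be the arclength derivative. Put $$\eta_\ell(E)^2=h_E\|[\partial_nU_\ell]\|_{L^2(E)}^2,\qquad \mathrm{osc}_\ell(E)^2=|\omega_E|\,\|f-f_{\omega_E}\|_{L^2(\omega_E)}^2\qquad(E\in\mathcal E_\ell^\Omega),$$ $$\mathrm{apx}_\ell(E)^2=h_E\|(g-g_\ell)'\|_{L^2(E)}^2,\qquad \mathrm{osc}_\ell(E)^2=|T_E|\,\|f\|_{L^2(T_E)}^2\qquad(E\in\mathcal E_\ell^\Gamma),$$ $$\varrho_\ell^2=\sum_{E\in\mathcal E_\ell^\Omega}\big(\eta_\ell(E)^2+\mathrm{osc}_\ell(E)^2\big)+\sum_{E\in\mathcal E_\ell^\Gamma}\big(\mathrm{apx}_\ell(E)^2+\mathrm{osc}_\ell(E)^2\big).$$ Proposition (estimator reduction). Let $0<\theta<1$. There is $q\in(0,1)$ that depends only on $\theta$, and a constant $C>0$ that depends only on $\theta$ and on the initial mesh $\mathcal T_0$, such that for each $\ell\ge0$ for which $\mathcal M_\ell$ satisfies the Dörfler marking criterion $$\theta\,\varrho_\ell^2\le\sum_{E\in\mathcal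 E_\ell^\Omega\cap\mathcal M_\ell}\big(\eta_\ell(E)^2+\mathrm{osc}_\ell(E)^2\big)+\sum_{E\in\mathcal E_\ell^\Gamma\cap\mathcal M_\ell}\big(\mathrm{apx}_\ell(E)^2+\mathrm{osc}_\ell(E)^2\big)$$ there holds $$\varrho_{\ell+1}^2\le q\,\varrho_\ell^2+C\,|||U_{\ell+1}-U_\ell|||^2.$$ -/

import Mathlib

open MeasureTheory

namespace ObstacleAFEM

noncomputable section

open scoped Classical

/-- The Euclidean plane. -/
abbrev Plane := EuclideanSpace ℝ (Fin 2)

/-- The closed simplex (triangle, edge or node) spanned by a finite set of vertices. -/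
def hull (s : Finset Plane) : Set Plane := convexHull ℝ (s : Set Plane)

/-! ### Triangulations

A triangle is given by the set of its three vertices, an edge by the set of its two endpoints. -/

/-- The set of all edges of the triangles in `τ`. -/
def edges (τ : Finset (Finset Plane)) : Finset (Finset Plane) :=
  τ.biUnion fun T => T.powersetCard 2

/-- The interior edges, that is, the edges `E = T⁺ ∩ T⁻` with two different elements `T⁺`, `T⁻`. -/
def interiorEdges (τ : Finset (Finset Plane)) : Finset (Finset Plane) :=
  (edges τ).filter fun E => ∃ T ∈ τ, ∃ T' ∈ τ, T ≠ T' ∧ E = T ∩ T'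

/-- The boundary edges: all the other edges. -/
def boundaryEdges (τ : Finset (Finset Plane)) : Finset (Finset Plane) :=
  edges τ \ interiorEdges τ

/-- `τ` is a conforming triangulation of `Ω`, regular in the sense of Ciarlet: the elements are
nondegenerate closed triangles that cover `closure Ω`, two of them meet in the simplex spanned by
their common vertices (nothing, a node or an edge, unless they are equal), and the boundary edges
make up the boundary of `Ω` (which is thereby polygonal). -/
structure IsTriangulation (Ω : Set Plane) (τ : Finset (Finset Plane)) : Prop where
  card_eq : ∀ T ∈ τ, T.card = 3
  nondegenerate : ∀ T ∈ τ, AffineIndependent ℝ ((↑) : T → Plane)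
  conforming : ∀ T ∈ τ, ∀ T' ∈ τ, hull T ∩ hull T' = hull (T ∩ T')
  cover : ⋃ T ∈ τ, hull T = closure Ω
  boundary : ⋃ E ∈ boundaryEdges τ, hull E = frontier Ω

/-! ### Newest vertex bisection -/

/-- A triangle together with its reference edge. -/
abbrev RefTriangle := Finset Plane × Finset Plane

/-- The triangles of a mesh, without the reference edges. -/
def tris (𝒯 : Finset RefTriangle) : Finset (Finset Plane) := 𝒯.image Prod.fst

/-- The mesh `τ` where each `T ∈ τ` has the reference edge `r T`. -/
def withRefEdges (τ : Finset (Finset Plane)) (r : Finset Plane → Finset Plane) :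
    Finset RefTriangle := τ.image fun T => (T, r T)

/-- Bisection of a triangle `p.1` through the midpoint of its reference edge `p.2`. Each of the two
sons keeps all vertices of `p.1` but one endpoint `x` of the reference edge and has the midpoint as
its newest vertex; the reference edge of the son is the one opposite to this newest vertex. -/
def bisect (p : RefTriangle) : Finset RefTriangle :=
  p.2.image fun x => (insert (p.2.centroid ℝ id) (p.1.erase x), p.1.erase x)

/-- The closure of a set `M` of marked edges which avoids hanging nodes: the smallest set of edges
that contains `M` and, with an edge of some element of the mesh, its reference edge. -/
inductive MarkClosure (𝒯 : Finset RefTriangle) (M : Finset (Finset Plane)) :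
    Finset Plane → Prop
  | base (E : Finset Plane) (hE : E ∈ M) : MarkClosure 𝒯 M E
  | ref (p : RefTriangle) (hp : p ∈ 𝒯) (E : Finset Plane) (hEp : E ∈ p.1.powersetCard 2)
      (hE : MarkClosure 𝒯 M E) : MarkClosure 𝒯 M p.2

/-- Refinement of one element by iterated newest vertex bisection, if exactly its edges that belong
to `S` are to be halved. The reference edge of a son of the first bisection is an edge of the
father, and the son is bisected in turn if that edge is to be halved. The result consists of
1, 2, 3 or 4 elements. -/
def refineElement (S : Finset Plane → Prop) (p : RefTriangle) : Finset RefTriangle :=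
  if S p.2 then
    (bisect p).biUnion fun p' => if S p'.2 then bisect p' else {p'}
  else {p}

/-- The mesh obtained from `𝒯` by newest vertex bisection with marked edges `M`. -/
def newestVertexBisection (𝒯 : Finset RefTriangle) (M : Finset (Finset Plane)) :
    Finset RefTriangle :=
  𝒯.biUnion (refineElement (MarkClosure 𝒯 M))

/-! ### Discrete spaces, energy, discrete obstacle problem -/

/-- `v` coincides on `s` with an affine function. -/
def AffineOn (v : Plane → ℝ) (s : Set Plane) : Prop :=
  ∃ A : Plane →ᵃ[ℝ] ℝ, Set.EqOn v A s

/-- The P1 finite element space on the triangulation `τ` of `Ω`: continuous on `closure Ω` and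
affine on each element. The values of the functions outside of `closure Ω` play no role. -/
def S1 (Ω : Set Plane) (τ : Finset (Finset Plane)) : Set (Plane → ℝ) :=
  {V | ContinuousOn V (closure Ω) ∧ ∀ T ∈ τ, AffineOn V (hull T)}

/-- The bilinear form `∫_Ω ∇u · ∇v`. (It is used for continuous piecewise affine functions only,
whose weak gradient is the classical gradient, defined almost everywhere.) -/
def energyForm (Ω : Set Plane) (u v : Plane → ℝ) : ℝ :=
  ∫ x in Ω, inner ℝ (gradient u x) (gradient v x)

/-- The energy functional. -/
def energy (Ω : Set Plane) (f v : Plane → ℝ) : ℝ :=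
  1 / 2 * energyForm Ω v v - ∫ x in Ω, f x * v x

/-- `gh` is, on the boundary, the nodal interpolant of `g`: continuous, affine on each boundary
edge, and equal to `g` at the endpoints of the boundary edges. -/
structure IsNodalInterpolant (Ω : Set Plane) (τ : Finset (Finset Plane)) (g gh : Plane → ℝ) :
    Prop where
  continuousOn : ContinuousOn gh (frontier Ω)
  affineOn : ∀ E ∈ boundaryEdges τ, AffineOn gh (hull E)
  interpolates : ∀ E ∈ boundaryEdges τ, ∀ z ∈ E, gh z = g z

/-- The discrete admissible functions for the obstacle `χ` and the boundary data `gh`. -/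
def admissible (Ω : Set Plane) (τ : Finset (Finset Plane)) (χ gh : Plane → ℝ) :
    Set (Plane → ℝ) :=
  {V | V ∈ S1 Ω τ ∧ (∀ x ∈ Ω, χ x ≤ V x) ∧ ∀ x ∈ frontier Ω, V x = gh x}

/-- `U` solves the discrete obstacle problem: it minimizes the energy over the discrete admissible
functions. -/
def IsDiscreteSolution (Ω : Set Plane) (τ : Finset (Finset Plane)) (f χ gh U : Plane → ℝ) : Prop :=
  U ∈ admissible Ω τ χ gh ∧ ∀ V ∈ admissible Ω τ χ gh, energy Ω f U ≤ energy Ω f V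

/-! ### Boundary data -/

/-- Arclength parametrization of the line through `a` and `b`: the segment from `a` to `b` is
traversed for parameters in `[0, dist a b]`. -/
def arc (a b : Plane) (s : ℝ) : Plane := a + (s / dist a b) • (b - a)

/-- `g ∈ H¹(Γ)` for `Γ` the (polygonal) boundary of `Ω`, where `g` is the continuous
representative: on each segment in `Γ` it is an absolutely continuous function of the arclength
with a square integrable derivative. -/
def H1Boundary (Ω : Set Plane) (g : Plane → ℝ) : Prop :=
  ContinuousOn g (frontier Ω) ∧
  ∀ a b : Plane, a ≠ b → segment ℝ a b ⊆ frontier Ω →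
    AbsolutelyContinuousOnInterval (fun s => g (arc a b s)) 0 (dist a b) ∧
    MemLp (deriv fun s => g (arc a b s)) 2 (volume.restrict (Set.Ioo 0 (dist a b)))

/-! ### The error estimator -/

/-- The length of the edge `E`. -/
def len (E : Finset Plane) : ℝ := Metric.diam (hull E)

/-- The endpoints of an edge, in one of the two possible orders. -/
def endpoints (E : Finset Plane) : Plane × Plane :=
  Classical.epsilon fun p => p.1 ≠ p.2 ∧ E = {p.1, p.2}

/-- The outer unit normal of the triangle `T` on its edge `E`. -/
def outerNormal (T E : Finset Plane) : Plane :=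
  Classical.epsilon fun n => ‖n‖ = 1 ∧ (∀ x ∈ E, ∀ y ∈ E, inner ℝ n (x - y) = 0) ∧
    ∀ x ∈ E, ∀ z ∈ T, inner ℝ n (z - x) ≤ 0

/-- The gradient on `T` of a function that is affine on `T`, taken at the center of mass. -/
def gradOn (U : Plane → ℝ) (T : Finset Plane) : Plane := gradient U (T.centroid ℝ id)

/-- The jump over the interior edge `E` of the normal derivative of a piecewise affine function
(a constant on `E`): the sum of the outer normal derivatives from the two elements that have the
edge `E`. -/
def normalJump (τ : Finset (Finset Plane)) (U : Plane → ℝ) (E : Finset Plane) : ℝ :=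
  ∑ T ∈ τ with E ⊆ T, inner ℝ (gradOn U T) (outerNormal T E)

/-- `η(E)² = h_E ‖[∂ₙU]‖²` with the norm of `L²(E)`, for an interior edge. -/
def etaSq (τ : Finset (Finset Plane)) (U : Plane → ℝ) (E : Finset Plane) : ℝ :=
  len E * ∫ _s in (0 : ℝ)..len E, normalJump τ U E ^ 2

/-- The patch of an edge: the union of the elements that have it as an edge. -/
def patch (τ : Finset (Finset Plane)) (E : Finset Plane) : Set Plane :=
  ⋃ T ∈ τ, ⋃ (_ : E ⊆ T), hull T

/-- The oscillation `osc(E)² = |ω| ‖f - f_ω‖²` with the norm of `L²(ω)`, `ω` the patch and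
`f_ω` the integral mean, for an interior edge. -/
def oscInteriorSq (τ : Finset (Finset Plane)) (f : Plane → ℝ) (E : Finset Plane) : ℝ :=
  volume.real (patch τ E) * ∫ x in patch τ E, (f x - ⨍ y in patch τ E, f y) ^ 2

/-- `osc(E)² = |T| ‖f‖²` with the norm of `L²(T)`, for a boundary edge; here the patch is the unique
element `T` with the edge `E`. -/
def oscBoundarySq (τ : Finset (Finset Plane)) (f : Plane → ℝ) (E : Finset Plane) : ℝ :=
  volume.real (patch τ E) * ∫ x in patch τ E, f x ^ 2

/-- `apx(E)² = h_E ‖(g - gh)'‖²` with the norm of `L²(E)` and the arclength derivative, for a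
boundary edge. -/
def apxSq (g gh : Plane → ℝ) (E : Finset Plane) : ℝ :=
  len E * ∫ s in (0 : ℝ)..len E,
    deriv (fun t => g (arc (endpoints E).1 (endpoints E).2 t) -
      gh (arc (endpoints E).1 (endpoints E).2 t)) s ^ 2

/-- The contribution to the squared estimator of the edges in `S`. -/
def contribution (τ : Finset (Finset Plane)) (f g gh U : Plane → ℝ)
    (S : Finset (Finset Plane)) : ℝ :=
  ∑ E ∈ interiorEdges τ ∩ S, (etaSq τ U E + oscInteriorSq τ f E) +
    ∑ E ∈ boundaryEdges τ ∩ S, (apxSq g gh E + oscBoundarySq τ f E)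

/-- The squared error estimator `ϱ²`. -/
def estimatorSq (τ : Finset (Finset Plane)) (f g gh U : Plane → ℝ) : ℝ :=
  ∑ E ∈ interiorEdges τ, (etaSq τ U E + oscInteriorSq τ f E) +
    ∑ E ∈ boundaryEdges τ, (apxSq g gh E + oscBoundarySq τ f E)

end

end ObstacleAFEM

open ObstacleAFEM

namespace ObstacleAFEM

noncomputable section

open scoped Classical

/-! ### Planar geometry -/

/-- Twice the signed area of the triangle with the vertices `a`, `b`, `c`. -/
def orient (a b c : Plane) : ℝ :=
  (b 0 - a 0) * (c 1 - a 1) - (b 1 - a 1) * (c 0 - a 0)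

lemma plane_ext {u v : Plane} (h0 : u 0 = v 0) (h1 : u 1 = v 1) : u = v := by
  ext i; fin_cases i <;> simpa

lemma orient_cycle (a b c : Plane) : orient b c a = orient a b c := by
  unfold orient; ring

lemma orient_swap (a b c : Plane) : orient a c b = -orient a b c := by
  unfold orient; ring

lemma midpoint_apply (a b : Plane) (i : Fin 2) : midpoint ℝ a b i = (a i + b i) / 2 := by
  rw [midpoint_eq_smul_add]; simp; ring

lemma orient_ne_of_ne {a b c : Plane} (h : orient a b c ≠ 0) : a ≠ b ∧ a ≠ c ∧ b ≠ c := by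
  refine ⟨?_, ?_, ?_⟩ <;> rintro rfl <;> apply h <;> unfold orient <;> ring

/-- The affine function `w ↦ orient a b w`. -/
def orientMap (a b : Plane) : Plane →ᵃ[ℝ] ℝ where
  toFun w := orient a b w
  linear :=
    { toFun := fun v => (b 0 - a 0) * v 1 - (b 1 - a 1) * v 0
      map_add' := fun u v => by simp; ring
      map_smul' := fun r v => by simp; ring }
  map_vadd' p v := by simp [orient]; ring

@[simp] lemma orientMap_apply (a b w : Plane) : orientMap a b w = orient a b w := rfl

/-- `b` is the family of the barycentric coordinates of the triangle `T`. -/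
structure IsBary (T : Finset Plane) (b : Plane → Plane →ᵃ[ℝ] ℝ) : Prop where
  delta : ∀ u ∈ T, ∀ v ∈ T, b v u = if u = v then 1 else 0
  sum_one : ∀ w, ∑ v ∈ T, b v w = 1
  sum_smul : ∀ w, ∑ v ∈ T, b v w • v = w

lemma exists_isBary {z x y : Plane} (h : orient z x y ≠ 0) : ∃ b, IsBary {z, x, y} b := by
  obtain ⟨hzx, hzy, hxy⟩ := orient_ne_of_ne h
  refine ⟨fun v => (orient z x y)⁻¹ • (if v = z then orientMap x y else if v = x then orientMap y z
    else orientMap z x), ?_, ?_, ?_⟩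
  · intro u hu v hv
    simp only [Finset.mem_insert, Finset.mem_singleton] at hu hv
    have e1 : orient x y z = orient z x y := by unfold orient; ring
    have e2 : orient y z x = orient z x y := by unfold orient; ring
    have e3 : ∀ a b, orient a b a = 0 := by intro a b; unfold orient; ring
    have e4 : ∀ a b, orient a b b = 0 := by intro a b; unfold orient; ring
    rcases hu with rfl | rfl | rfl <;> rcases hv with rfl | rfl | rfl <;>
      simp [hzx, hzy, hxy, hzx.symm, hzy.symm, hxy.symm, e1, e2, e3, e4, h]
  · intro w
    rw [Finset.sum_insert (by simp [hzx, hzy]), Finset.sum_pair hxy]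
    simp [hzx.symm, hzy.symm, hxy.symm]
    field_simp
    unfold orient; ring
  · intro w
    rw [Finset.sum_insert (by simp [hzx, hzy]), Finset.sum_pair hxy]
    simp [hzx.symm, hzy.symm, hxy.symm]
    apply plane_ext <;> simp <;> field_simp <;> unfold orient <;> ring

lemma hull_mono {s t : Finset Plane} (h : s ⊆ t) : hull s ⊆ hull t :=
  convexHull_mono (by exact_mod_cast h)

lemma subset_hull {s : Finset Plane} {v : Plane} (h : v ∈ s) : v ∈ hull s :=
  subset_convexHull ℝ _ (by exact_mod_cast h)

lemma convex_hull (s : Finset Plane) : Convex ℝ (hull s) := convex_convexHull ℝ _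

lemma hull_subset_hull {s t : Finset Plane} (h : ∀ v ∈ s, v ∈ hull t) : hull s ⊆ hull t :=
  convexHull_min (fun v hv => h v (by exact_mod_cast hv)) (convex_hull t)

lemma isCompact_hull (s : Finset Plane) : IsCompact (hull s) := by
  exact (s.finite_toSet).isCompact_convexHull (𝕜 := ℝ)

lemma measurableSet_hull (s : Finset Plane) : MeasurableSet (hull s) :=
  (isCompact_hull s).isClosed.measurableSet

lemma midpoint_mem_hull {s : Finset Plane} {a b : Plane} (ha : a ∈ hull s) (hb : b ∈ hull s) :
    midpoint ℝ a b ∈ hull s := (convex_hull s).midpoint_mem ha hb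

lemma nonneg_on_hull {s : Finset Plane} {φ : Plane →ᵃ[ℝ] ℝ} (h : ∀ v ∈ s, 0 ≤ φ v) {w : Plane}
    (hw : w ∈ hull s) : 0 ≤ φ w :=
  convexHull_min (t := φ ⁻¹' Set.Ici 0) (fun v hv => h v (by exact_mod_cast hv))
    ((convex_Ici 0).affine_preimage φ) hw

lemma eq_zero_on_hull {s : Finset Plane} {φ : Plane →ᵃ[ℝ] ℝ} (h : ∀ v ∈ s, φ v = 0) {w : Plane}
    (hw : w ∈ hull s) : φ w = 0 :=
  convexHull_min (t := φ ⁻¹' {0}) (fun v hv => h v (by exact_mod_cast hv))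
    ((convex_singleton 0).affine_preimage φ) hw

lemma affine_apply_midpoint (φ : Plane →ᵃ[ℝ] ℝ) (a b : Plane) :
    φ (midpoint ℝ a b) = (φ a + φ b) / 2 := by
  rw [AffineMap.map_midpoint, midpoint_eq_smul_add]; simp; ring

lemma affine_apply_sum (φ : Plane →ᵃ[ℝ] ℝ) (s : Finset Plane) (w : Plane → ℝ)
    (hw : ∑ v ∈ s, w v = 1) : φ (∑ v ∈ s, w v • v) = ∑ v ∈ s, w v * φ v := by
  have h := Finset.map_affineCombination s (fun v : Plane => v) w hw φ
  rw [Finset.affineCombination_eq_linear_combination _ _ _ hw,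
    Finset.affineCombination_eq_linear_combination _ _ _ hw] at h
  simpa using h

lemma mem_hull_iff {s : Finset Plane} {x : Plane} : x ∈ hull s ↔
    ∃ w : Plane → ℝ, (∀ y ∈ s, 0 ≤ w y) ∧ ∑ y ∈ s, w y = 1 ∧ ∑ y ∈ s, w y • y = x := by
  unfold hull
  rw [Finset.mem_convexHull]
  constructor
  · rintro ⟨w, h0, h1, rfl⟩
    exact ⟨w, h0, h1, by rw [Finset.centerMass_eq_of_sum_1 _ _ h1]; rfl⟩
  · rintro ⟨w, h0, h1, rfl⟩
    exact ⟨w, h0, h1, by rw [Finset.centerMass_eq_of_sum_1 _ _ h1]; rfl⟩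

/-- The zero set of an affine function that is nonnegative on a simplex is a face. -/
lemma mem_hull_filter {s : Finset Plane} {φ : Plane →ᵃ[ℝ] ℝ} (h : ∀ v ∈ s, 0 ≤ φ v) {x : Plane}
    (hx : x ∈ hull s) (h0 : φ x = 0) : x ∈ hull (s.filter fun v => φ v = 0) := by
  obtain ⟨w, hw, hw1, rfl⟩ := mem_hull_iff.1 hx
  rw [affine_apply_sum φ s w hw1] at h0
  have hz := (Finset.sum_eq_zero_iff_of_nonneg fun v hv => mul_nonneg (hw v hv) (h v hv)).1 h0
  have hz' : ∀ v ∈ s, ¬ φ v = 0 → w v = 0 := fun v hv hn =>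
    (mul_eq_zero.1 (hz v hv)).resolve_right hn
  refine mem_hull_iff.2 ⟨w, fun y hy => hw y (Finset.mem_filter.1 hy).1, ?_, ?_⟩
  · rw [← hw1]
    exact Finset.sum_subset (Finset.filter_subset _ _) fun v hv hn =>
      hz' v hv fun h' => hn (Finset.mem_filter.2 ⟨hv, h'⟩)
  · exact Finset.sum_subset (Finset.filter_subset _ _) fun v hv hn => by
      rw [hz' v hv fun h' => hn (Finset.mem_filter.2 ⟨hv, h'⟩), zero_smul]

lemma hull_empty : hull ∅ = ∅ := by simp [hull]

lemma hull_singleton (v : Plane) : hull {v} = {v} := by simp [hull]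

lemma hull_pair (a b : Plane) : hull {a, b} = segment ℝ a b := by
  simp [hull, convexHull_pair]

lemma hull_inter_of_subset_pair {a b : Plane} (hab : a ≠ b) {P Q : Finset Plane}
    (hP : P ⊆ {a, b}) (hQ : Q ⊆ {a, b}) : hull P ∩ hull Q ⊆ hull (P ∩ Q) := by
  have hi : AffineIndependent ℝ ((↑) : ({a, b} : Finset Plane) → Plane) := by
    have := (affineIndependent_of_ne ℝ hab).range
    have hs : Set.range ![a, b] = (({a, b} : Finset Plane) : Set Plane) := by
      simp [Set.pair_comm]
    rw [hs] at this
    exact this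
  have := hi.convexHull_inter hP hQ
  unfold hull
  rw [← this]; simp

namespace IsBary

variable {T : Finset Plane} {b : Plane → Plane →ᵃ[ℝ] ℝ}

lemma self (hb : IsBary T b) {v : Plane} (hv : v ∈ T) : b v v = 1 := by
  rw [hb.delta v hv v hv, if_pos rfl]

lemma of_ne (hb : IsBary T b) {u v : Plane} (hu : u ∈ T) (hv : v ∈ T) (h : u ≠ v) :
    b v u = 0 := by
  rw [hb.delta u hu v hv, if_neg h]

lemma nonneg_vertex (hb : IsBary T b) {u v : Plane} (hu : u ∈ T) (hv : v ∈ T) : 0 ≤ b v u := by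
  rw [hb.delta u hu v hv]; split_ifs <;> norm_num

lemma nonneg (hb : IsBary T b) {v w : Plane} (hv : v ∈ T) (hw : w ∈ hull T) : 0 ≤ b v w :=
  nonneg_on_hull (fun _ hu => hb.nonneg_vertex hu hv) hw

lemma mem_hull (hb : IsBary T b) {w : Plane} : w ∈ hull T ↔ ∀ v ∈ T, 0 ≤ b v w :=
  ⟨fun h _ hv => hb.nonneg hv h, fun h => mem_hull_iff.2 ⟨fun v => b v w, h, hb.sum_one w,
    hb.sum_smul w⟩⟩

lemma mem_interior (hb : IsBary T b) {w : Plane} (h : ∀ v ∈ T, 0 < b v w) :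
    w ∈ interior (hull T) := by
  refine _root_.mem_interior.2 ⟨⋂ v ∈ T, b v ⁻¹' Set.Ioi 0, ?_, ?_, ?_⟩
  · intro u hu
    simp only [Set.mem_iInter, Set.mem_preimage, Set.mem_Ioi] at hu
    exact hb.mem_hull.2 fun v hv => (hu v hv).le
  · exact isOpen_biInter_finset fun v _ =>
      isOpen_Ioi.preimage (AffineMap.continuous_of_finiteDimensional _)
  · simpa using h

/-- A face of `T` contains every vertex for which some point of the face has a nonzero
coordinate. -/
lemma mem_of_ne_zero (hb : IsBary T b) {F : Finset Plane} (hF : F ⊆ T) {v w : Plane} (hv : v ∈ T)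
    (hw : w ∈ hull F) (h : b v w ≠ 0) : v ∈ F := by
  by_contra hvF
  exact h (eq_zero_on_hull (fun u hu => hb.of_ne (hF hu) hv (fun h' => hvF (h' ▸ hu))) hw)

end IsBary

/-! ### Areas -/

lemma orient_midpoint_left (z x y : Plane) :
    orient (midpoint ℝ x y) z x = orient z x y / 2 := by
  unfold orient; simp only [midpoint_apply]; ring

lemma orient_midpoint_right (z x y : Plane) :
    orient (midpoint ℝ x y) y z = orient z x y / 2 := by
  unfold orient; simp only [midpoint_apply]; ring

/-- The area of the standard triangle. -/
def stdArea : ℝ := volume.real (hull {0, EuclideanSpace.single 0 1, EuclideanSpace.single 1 1})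

lemma volume_hull_lt_top (s : Finset Plane) : volume (hull s) < ⊤ := (isCompact_hull s).measure_lt_top

/-- The linear map that takes the standard basis to `u`, `v`. -/
def frameMap (u v : Plane) : Plane →ₗ[ℝ] Plane where
  toFun w := w 0 • u + w 1 • v
  map_add' a b := by simp [add_smul]; abel
  map_smul' r a := by simp [mul_smul]

lemma det_frameMap (u v : Plane) : LinearMap.det (frameMap u v) = u 0 * v 1 - u 1 * v 0 := by
  rw [← LinearMap.det_toMatrix (EuclideanSpace.basisFun (Fin 2) ℝ).toBasis, Matrix.det_fin_two]
  simp [LinearMap.toMatrix_apply, frameMap]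
  ring

lemma volume_hull_triangle (z x y : Plane) :
    volume.real (hull {z, x, y}) = |orient z x y| * stdArea := by
  have h : hull {z, x, y} = (fun w => z + w) '' (frameMap (x - z) (y - z) ''
      hull {0, EuclideanSpace.single 0 1, EuclideanSpace.single 1 1}) := by
    let g : Plane →ᵃ[ℝ] Plane :=
      (AffineEquiv.constVAdd ℝ Plane z).toAffineMap.comp (frameMap (x - z) (y - z)).toAffineMap
    have := g.image_convexHull
      ((({0, EuclideanSpace.single 0 1, EuclideanSpace.single 1 1} : Finset Plane)) : Set Plane)
    rw [← Set.image_comp]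
    change _ = g '' _
    unfold hull
    rw [this]
    congr 1
    simp [g, Set.image_insert_eq, frameMap]
  rw [h, Measure.real, Set.image_add_left, measure_preimage_add, Measure.addHaar_image_linearMap,
    ENNReal.toReal_mul, det_frameMap, ENNReal.toReal_ofReal (abs_nonneg _)]
  rfl

lemma stdArea_pos : 0 < stdArea := by
  have h : orient (0 : Plane) (EuclideanSpace.single 0 1) (EuclideanSpace.single 1 1) ≠ 0 := by
    simp [orient]
  obtain ⟨b, hb⟩ := exists_isBary h
  have hpos : ∀ v ∈ ({0, EuclideanSpace.single 0 1, EuclideanSpace.single 1 1} : Finset Plane),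
      0 < b v (∑ u ∈ ({0, EuclideanSpace.single 0 1, EuclideanSpace.single 1 1} : Finset Plane),
        (1 / 3 : ℝ) • u) := by
    intro v hv
    have hc : ({0, EuclideanSpace.single 0 1, EuclideanSpace.single 1 1} : Finset Plane).card = 3 := by
      obtain ⟨h1, h2, h3⟩ := orient_ne_of_ne h
      rw [Finset.card_insert_of_notMem (by simp [h1, h2]), Finset.card_pair h3]
    rw [affine_apply_sum _ _ (fun _ => 1 / 3) (by simp [hc])]
    refine Finset.sum_pos' (fun u hu => mul_nonneg (by norm_num) (hb.nonneg_vertex hu hv))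
      ⟨v, hv, by rw [hb.self hv]; norm_num⟩
  have := hb.mem_interior hpos
  exact ENNReal.toReal_pos (Measure.measure_pos_of_mem_nhds volume
    (mem_interior_iff_mem_nhds.1 this)).ne' (volume_hull_lt_top _).ne

lemma volume_hull_pair (a b : Plane) : volume (hull {a, b}) = 0 := by
  have h := volume_hull_triangle a a b
  have h0 : orient a a b = 0 := by unfold orient; ring
  rw [h0] at h
  simp only [abs_zero, zero_mul, Finset.insert_eq_of_mem (Finset.mem_insert_self a {b})] at h
  exact (measureReal_eq_zero_iff (volume_hull_lt_top _).ne).1 h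

lemma volume_hull_of_card_le {F : Finset Plane} (h : F.card ≤ 2) : volume (hull F) = 0 := by
  rcases Nat.lt_or_ge F.card 2 with h' | h'
  · obtain ⟨v, hv⟩ := Finset.card_le_one_iff_subset_singleton.1 (Nat.le_of_lt_succ h')
    refine measure_mono_null (hull_mono hv) ?_
    rw [hull_singleton]; simp
  · obtain ⟨a, b, -, rfl⟩ := Finset.card_eq_two.1 (le_antisymm h h')
    exact volume_hull_pair a b

/-! ### Nodes on marked edges, conformity -/

lemma orient_ne_zero_of_affineIndependent {z x y : Plane}
    (h : AffineIndependent ℝ ((↑) : ({z, x, y} : Finset Plane) → Plane))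
    (hzx : z ≠ x) (hzy : z ≠ y) (hxy : x ≠ y) : orient z x y ≠ 0 := by
  intro h0
  have hinj : Function.Injective
      (fun i : Fin 3 => (⟨![z, x, y] i, by fin_cases i <;> simp⟩ : ({z, x, y} : Finset Plane))) := by
    intro i j hij
    have h := congrArg Subtype.val hij
    fin_cases i <;> fin_cases j <;>
      simp [hzx, hzy, hxy, hzx.symm, hzy.symm, hxy.symm] at h ⊢
  have h3 : AffineIndependent ℝ ![z, x, y] := h.comp_embedding ⟨_, hinj⟩
  rw [affineIndependent_iff_not_collinear_set] at h3
  apply h3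
  rw [collinear_iff_of_mem (p₀ := z) (by simp)]
  refine ⟨x - z, ?_⟩
  have key : ∃ r : ℝ, y = r • (x - z) + z := by
    unfold orient at h0
    by_cases hx0 : x 0 - z 0 = 0
    · have hx1 : x 1 - z 1 ≠ 0 := fun hx1 =>
        hzx (plane_ext (sub_eq_zero.1 hx0).symm (sub_eq_zero.1 hx1).symm)
      refine ⟨(y 1 - z 1) / (x 1 - z 1), plane_ext ?_ ?_⟩
      · simp
        field_simp
        linear_combination -h0
      · simp; field_simp; ring
    · refine ⟨(y 0 - z 0) / (x 0 - z 0), plane_ext ?_ ?_⟩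
      · simp; field_simp; ring
      · simp
        field_simp
        linear_combination h0
  obtain ⟨r, hr⟩ := key
  intro p hp
  simp only [Set.mem_insert_iff, Set.mem_singleton_iff] at hp
  rcases hp with rfl | rfl | rfl
  · exact ⟨0, by simp⟩
  · exact ⟨1, by simp⟩
  · exact ⟨r, by simpa using hr⟩

/-- `u` is a vertex of the simplex `T` or the midpoint of an edge of `T` that belongs to `S`. -/
def IsNode (S : Finset Plane → Prop) (T : Finset Plane) (u : Plane) : Prop :=
  u ∈ T ∨ ∃ a ∈ T, ∃ b ∈ T, a ≠ b ∧ S {a, b} ∧ u = midpoint ℝ a b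

/-- The vertices of `c` are nodes of `T`, and the edges of `T` in `S` are no edges of `c`. -/
structure Subordinate (S : Finset Plane → Prop) (T c : Finset Plane) : Prop where
  isNode : ∀ u ∈ c, IsNode S T u
  not_both : ∀ a ∈ T, ∀ b ∈ T, a ≠ b → S {a, b} → a ∈ c → b ∉ c

lemma IsNode.mem_hull {S : Finset Plane → Prop} {T : Finset Plane} {u : Plane}
    (h : IsNode S T u) : u ∈ hull T := by
  rcases h with h | ⟨a, ha, b, hb, -, -, rfl⟩
  · exact subset_hull h
  · exact midpoint_mem_hull (subset_hull ha) (subset_hull hb)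

lemma Subordinate.hull_subset {S : Finset Plane → Prop} {T c : Finset Plane}
    (h : Subordinate S T c) : hull c ⊆ hull T :=
  hull_subset_hull fun u hu => (h.isNode u hu).mem_hull

/-- The trace of a refined simplex on a face. -/
lemma Subordinate.mem_hull_face {S : Finset Plane → Prop} {T c F : Finset Plane}
    {b : Plane → Plane →ᵃ[ℝ] ℝ} (hb : IsBary T b) (hF : F ⊆ T) (hc : Subordinate S T c) {w : Plane}
    (hw : w ∈ hull c) (hwF : w ∈ hull F) : w ∈ hull (c.filter (IsNode S F)) := by
  let φ : Plane →ᵃ[ℝ] ℝ := ∑ v ∈ T \ F, b v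
  have hφ : ∀ w, φ w = ∑ v ∈ T \ F, b v w := fun w => by
    have : ∀ s : Finset Plane, (∑ v ∈ s, b v) w = ∑ v ∈ s, b v w := by
      intro s
      induction s using Finset.induction_on with
      | empty => simp
      | insert a s ha ih => rw [Finset.sum_insert ha, Finset.sum_insert ha, ← ih]; rfl
    exact this _
  have hnn : ∀ u ∈ hull T, 0 ≤ φ u := fun u hu => by
    rw [hφ]
    exact Finset.sum_nonneg fun v hv => hb.nonneg (Finset.mem_sdiff.1 hv).1 hu
  have hT : ∀ u ∈ T, φ u = 0 → u ∈ F := by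
    intro u hu h0
    by_contra hn
    rw [hφ, Finset.sum_eq_zero_iff_of_nonneg
      fun v hv => hb.nonneg_vertex hu (Finset.mem_sdiff.1 hv).1] at h0
    have := h0 u (Finset.mem_sdiff.2 ⟨hu, hn⟩)
    rw [hb.self hu] at this
    exact one_ne_zero this
  have h0 : φ w = 0 := by
    refine eq_zero_on_hull (fun u hu => ?_) hwF
    rw [hφ]
    refine Finset.sum_eq_zero fun v hv => hb.of_ne (hF hu) (Finset.mem_sdiff.1 hv).1 ?_
    rintro rfl
    exact (Finset.mem_sdiff.1 hv).2 hu
  refine hull_mono ?_ (mem_hull_filter (fun v hv => hnn v (hc.isNode v hv).mem_hull) hw h0)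
  intro u hu
  obtain ⟨huc, hu0⟩ := Finset.mem_filter.1 hu
  refine Finset.mem_filter.2 ⟨huc, ?_⟩
  rcases hc.isNode u huc with h | ⟨p, hp, q, hq, hpq, hS, rfl⟩
  · exact Or.inl (hT u h hu0)
  · rw [affine_apply_midpoint] at hu0
    have h1 := hnn p (subset_hull hp)
    have h2 := hnn q (subset_hull hq)
    exact Or.inr ⟨p, hT p hp (by linarith), q, hT q hq (by linarith), hpq, hS, rfl⟩

lemma hull_inter_of_separated {a m b : Plane} {φ : Plane →ᵃ[ℝ] ℝ} (ha : 0 < φ a) (hm : φ m = 0)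
    (hb : φ b < 0) {P Q : Finset Plane} (hP : P ⊆ {a, m}) (hQ : Q ⊆ {m, b}) :
    hull P ∩ hull Q ⊆ hull (P ∩ Q) := by
  rintro w ⟨hwP, hwQ⟩
  have h1 : ∀ v ∈ P, 0 ≤ φ v := by
    intro v hv
    have := hP hv
    simp only [Finset.mem_insert, Finset.mem_singleton] at this
    rcases this with rfl | rfl
    exacts [ha.le, hm.ge]
  have h2 : ∀ v ∈ Q, 0 ≤ (-φ) v := by
    intro v hv
    have := hQ hv
    simp only [Finset.mem_insert, Finset.mem_singleton] at this
    change 0 ≤ -φ v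
    rcases this with rfl | rfl <;> linarith
  have hw0 : φ w = 0 := le_antisymm
    (by have := nonneg_on_hull h2 hwQ; change 0 ≤ -φ w at this; linarith) (nonneg_on_hull h1 hwP)
  have h3 := mem_hull_filter h1 hwP hw0
  have h4 := mem_hull_filter h2 hwQ (by change -φ w = 0; linarith)
  have e1 : (P.filter fun v => φ v = 0) ⊆ {m} ∩ P := by
    intro v hv
    obtain ⟨hv, hv0⟩ := Finset.mem_filter.1 hv
    have := hP hv
    simp only [Finset.mem_insert, Finset.mem_singleton] at this
    rcases this with rfl | rfl
    · exact absurd hv0 ha.ne'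
    · simp [hv]
  have e2 : (Q.filter fun v => (-φ) v = 0) ⊆ {m} ∩ Q := by
    intro v hv
    obtain ⟨hv, hv0⟩ := Finset.mem_filter.1 hv
    have := hQ hv
    change -φ v = 0 at hv0
    simp only [Finset.mem_insert, Finset.mem_singleton] at this
    rcases this with rfl | rfl
    · simp [hv]
    · exact absurd hv0 (by linarith)
  have h3 := hull_mono e1 h3
  have h4 := hull_mono e2 h4
  by_cases hmP : m ∈ P
  · by_cases hmQ : m ∈ Q
    · rw [Finset.singleton_inter_of_mem hmP] at h3
      exact hull_mono (by simp [hmP, hmQ]) h3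
    · rw [Finset.singleton_inter_of_notMem hmQ, hull_empty] at h4
      exact h4.elim
  · rw [Finset.singleton_inter_of_notMem hmP, hull_empty] at h3
    exact h3.elim

/-- Refinement preserves the conformity of two different elements. -/
lemma hull_inter_subset_of_subordinate {S : Finset Plane → Prop} {T T' c c' : Finset Plane}
    {b b' : Plane → Plane →ᵃ[ℝ] ℝ} (hb : IsBary T b) (hb' : IsBary T' b')
    (hconf : hull T ∩ hull T' ⊆ hull (T ∩ T')) (hcard : (T ∩ T').card ≤ 2)
    (hc : Subordinate S T c) (hc' : Subordinate S T' c') :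
    hull c ∩ hull c' ⊆ hull (c ∩ c') := by
  rintro w ⟨hw, hw'⟩
  have hF : T ∩ T' ⊆ T := Finset.inter_subset_left
  have hF' : T ∩ T' ⊆ T' := Finset.inter_subset_right
  have hwF := hconf ⟨hc.hull_subset hw, hc'.hull_subset hw'⟩
  generalize T ∩ T' = F at *
  have hP := hc.mem_hull_face hb hF hw hwF
  have hQ := hc'.mem_hull_face hb' hF' hw' hwF
  suffices h : w ∈ hull (c.filter (IsNode S F) ∩ c'.filter (IsNode S F)) from
    hull_mono (Finset.inter_subset_inter (Finset.filter_subset _ _) (Finset.filter_subset _ _)) h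
  have hPn : ∀ u ∈ c.filter (IsNode S F), IsNode S F u := fun u hu => (Finset.mem_filter.1 hu).2
  have hQn : ∀ u ∈ c'.filter (IsNode S F), IsNode S F u := fun u hu => (Finset.mem_filter.1 hu).2
  have hPb : ∀ a ∈ F, ∀ b ∈ F, a ≠ b → S {a, b} → a ∈ c.filter (IsNode S F) →
      b ∉ c.filter (IsNode S F) := fun a ha b hb hab hS h1 h2 =>
    hc.not_both a (hF ha) b (hF hb) hab hS (Finset.mem_filter.1 h1).1 (Finset.mem_filter.1 h2).1
  have hQb : ∀ a ∈ F, ∀ b ∈ F, a ≠ b → S {a, b} → a ∈ c'.filter (IsNode S F) →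
      b ∉ c'.filter (IsNode S F) := fun a ha b hb hab hS h1 h2 =>
    hc'.not_both a (hF' ha) b (hF' hb) hab hS (Finset.mem_filter.1 h1).1 (Finset.mem_filter.1 h2).1
  generalize c.filter (IsNode S F) = P at *
  generalize c'.filter (IsNode S F) = Q at *
  rcases Nat.lt_or_ge F.card 2 with h2 | h2
  · obtain ⟨v, hv⟩ := Finset.card_le_one_iff_subset_singleton.1 (Nat.le_of_lt_succ h2)
    have hn : ∀ u, IsNode S F u → u = v := by
      rintro u (h | ⟨p, hp, q, hq, hpq, -, -⟩)
      · exact Finset.mem_singleton.1 (hv h)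
      · exact absurd ((Finset.mem_singleton.1 (hv hp)).trans (Finset.mem_singleton.1 (hv hq)).symm) hpq
    rcases P.eq_empty_or_nonempty with rfl | ⟨p, hp⟩
    · rw [hull_empty] at hP; exact hP.elim
    rcases Q.eq_empty_or_nonempty with rfl | ⟨q, hq⟩
    · rw [hull_empty] at hQ; exact hQ.elim
    have hpv := hn p (hPn p hp)
    have hqv := hn q (hQn q hq)
    subst hpv
    subst hqv
    refine hull_mono (fun u hu => ?_) hP
    rw [hn u (hPn u hu)]
    exact Finset.mem_inter.2 ⟨hp, hq⟩
  · obtain ⟨p, q, hpq, rfl⟩ := Finset.card_eq_two.1 (le_antisymm hcard h2)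
    have hn : ∀ u, IsNode S {p, q} u → u = p ∨ u = q ∨ (S {p, q} ∧ u = midpoint ℝ p q) := by
      rintro u (h | ⟨p', hp', q', hq', hpq', hS, rfl⟩)
      · simp only [Finset.mem_insert, Finset.mem_singleton] at h
        tauto
      · simp only [Finset.mem_insert, Finset.mem_singleton] at hp' hq'
        rcases hp' with rfl | rfl <;> rcases hq' with rfl | rfl
        · exact absurd rfl hpq'
        · exact Or.inr (Or.inr ⟨hS, rfl⟩)
        · exact Or.inr (Or.inr ⟨by rwa [Finset.pair_comm], midpoint_comm _ _⟩)
        · exact absurd rfl hpq'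
    by_cases hS : S {p, q}
    · have hp : p ∈ T := hF (by simp)
      have hq : q ∈ T := hF (by simp)
      have key : ∀ R : Finset Plane, (∀ u ∈ R, IsNode S {p, q} u) →
          (∀ a ∈ ({p, q} : Finset Plane), ∀ b ∈ ({p, q} : Finset Plane), a ≠ b → S {a, b} →
            a ∈ R → b ∉ R) → R ⊆ {p, midpoint ℝ p q} ∨ R ⊆ {midpoint ℝ p q, q} := by
        intro R hR hRb
        by_cases hpR : p ∈ R
        · left
          have hqR := hRb p (by simp) q (by simp) hpq hS hpR
          intro u hu
          rcases hn u (hR u hu) with rfl | rfl | ⟨-, rfl⟩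
          · simp
          · exact absurd hu hqR
          · simp
        · right
          intro u hu
          rcases hn u (hR u hu) with rfl | rfl | ⟨-, rfl⟩
          · exact absurd hu hpR
          · simp
          · simp
      let φ : Plane →ᵃ[ℝ] ℝ := b p - b q
      have hφ : ∀ u, φ u = b p u - b q u := fun u => rfl
      have h1 : φ p = 1 := by rw [hφ, hb.self hp, hb.of_ne hp hq hpq]; norm_num
      have h2 : φ q = -1 := by rw [hφ, hb.self hq, hb.of_ne hq hp hpq.symm]; norm_num
      have h3 : φ (midpoint ℝ p q) = 0 := by rw [affine_apply_midpoint, h1, h2]; norm_num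
      have hpm : p ≠ midpoint ℝ p q := fun h => by rw [← h, h1] at h3; norm_num at h3
      have hmq : midpoint ℝ p q ≠ q := fun h => by rw [h, h2] at h3; norm_num at h3
      rcases key P hPn hPb with hP1 | hP1 <;> rcases key Q hQn hQb with hQ1 | hQ1
      · exact hull_inter_of_subset_pair hpm hP1 hQ1 ⟨hP, hQ⟩
      · exact hull_inter_of_separated (h1 ▸ one_pos) h3 (by rw [h2]; norm_num) hP1 hQ1 ⟨hP, hQ⟩
      · rw [Finset.inter_comm]
        exact hull_inter_of_separated (h1 ▸ one_pos) h3 (by rw [h2]; norm_num) hQ1 hP1 ⟨hQ, hP⟩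
      · exact hull_inter_of_subset_pair hmq hP1 hQ1 ⟨hP, hQ⟩
    · have key : ∀ R : Finset Plane, (∀ u ∈ R, IsNode S {p, q} u) → R ⊆ {p, q} := by
        intro R hR u hu
        rcases hn u (hR u hu) with rfl | rfl | ⟨h, -⟩
        · simp
        · simp
        · exact absurd h hS
      exact hull_inter_of_subset_pair hpq (key P hPn) (key Q hQn) ⟨hP, hQ⟩

/-! ### Bisection of one element -/

/-- The midpoint of an edge. -/
def mid (E : Finset Plane) : Plane := E.centroid ℝ id

lemma mid_pair (a b : Plane) : mid {a, b} = midpoint ℝ a b := by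
  unfold mid
  rw [Finset.centroid_pair, midpoint_comm, midpoint_eq_smul_add]
  apply plane_ext <;> simp <;> ring

/-- The parts of the edge `E` in the refined mesh. -/
def subEdges (S : Finset Plane → Prop) (E : Finset Plane) : Finset (Finset Plane) :=
  if S E then E.image fun v => {v, mid E} else {E}

/-- The new edges inside of a refined element. -/
def innerEdges (S : Finset Plane → Prop) (p : RefTriangle) : Finset (Finset Plane) :=
  ((refineElement S p).biUnion fun c => c.1.powersetCard 2) \
    (p.1.powersetCard 2).biUnion (subEdges S)

/-- The part of the refined triangle `z, x, y` in its son with the vertices `m, z, w`, for `m` the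
midpoint of the reference edge and `w` one of its endpoints. -/
def sideChildren (S : Finset Plane → Prop) (z m w : Plane) : Finset RefTriangle :=
  if S {z, w} then {({midpoint ℝ z w, m, w}, {m, w}), ({midpoint ℝ z w, m, z}, {m, z})}
  else {({m, z, w}, {z, w})}

lemma powersetCard_two_triple {a b c : Plane} {E : Finset Plane}
    (h : E ∈ ({a, b, c} : Finset Plane).powersetCard 2) : E = {a, b} ∨ E = {a, c} ∨ E = {b, c} := by
  obtain ⟨hE, hc⟩ := Finset.mem_powersetCard.1 h
  obtain ⟨p, q, hpq, rfl⟩ := Finset.card_eq_two.1 hc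
  have hp := hE (Finset.mem_insert_self p _)
  have hq := hE (Finset.mem_insert_of_mem (Finset.mem_singleton_self q))
  simp only [Finset.mem_insert, Finset.mem_singleton] at hp hq
  rcases hp with rfl | rfl | rfl <;> rcases hq with rfl | rfl | rfl <;>
    simp_all [Finset.pair_comm]

lemma pair_mem_powersetCard {T : Finset Plane} {a b : Plane} (ha : a ∈ T) (hb : b ∈ T)
    (hab : a ≠ b) : {a, b} ∈ T.powersetCard 2 :=
  Finset.mem_powersetCard.2 ⟨by simp [Finset.insert_subset_iff, ha, hb], Finset.card_pair hab⟩

/-- The nodes of a triangle are different. -/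
lemma nodes_ne {z x y : Plane} (h : orient z x y ≠ 0) :
    (z ≠ x ∧ z ≠ y ∧ x ≠ y) ∧
    (midpoint ℝ x y ≠ z ∧ midpoint ℝ x y ≠ x ∧ midpoint ℝ x y ≠ y) ∧
    (midpoint ℝ z x ≠ z ∧ midpoint ℝ z x ≠ x ∧ midpoint ℝ z x ≠ y) ∧
    (midpoint ℝ z y ≠ z ∧ midpoint ℝ z y ≠ x ∧ midpoint ℝ z y ≠ y) ∧
    midpoint ℝ z x ≠ midpoint ℝ x y ∧ midpoint ℝ z y ≠ midpoint ℝ x y ∧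
    midpoint ℝ z x ≠ midpoint ℝ z y := by
  obtain ⟨h1, h2, h3⟩ := orient_ne_of_ne h
  obtain ⟨b, hb⟩ := exists_isBary h
  have e := hb.delta
  have key : ∀ u v : Plane, u = v → ∀ w, b w u = b w v := fun u v h w => by rw [h]
  simp only [Finset.mem_insert, Finset.mem_singleton, forall_eq_or_imp, forall_eq, h1, h2, h3,
    h1.symm, h2.symm, h3.symm, if_true, if_false] at e
  obtain ⟨⟨a1, a2, a3⟩, ⟨a4, a5, a6⟩, a7, a8, a9⟩ := e
  refine ⟨⟨h1, h2, h3⟩, ⟨?_, ?_, ?_⟩, ⟨?_, ?_, ?_⟩, ⟨?_, ?_, ?_⟩, ?_, ?_, ?_⟩ <;> intro hh <;>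
    have k1 := key _ _ hh z <;> have k2 := key _ _ hh x <;> have k3 := key _ _ hh y <;>
    simp only [affine_apply_midpoint] at k1 k2 k3 <;> linarith

lemma bisect_eq {a u v : Plane} (h : orient a u v ≠ 0) :
    bisect ({a, u, v}, {u, v}) = {({midpoint ℝ u v, a, v}, {a, v}),
      ({midpoint ℝ u v, a, u}, {a, u})} := by
  obtain ⟨h1, h2, h3⟩ := orient_ne_of_ne h
  have e1 : ({a, u, v} : Finset Plane).erase u = {a, v} := by
    ext w; simp only [Finset.mem_erase, Finset.mem_insert, Finset.mem_singleton]
    constructor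
    · tauto
    · rintro (rfl | rfl) <;> simp [h1, h3.symm]
  have e2 : ({a, u, v} : Finset Plane).erase v = {a, u} := by
    ext w; simp only [Finset.mem_erase, Finset.mem_insert, Finset.mem_singleton]
    constructor
    · tauto
    · rintro (rfl | rfl) <;> simp [h2, h3]
  unfold bisect
  have e3 : Finset.centroid ℝ ({u, v} : Finset Plane) id = midpoint ℝ u v := mid_pair u v
  simp only [Finset.image_insert, Finset.image_singleton, e1, e2, e3]

lemma orient_son {z x y w : Plane} (h : orient z x y ≠ 0) (hw : w = x ∨ w = y) :
    |orient (midpoint ℝ x y) z w| = |orient z x y| / 2 := by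
  rcases hw with rfl | rfl
  · rw [orient_midpoint_left, abs_div]; norm_num
  · rw [orient_swap, orient_midpoint_right, abs_neg, abs_div]; norm_num

lemma orient_son_ne {z x y w : Plane} (h : orient z x y ≠ 0) (hw : w = x ∨ w = y) :
    orient (midpoint ℝ x y) z w ≠ 0 := by
  rw [← abs_pos, orient_son h hw]
  have := abs_pos.2 h
  linarith

lemma refineElement_of_not {S : Finset Plane → Prop} {p : RefTriangle} (h : ¬ S p.2) :
    refineElement S p = {p} := if_neg h

lemma refineElement_eq {S : Finset Plane → Prop} {z x y : Plane} (h : orient z x y ≠ 0)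
    (hS : S {x, y}) : refineElement S ({z, x, y}, {x, y}) =
      sideChildren S z (midpoint ℝ x y) y ∪ sideChildren S z (midpoint ℝ x y) x := by
  unfold refineElement
  rw [if_pos hS, bisect_eq h, Finset.biUnion_insert, Finset.singleton_biUnion]
  unfold sideChildren
  rw [bisect_eq (orient_son_ne h (Or.inl rfl)), bisect_eq (orient_son_ne h (Or.inr rfl))]

lemma triangle_swap (z x y : Plane) :
    (({z, x, y}, {x, y}) : RefTriangle) = ({z, y, x}, {y, x}) := by
  simp [Finset.pair_comm]

/-- The shape of an element `p` with the vertices `z`, `x`, `y` and the reference edge `x, y`. -/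
structure IsShape (κ : ℝ) (p : RefTriangle) (z x y : Plane) : Prop where
  eq : p = ({z, x, y}, {x, y})
  ne : orient z x y ≠ 0
  le : dist x z ^ 2 + dist y z ^ 2 ≤ κ * |orient z x y|

lemma IsShape.swap {κ : ℝ} {p : RefTriangle} {z x y : Plane} (h : IsShape κ p z x y) :
    IsShape κ p z y x :=
  ⟨by rw [h.eq, triangle_swap], by rw [orient_swap]; exact neg_ne_zero.2 h.ne,
    by rw [orient_swap, abs_neg, add_comm]; exact h.le⟩

lemma dist_sq_plane (a b : Plane) : dist a b ^ 2 = (a 0 - b 0) ^ 2 + (a 1 - b 1) ^ 2 := by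
  rw [EuclideanSpace.dist_eq, Real.sq_sqrt (by positivity)]
  simp [Real.dist_eq, sq_abs]

/-- Bisection preserves the shape constant. -/
lemma IsShape.son {κ : ℝ} {p : RefTriangle} {z x y w : Plane} (h : IsShape κ p z x y)
    (hw : w = x ∨ w = y) :
    IsShape κ ({midpoint ℝ x y, z, w}, {z, w}) (midpoint ℝ x y) z w := by
  refine ⟨rfl, orient_son_ne h.ne hw, ?_⟩
  rw [orient_son h.ne hw]
  have := h.le
  simp only [dist_sq_plane, midpoint_apply] at this ⊢
  rcases hw with rfl | rfl <;> linarith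

lemma IsShape.child {κ : ℝ} {S : Finset Plane → Prop} {p c : RefTriangle} {z x y w : Plane}
    (h : IsShape κ p z x y) (hw : w = x ∨ w = y) (hc : c ∈ sideChildren S z (midpoint ℝ x y) w) :
    ∃ z' x' y', IsShape κ c z' x' y' ∧
      |orient z' x' y'| = |orient z x y| / (if S {z, w} then 4 else 2) := by
  unfold sideChildren at hc
  have h1 := h.son hw
  have e := orient_son h.ne hw
  split_ifs at hc with hS
  · rw [if_pos hS]
    simp only [Finset.mem_insert, Finset.mem_singleton] at hc
    rcases hc with rfl | rfl
    · exact ⟨_, _, _, h1.son (Or.inr rfl), by rw [orient_son h1.ne (Or.inr rfl), e]; ring⟩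
    · exact ⟨_, _, _, h1.son (Or.inl rfl), by rw [orient_son h1.ne (Or.inl rfl), e]; ring⟩
  · rw [if_neg hS]
    rw [Finset.mem_singleton.1 hc]
    exact ⟨_, _, _, h1, e⟩

lemma IsShape.area {κ : ℝ} {p : RefTriangle} {z x y : Plane} (h : IsShape κ p z x y) :
    volume.real (hull p.1) = |orient z x y| * stdArea := by
  rw [h.eq, volume_hull_triangle]

lemma IsShape.card {κ : ℝ} {p : RefTriangle} {z x y : Plane} (h : IsShape κ p z x y) :
    p.1.card = 3 := by
  obtain ⟨h1, h2, h3⟩ := orient_ne_of_ne h.ne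
  rw [h.eq, Finset.card_insert_of_notMem (by simp [h1, h2]), Finset.card_pair h3]

lemma IsShape.area_pos {κ : ℝ} {p : RefTriangle} {z x y : Plane} (h : IsShape κ p z x y) :
    0 < volume.real (hull p.1) := by
  rw [h.area]
  exact mul_pos (abs_pos.2 h.ne) stdArea_pos

/-- The two sons of a triangle. -/
lemma hull_sons_inter {z x y : Plane} (h : orient z x y ≠ 0) :
    hull {midpoint ℝ x y, z, x} ∩ hull {midpoint ℝ x y, z, y} ⊆ hull {midpoint ℝ x y, z} := by
  rintro w ⟨hw, hw'⟩
  obtain ⟨h1, h2, h3⟩ := orient_ne_of_ne h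
  obtain ⟨b, hb⟩ := exists_isBary h
  let φ : Plane →ᵃ[ℝ] ℝ := b x - b y
  have hφ : ∀ u, φ u = b x u - b y u := fun u => rfl
  have ex : φ x = 1 := by
    rw [hφ, hb.self (by simp), hb.of_ne (by simp) (by simp) h3]; norm_num
  have ey : φ y = -1 := by
    rw [hφ, hb.self (by simp), hb.of_ne (by simp) (by simp) h3.symm]; norm_num
  have ez : φ z = 0 := by
    rw [hφ, hb.of_ne (by simp) (by simp) h1, hb.of_ne (by simp) (by simp) h2]; norm_num
  have em : φ (midpoint ℝ x y) = 0 := by rw [affine_apply_midpoint, ex, ey]; norm_num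
  have p1 : ∀ v ∈ ({midpoint ℝ x y, z, x} : Finset Plane), 0 ≤ φ v := by
    intro v hv
    simp only [Finset.mem_insert, Finset.mem_singleton] at hv
    rcases hv with rfl | rfl | rfl
    exacts [em.ge, ez.ge, ex ▸ zero_le_one]
  have p2 : ∀ v ∈ ({midpoint ℝ x y, z, y} : Finset Plane), 0 ≤ (-φ) v := by
    intro v hv
    change 0 ≤ -φ v
    simp only [Finset.mem_insert, Finset.mem_singleton] at hv
    rcases hv with rfl | rfl | rfl <;> linarith
  have h0 : φ w = 0 := le_antisymm
    (by have := nonneg_on_hull p2 hw'; change 0 ≤ -φ w at this; linarith) (nonneg_on_hull p1 hw)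
  refine hull_mono ?_ (mem_hull_filter p1 hw h0)
  intro v hv
  obtain ⟨hv, hv0⟩ := Finset.mem_filter.1 hv
  simp only [Finset.mem_insert, Finset.mem_singleton] at hv ⊢
  rcases hv with rfl | rfl | rfl
  · simp
  · simp
  · rw [ex] at hv0; exact absurd hv0 one_ne_zero

lemma hull_sons_union {z x y : Plane} (h : orient z x y ≠ 0) :
    hull {midpoint ℝ x y, z, x} ∪ hull {midpoint ℝ x y, z, y} = hull {z, x, y} := by
  apply Set.Subset.antisymm
  · have hm : midpoint ℝ x y ∈ hull {z, x, y} :=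
      midpoint_mem_hull (subset_hull (by simp)) (subset_hull (by simp))
    have hv : ∀ v ∈ ({z, x, y} : Finset Plane), v ∈ hull {z, x, y} := fun v hv => subset_hull hv
    refine Set.union_subset (hull_subset_hull ?_) (hull_subset_hull ?_) <;>
    · intro v hv'
      simp only [Finset.mem_insert, Finset.mem_singleton] at hv'
      rcases hv' with rfl | rfl | rfl
      exacts [hm, hv _ (by simp), hv _ (by simp)]
  · intro w hw
    obtain ⟨h1, h2, h3⟩ := orient_ne_of_ne h
    obtain ⟨⟨-, -, -⟩, ⟨m1, m2, m3⟩, -⟩ := nodes_ne h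
    obtain ⟨b, hb⟩ := exists_isBary h
    have hs := hb.sum_one w
    have hsm := hb.sum_smul w
    have hnn := hb.mem_hull.1 hw
    rw [Finset.sum_insert (by simp [h1, h2]), Finset.sum_pair h3] at hs hsm
    have nz := hnn z (by simp)
    have nx := hnn x (by simp)
    have ny := hnn y (by simp)
    generalize b z w = α at *
    generalize b x w = β at *
    generalize b y w = γ at *
    rcases le_total γ β with hle | hle
    · left
      refine mem_hull_iff.2 ⟨fun v => if v = midpoint ℝ x y then 2 * γ else if v = z then α
        else β - γ, ?_, ?_, ?_⟩
      · intro v _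
        dsimp only
        split_ifs <;> linarith
      · rw [Finset.sum_insert (by simp [m1, m2]), Finset.sum_pair h1]
        simp [m1.symm, m2.symm, h1.symm]
        linarith
      · rw [Finset.sum_insert (by simp [m1, m2]), Finset.sum_pair h1]
        simp [m1.symm, m2.symm, h1.symm]
        rw [← hsm]
        apply plane_ext <;> simp [midpoint_apply] <;> ring
    · right
      refine mem_hull_iff.2 ⟨fun v => if v = midpoint ℝ x y then 2 * β else if v = z then α
        else γ - β, ?_, ?_, ?_⟩
      · intro v _
        dsimp only
        split_ifs <;> linarith
      · rw [Finset.sum_insert (by simp [m1, m3]), Finset.sum_pair h2]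
        simp [m1.symm, m3.symm, h2.symm]
        linarith
      · rw [Finset.sum_insert (by simp [m1, m3]), Finset.sum_pair h2]
        simp [m1.symm, m3.symm, h2.symm]
        rw [← hsm]
        apply plane_ext <;> simp [midpoint_apply] <;> ring

lemma iUnion_hull_sideChildren {S : Finset Plane → Prop} {z m w : Plane} (h : orient m z w ≠ 0) :
    ⋃ c ∈ sideChildren S z m w, hull c.1 = hull {m, z, w} := by
  unfold sideChildren
  split_ifs
  · simp only [Finset.mem_insert, Finset.mem_singleton, Set.iUnion_iUnion_eq_or_left,
      Set.iUnion_iUnion_eq_left]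
    rw [Set.union_comm, hull_sons_union h]
  · simp

lemma iUnion_hull_refineElement {κ : ℝ} {S : Finset Plane → Prop} {p : RefTriangle} {z x y : Plane}
    (h : IsShape κ p z x y) : ⋃ c ∈ refineElement S p, hull c.1 = hull p.1 := by
  by_cases hS : S p.2
  · have e := h.eq
    subst e
    rw [refineElement_eq h.ne hS, Finset.set_biUnion_union,
      iUnion_hull_sideChildren (orient_son_ne h.ne (Or.inl rfl)),
      iUnion_hull_sideChildren (orient_son_ne h.ne (Or.inr rfl)), Set.union_comm,
      hull_sons_union h.ne]
  · rw [refineElement_of_not hS]; simp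

lemma hull_child_subset {κ : ℝ} {S : Finset Plane → Prop} {p c : RefTriangle} {z x y : Plane}
    (h : IsShape κ p z x y) (hc : c ∈ refineElement S p) : hull c.1 ⊆ hull p.1 := by
  rw [← iUnion_hull_refineElement (S := S) h]
  exact Set.subset_biUnion_of_mem (u := fun c : RefTriangle => hull c.1) hc

set_option linter.unusedSimpArgs false

/-! ### The children of one element -/

lemma mem_refineElement {S : Finset Plane → Prop} {z x y : Plane} (h : orient z x y ≠ 0)
    (hS : S {x, y}) {c : RefTriangle} (hc : c ∈ refineElement S ({z, x, y}, {x, y})) :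
    ∃ w, (w = x ∨ w = y) ∧ c ∈ sideChildren S z (midpoint ℝ x y) w := by
  rw [refineElement_eq h hS, Finset.mem_union] at hc
  rcases hc with hc | hc
  exacts [⟨y, Or.inr rfl, hc⟩, ⟨x, Or.inl rfl, hc⟩]

lemma IsShape.exists_child {κ : ℝ} {S : Finset Plane → Prop} {p c : RefTriangle} {z x y : Plane}
    (h : IsShape κ p z x y) (hc : c ∈ refineElement S p) : ∃ z' x' y', IsShape κ c z' x' y' := by
  by_cases hS : S p.2
  · have e := h.eq
    subst e
    obtain ⟨w, hw, hcw⟩ := mem_refineElement h.ne hS hc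
    obtain ⟨z', x', y', h', -⟩ := h.child hw hcw
    exact ⟨z', x', y', h'⟩
  · rw [refineElement_of_not hS, Finset.mem_singleton] at hc
    exact ⟨z, x, y, hc ▸ h⟩

lemma IsShape.area_child_le {κ : ℝ} {S : Finset Plane → Prop} {p c : RefTriangle} {z x y : Plane}
    (h : IsShape κ p z x y) (hS : S p.2) (hc : c ∈ refineElement S p) :
    volume.real (hull c.1) ≤ volume.real (hull p.1) / 2 := by
  have e := h.eq
  subst e
  obtain ⟨w, hw, hcw⟩ := mem_refineElement h.ne hS hc
  obtain ⟨z', x', y', h', e⟩ := h.child hw hcw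
  rw [h'.area, h.area, e, mul_div_right_comm]
  refine mul_le_mul_of_nonneg_right ?_ stdArea_pos.le
  have := abs_nonneg (orient z x y)
  split_ifs <;> linarith

lemma pair_subset_triple {a b p q r : Plane} : ({a, b} : Finset Plane) ⊆ {p, q, r} ↔
    (a = p ∨ a = q ∨ a = r) ∧ (b = p ∨ b = q ∨ b = r) := by
  simp [Finset.insert_subset_iff]

lemma subordinate_side {S : Finset Plane → Prop} {z m w : Plane} {c : RefTriangle}
    (hmz : m ≠ z) (hmw : m ≠ w) (hzw : z ≠ w) (h1 : midpoint ℝ z w ≠ z) (h2 : midpoint ℝ z w ≠ w)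
    (hm : ∀ E, S E → m ∉ E) (hc : c ∈ sideChildren S z m w) : Subordinate S {m, z, w} c.1 := by
  unfold sideChildren at hc
  have hnb : ∀ a b : Plane, a ∈ ({m, z, w} : Finset Plane) → b ∈ ({m, z, w} : Finset Plane) →
      a ≠ b → S {a, b} → S {z, w} ∧ ((a = z ∧ b = w) ∨ (a = w ∧ b = z)) := by
    intro a b ha hb hab hS
    have hma := hm _ hS
    simp only [Finset.mem_insert, Finset.mem_singleton] at ha hb hma
    push Not at hma
    rcases ha with rfl | rfl | rfl
    · exact absurd rfl hma.1
    · rcases hb with rfl | rfl | rfl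
      · exact absurd rfl hma.2
      · exact absurd rfl hab
      · exact ⟨hS, Or.inl ⟨rfl, rfl⟩⟩
    · rcases hb with rfl | rfl | rfl
      · exact absurd rfl hma.2
      · exact ⟨by rwa [Finset.pair_comm], Or.inr ⟨rfl, rfl⟩⟩
      · exact absurd rfl hab
  split_ifs at hc with hS
  · have hn : IsNode S {m, z, w} (midpoint ℝ z w) :=
      Or.inr ⟨z, by simp, w, by simp, hzw, hS, rfl⟩
    simp only [Finset.mem_insert, Finset.mem_singleton] at hc
    rcases hc with rfl | rfl
    · refine ⟨?_, ?_⟩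
      · intro u hu
        simp only [Finset.mem_insert, Finset.mem_singleton] at hu
        rcases hu with rfl | rfl | rfl
        exacts [hn, Or.inl (by simp), Or.inl (by simp)]
      · intro a ha b hb hab hSab hac hbc
        obtain ⟨-, ⟨rfl, rfl⟩ | ⟨rfl, rfl⟩⟩ := hnb a b ha hb hab hSab <;>
          simp [hmz.symm, hzw, h1.symm] at hac hbc
    · refine ⟨?_, ?_⟩
      · intro u hu
        simp only [Finset.mem_insert, Finset.mem_singleton] at hu
        rcases hu with rfl | rfl | rfl
        exacts [hn, Or.inl (by simp), Or.inl (by simp)]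
      · intro a ha b hb hab hSab hac hbc
        obtain ⟨-, ⟨rfl, rfl⟩ | ⟨rfl, rfl⟩⟩ := hnb a b ha hb hab hSab <;>
          simp [hmw.symm, hzw.symm, h2.symm] at hac hbc
  · rw [Finset.mem_singleton.1 hc]
    exact ⟨fun u hu => Or.inl hu, fun a ha b hb hab hSab _ _ => hS (hnb a b ha hb hab hSab).1⟩

lemma Subordinate.of_side {S : Finset Plane → Prop} {z x y w : Plane} {c : Finset Plane}
    (h : orient z x y ≠ 0) (hS : S {x, y}) (hw : w = x ∨ w = y)
    (hc : Subordinate S {midpoint ℝ x y, z, w} c)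
    (hm : ∀ E, S E → midpoint ℝ x y ∉ E) : Subordinate S {z, x, y} c := by
  obtain ⟨⟨n1, n2, n3⟩, ⟨n4, n5, n6⟩, ⟨n7, n8, n9⟩, ⟨n10, n11, n12⟩, n13, n14, n15⟩ := nodes_ne h
  have hwT : w ∈ ({z, x, y} : Finset Plane) := by rcases hw with rfl | rfl <;> simp
  have hsub : ∀ a, a ∈ ({midpoint ℝ x y, z, w} : Finset Plane) → a ≠ midpoint ℝ x y →
      a ∈ ({z, x, y} : Finset Plane) := by
    intro a ha ham
    simp only [Finset.mem_insert, Finset.mem_singleton] at ha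
    rcases ha with rfl | rfl | rfl
    exacts [absurd rfl ham, by simp, hwT]
  refine ⟨?_, ?_⟩
  · intro u hu
    rcases hc.isNode u hu with h' | ⟨a, ha, b, hb, hab, hSab, rfl⟩
    · by_cases hum : u = midpoint ℝ x y
      · exact Or.inr ⟨x, by simp, y, by simp, n3, hS, hum⟩
      · exact Or.inl (hsub u h' hum)
    · have hma := hm _ hSab
      simp only [Finset.mem_insert, Finset.mem_singleton] at hma
      push Not at hma
      exact Or.inr ⟨a, hsub a ha hma.1.symm, b, hsub b hb hma.2.symm, hab, hSab, rfl⟩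
  · intro a ha b hb hab hSab hac hbc
    have hv : ∀ v, v ∈ ({z, x, y} : Finset Plane) → v ∈ c → v = z ∨ v = w := by
      intro v hv hvc
      rcases hc.isNode v hvc with h' | ⟨a', ha', b', hb', hab', hSab', rfl⟩
      · simp only [Finset.mem_insert, Finset.mem_singleton] at h' hv
        rcases h' with rfl | h' | h'
        · rcases hv with hv | hv | hv
          exacts [absurd hv n4, absurd hv n5, absurd hv n6]
        · exact Or.inl h'
        · exact Or.inr h'
      · exfalso
        have hma := hm _ hSab'
        simp only [Finset.mem_insert, Finset.mem_singleton] at hma ha' hb' hv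
        push Not at hma
        have hzw : ∀ t : Plane, t = z → (midpoint ℝ t w = z ∨ midpoint ℝ t w = x ∨
            midpoint ℝ t w = y) → False := by
          rintro t rfl ht
          rcases hw with rfl | rfl <;> rcases ht with ht | ht | ht <;> contradiction
        rcases ha' with ha' | ha' | ha'
        · exact hma.1 ha'.symm
        · rcases hb' with hb' | hb' | hb'
          · exact hma.2 hb'.symm
          · exact hab' (ha'.trans hb'.symm)
          · subst hb'; exact hzw _ ha' hv
        · rcases hb' with hb' | hb' | hb'
          · exact hma.2 hb'.symm
          · subst ha'; rw [midpoint_comm] at hv; exact hzw _ hb' hv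
          · exact hab' (ha'.trans hb'.symm)
    have hmz : z ∈ ({midpoint ℝ x y, z, w} : Finset Plane) := by simp
    have hmw : w ∈ ({midpoint ℝ x y, z, w} : Finset Plane) := by simp
    rcases hv a ha hac with rfl | rfl <;> rcases hv b hb hbc with rfl | rfl
    · exact hab rfl
    · exact hc.not_both _ hmz _ hmw hab hSab hac hbc
    · exact hc.not_both _ hmw _ hmz hab hSab hac hbc
    · exact hab rfl

lemma subordinate_sideChildren {S : Finset Plane → Prop} {z x y w : Plane} {c : RefTriangle}
    (h : orient z x y ≠ 0) (hw : w = x ∨ w = y) (hm : ∀ E, S E → midpoint ℝ x y ∉ E)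
    (hc : c ∈ sideChildren S z (midpoint ℝ x y) w) : Subordinate S {midpoint ℝ x y, z, w} c.1 := by
  obtain ⟨⟨n1, n2, n3⟩, ⟨n4, n5, n6⟩, ⟨n7, n8, n9⟩, ⟨n10, n11, n12⟩, n13, n14, n15⟩ := nodes_ne h
  rcases hw with rfl | rfl
  · exact subordinate_side n4 n5 n1 n7 n8 hm hc
  · exact subordinate_side n4 n6 n2 n10 n12 hm hc

lemma subordinate_child {κ : ℝ} {S : Finset Plane → Prop} {p c : RefTriangle} {z x y : Plane}
    (h : IsShape κ p z x y) (hcl : ∀ E ∈ p.1.powersetCard 2, S E → S p.2)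
    (hm : S p.2 → ∀ E, S E → mid p.2 ∉ E) (hc : c ∈ refineElement S p) :
    Subordinate S p.1 c.1 := by
  by_cases hS : S p.2
  · have hm := hm hS
    have e := h.eq
    subst e
    simp only [mid_pair] at hm
    obtain ⟨w, hw, hcw⟩ := mem_refineElement h.ne hS hc
    exact (subordinate_sideChildren h.ne hw hm hcw).of_side h.ne hS hw hm
  · rw [refineElement_of_not hS, Finset.mem_singleton] at hc
    subst hc
    exact ⟨fun u hu => Or.inl hu, fun a ha b hb hab hSab _ _ =>
      hS (hcl _ (pair_mem_powersetCard ha hb hab) hSab)⟩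

lemma ne_of_hull_inter {κ : ℝ} {c c' : RefTriangle} {z x y : Plane} (h : IsShape κ c z x y)
    {F : Finset Plane} (hF : F.card ≤ 2) (hcc : hull c.1 ∩ hull c'.1 ⊆ hull F) : c.1 ≠ c'.1 := by
  intro e
  have h0 : volume (hull c.1) = 0 :=
    measure_mono_null (fun u hu => hcc ⟨hu, e ▸ hu⟩) (volume_hull_of_card_le hF)
  have := h.area_pos
  simp [Measure.real, h0] at this

lemma conforming_sides {κ : ℝ} {S : Finset Plane → Prop} {p c c' : RefTriangle} {z x y : Plane}
    (h : IsShape κ p z x y) (hm : ∀ E, S E → midpoint ℝ x y ∉ E)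
    (hc : c ∈ sideChildren S z (midpoint ℝ x y) x)
    (hc' : c' ∈ sideChildren S z (midpoint ℝ x y) y) :
    c.1 ≠ c'.1 ∧ hull c.1 ∩ hull c'.1 ⊆ hull (c.1 ∩ c'.1) := by
  obtain ⟨⟨n1, n2, n3⟩, ⟨n4, n5, n6⟩, -⟩ := nodes_ne h.ne
  obtain ⟨b, hb⟩ := exists_isBary (orient_son_ne h.ne (Or.inl rfl))
  obtain ⟨b', hb'⟩ := exists_isBary (orient_son_ne h.ne (Or.inr rfl))
  have s := subordinate_sideChildren h.ne (Or.inl rfl) hm hc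
  have s' := subordinate_sideChildren h.ne (Or.inr rfl) hm hc'
  have hi : ({midpoint ℝ x y, z, x} : Finset Plane) ∩ {midpoint ℝ x y, z, y} =
      {midpoint ℝ x y, z} := by
    ext u
    simp only [Finset.mem_inter, Finset.mem_insert, Finset.mem_singleton]
    constructor
    · rintro ⟨rfl | rfl | rfl, h2⟩
      · simp
      · simp
      · rcases h2 with h2 | h2 | h2
        exacts [Or.inl h2, Or.inr h2, absurd h2 n3]
    · tauto
  have hcard : (({midpoint ℝ x y, z, x} : Finset Plane) ∩ {midpoint ℝ x y, z, y}).card ≤ 2 := by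
    rw [hi]; exact Finset.card_le_two
  have hconf := hull_sons_inter h.ne
  obtain ⟨z', x', y', h', -⟩ := h.child (Or.inl rfl) hc
  refine ⟨ne_of_hull_inter h' Finset.card_le_two
    (fun u hu => hconf ⟨s.hull_subset hu.1, s'.hull_subset hu.2⟩),
    hull_inter_subset_of_subordinate hb hb' ?_ hcard s s'⟩
  rw [hi]; exact hconf

lemma conforming_side {κ : ℝ} {S : Finset Plane → Prop} {p c c' : RefTriangle} {z x y w : Plane}
    (h : IsShape κ p z x y) (hw : w = x ∨ w = y)
    (hc : c ∈ sideChildren S z (midpoint ℝ x y) w)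
    (hc' : c' ∈ sideChildren S z (midpoint ℝ x y) w) (hne : c ≠ c') :
    c.1 ≠ c'.1 ∧ hull c.1 ∩ hull c'.1 ⊆ hull (c.1 ∩ c'.1) := by
  have h1 := h.son hw
  obtain ⟨z', x', y', h', -⟩ := h.child hw hc
  have hconf := hull_sons_inter h1.ne
  have hconf' := hconf
  rw [Set.inter_comm] at hconf'
  unfold sideChildren at hc hc'
  split_ifs at hc hc' with hS
  · have hsub : ({midpoint ℝ z w, midpoint ℝ x y} : Finset Plane) ⊆
        {midpoint ℝ z w, midpoint ℝ x y, w} ∩ {midpoint ℝ z w, midpoint ℝ x y, z} := by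
      intro u hu
      simp only [Finset.mem_inter, Finset.mem_insert, Finset.mem_singleton] at hu ⊢
      tauto
    simp only [Finset.mem_insert, Finset.mem_singleton] at hc hc'
    rcases hc with rfl | rfl <;> rcases hc' with rfl | rfl
    · exact absurd rfl hne
    · exact ⟨ne_of_hull_inter h' Finset.card_le_two hconf',
        hconf'.trans (hull_mono hsub)⟩
    · rw [Finset.inter_comm] at hsub
      exact ⟨ne_of_hull_inter h' Finset.card_le_two hconf,
        hconf.trans (hull_mono hsub)⟩
    · exact absurd rfl hne
  · rw [Finset.mem_singleton] at hc hc'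
    exact absurd (hc.trans hc'.symm) hne

lemma conforming_children {κ : ℝ} {S : Finset Plane → Prop} {p c c' : RefTriangle} {z x y : Plane}
    (h : IsShape κ p z x y) (hm : S p.2 → ∀ E, S E → mid p.2 ∉ E) (hc : c ∈ refineElement S p)
    (hc' : c' ∈ refineElement S p) (hne : c ≠ c') :
    c.1 ≠ c'.1 ∧ hull c.1 ∩ hull c'.1 ⊆ hull (c.1 ∩ c'.1) := by
  by_cases hS : S p.2
  · have hm := hm hS
    have e := h.eq
    subst e
    simp only [mid_pair] at hm
    obtain ⟨w, rfl | rfl, hcw⟩ := mem_refineElement h.ne hS hc <;>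
    obtain ⟨w', rfl | rfl, hcw'⟩ := mem_refineElement h.ne hS hc'
    · exact conforming_side h (Or.inl rfl) hcw hcw' hne
    · exact conforming_sides h hm hcw hcw'
    · obtain ⟨h1, h2⟩ := conforming_sides h hm hcw' hcw
      rw [Set.inter_comm, Finset.inter_comm]
      exact ⟨h1.symm, h2⟩
    · exact conforming_side h (Or.inr rfl) hcw hcw' hne
  · rw [refineElement_of_not hS, Finset.mem_singleton] at hc hc'
    exact absurd (hc.trans hc'.symm) hne

/-! ### Edges of the children -/

lemma subEdges_of_mem {S : Finset Plane → Prop} {a b : Plane} (hS : S {a, b}) :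
    subEdges S {a, b} = {{a, midpoint ℝ a b}, {b, midpoint ℝ a b}} := by
  unfold subEdges
  rw [if_pos hS, mid_pair]; simp

lemma subEdges_of_not {S : Finset Plane → Prop} {E : Finset Plane} (hS : ¬ S E) :
    subEdges S E = {E} := if_neg hS

lemma exists_child_half {S : Finset Plane → Prop} {z x y : Plane} (h : orient z x y ≠ 0)
    (hS : S {x, y}) : ∃ c ∈ refineElement S ({z, x, y}, {x, y}), {x, midpoint ℝ x y} ⊆ c.1 ∧
      ∀ c' ∈ refineElement S ({z, x, y}, {x, y}), {x, midpoint ℝ x y} ⊆ c'.1 → c' = c := by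
  obtain ⟨⟨n1, n2, n3⟩, ⟨n4, n5, n6⟩, ⟨n7, n8, n9⟩, ⟨n10, n11, n12⟩, n13, n14, n15⟩ := nodes_ne h
  rw [refineElement_eq h hS]
  unfold sideChildren
  by_cases h1 : S {z, x} <;> by_cases h2 : S {z, y} <;>
    simp [h1, h2, pair_subset_triple, n1, n2, n3, n4, n5, n6, n7, n8, n9, n10, n11, n12, n13, n14,
      n15, n1.symm, n2.symm, n3.symm, n4.symm, n5.symm, n6.symm, n7.symm, n8.symm, n9.symm,
      n10.symm, n11.symm, n12.symm, n13.symm, n14.symm, n15.symm]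

lemma exists_child_side {S : Finset Plane → Prop} {z x y : Plane} (h : orient z x y ≠ 0)
    (hS : S {x, y}) {E : Finset Plane} (hE : E ∈ subEdges S {z, x}) :
    ∃ c ∈ refineElement S ({z, x, y}, {x, y}), E ⊆ c.1 ∧
      ∀ c' ∈ refineElement S ({z, x, y}, {x, y}), E ⊆ c'.1 → c' = c := by
  obtain ⟨⟨n1, n2, n3⟩, ⟨n4, n5, n6⟩, ⟨n7, n8, n9⟩, ⟨n10, n11, n12⟩, n13, n14, n15⟩ := nodes_ne h
  rw [refineElement_eq h hS]
  by_cases h1 : S {z, x}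
  · rw [subEdges_of_mem h1] at hE
    simp only [Finset.mem_insert, Finset.mem_singleton] at hE
    unfold sideChildren
    rcases hE with rfl | rfl <;> by_cases h2 : S {z, y} <;>
    simp [h1, h2, pair_subset_triple, n1, n2, n3, n4, n5, n6, n7, n8, n9, n10, n11, n12, n13, n14,
      n15, n1.symm, n2.symm, n3.symm, n4.symm, n5.symm, n6.symm, n7.symm, n8.symm, n9.symm,
      n10.symm, n11.symm, n12.symm, n13.symm, n14.symm, n15.symm]
  · rw [subEdges_of_not h1, Finset.mem_singleton] at hE
    subst hE
    unfold sideChildren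
    by_cases h2 : S {z, y} <;>
    simp [h1, h2, pair_subset_triple, n1, n2, n3, n4, n5, n6, n7, n8, n9, n10, n11, n12, n13, n14,
      n15, n1.symm, n2.symm, n3.symm, n4.symm, n5.symm, n6.symm, n7.symm, n8.symm, n9.symm,
      n10.symm, n11.symm, n12.symm, n13.symm, n14.symm, n15.symm]

/-- Each part of an edge of an element is an edge of exactly one of its children. -/
lemma exists_unique_child {κ : ℝ} {S : Finset Plane → Prop} {p : RefTriangle} {z x y : Plane}
    (h : IsShape κ p z x y) (hcl : ∀ E ∈ p.1.powersetCard 2, S E → S p.2) {E E' : Finset Plane}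
    (hE : E ∈ p.1.powersetCard 2) (hE' : E' ∈ subEdges S E) :
    ∃ c ∈ refineElement S p, E' ⊆ c.1 ∧ ∀ c' ∈ refineElement S p, E' ⊆ c'.1 → c' = c := by
  by_cases hS : S p.2
  · have e := h.eq
    subst e
    rcases powersetCard_two_triple hE with rfl | rfl | rfl
    · exact exists_child_side h.ne hS hE'
    · have hS' : S {y, x} := by rwa [Finset.pair_comm]
      rw [triangle_swap]
      exact exists_child_side h.swap.ne hS' hE'
    · rw [subEdges_of_mem hS] at hE'
      simp only [Finset.mem_insert, Finset.mem_singleton] at hE'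
      rcases hE' with rfl | rfl
      · exact exists_child_half h.ne hS
      · have hS' : S {y, x} := by rwa [Finset.pair_comm]
        rw [triangle_swap, midpoint_comm]
        exact exists_child_half h.swap.ne hS'
  · rw [subEdges_of_not fun h => hS (hcl E hE h), Finset.mem_singleton] at hE'
    subst hE'
    rw [refineElement_of_not hS]
    exact ⟨p, Finset.mem_singleton_self p, (Finset.mem_powersetCard.1 hE).1,
      fun c' hc' _ => Finset.mem_singleton.1 hc'⟩

/-! ### The new edges inside of an element -/

/-- The configuration of a new edge `E` inside of the element `p` with the barycentric coordinates
`b`: it has exactly two elements, which lie on opposite sides of it. -/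
structure IsInner (S : Finset Plane → Prop) (p : RefTriangle) (E : Finset Plane)
    (c₁ c₂ : RefTriangle) (u v a d : Plane) : Prop where
  mem₁ : c₁ ∈ refineElement S p
  mem₂ : c₂ ∈ refineElement S p
  ne : c₁ ≠ c₂
  eq : E = {u, v}
  eq₁ : c₁.1 = {u, v, a}
  eq₂ : c₂.1 = {u, v, d}
  opposite : ∃ β γ : ℝ, 0 < β ∧ d - u = -(β • (a - u)) + γ • (v - u)
  unique : ∀ c ∈ refineElement S p, E ⊆ c.1 → c = c₁ ∨ c = c₂
  interior : ∀ b, IsBary p.1 b → ∀ w ∈ p.1, 0 < b w (mid E)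

lemma innerEdges_of_not {κ : ℝ} {S : Finset Plane → Prop} {p : RefTriangle} {z x y : Plane}
    (_h : IsShape κ p z x y) (hcl : ∀ E ∈ p.1.powersetCard 2, S E → S p.2) (hS : ¬ S p.2) :
    innerEdges S p = ∅ := by
  unfold innerEdges
  rw [refineElement_of_not hS, Finset.singleton_biUnion, Finset.sdiff_eq_empty_iff_subset]
  intro E hE
  refine Finset.mem_biUnion.2 ⟨E, hE, ?_⟩
  rw [subEdges_of_not fun h => hS (hcl E hE h)]
  exact Finset.mem_singleton_self E

lemma edge_of_side {S : Finset Plane → Prop} {z x y w : Plane} (h : orient z x y ≠ 0)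
    (hS : S {x, y}) (hw : w = x ∨ w = y) {c : RefTriangle}
    (hc : c ∈ sideChildren S z (midpoint ℝ x y) w) {E : Finset Plane}
    (hE : E ∈ c.1.powersetCard 2)
    (hn : ∀ F ∈ ({z, x, y} : Finset Plane).powersetCard 2, E ∉ subEdges S F) :
    E = {midpoint ℝ x y, z} ∨ (S {z, w} ∧ E = {midpoint ℝ z w, midpoint ℝ x y}) := by
  obtain ⟨⟨n1, n2, n3⟩, -⟩ := nodes_ne h
  have hwT : w ∈ ({z, x, y} : Finset Plane) := by rcases hw with rfl | rfl <;> simp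
  have hzw : z ≠ w := by rcases hw with rfl | rfl <;> assumption
  have hs1 := hn {x, y} (pair_mem_powersetCard (by simp) (by simp) n3)
  have hs2 := hn {z, w} (pair_mem_powersetCard (by simp) hwT hzw)
  rw [subEdges_of_mem hS] at hs1
  simp only [Finset.mem_insert, Finset.mem_singleton, not_or] at hs1
  have hs1' : E ≠ {midpoint ℝ x y, w} := by
    rw [Finset.pair_comm]; rcases hw with rfl | rfl
    exacts [hs1.1, hs1.2]
  unfold sideChildren at hc
  split_ifs at hc with hSw
  · rw [subEdges_of_mem hSw] at hs2
    simp only [Finset.mem_insert, Finset.mem_singleton, not_or] at hs2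
    rw [Finset.pair_comm, Finset.pair_comm w] at hs2
    simp only [Finset.mem_insert, Finset.mem_singleton] at hc
    rcases hc with rfl | rfl
    · rcases powersetCard_two_triple hE with h | h | h
      exacts [Or.inr ⟨hSw, h⟩, absurd h hs2.2, absurd h hs1']
    · rcases powersetCard_two_triple hE with h | h | h
      exacts [Or.inr ⟨hSw, h⟩, absurd h hs2.1, Or.inl h]
  · rw [subEdges_of_not hSw, Finset.mem_singleton] at hs2
    rw [Finset.mem_singleton] at hc
    subst hc
    rcases powersetCard_two_triple hE with h | h | h
    exacts [Or.inl h, absurd h hs1', absurd h hs2]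

lemma mem_innerEdges {S : Finset Plane → Prop} {z x y : Plane} (h : orient z x y ≠ 0)
    (hS : S {x, y}) {E : Finset Plane} (hE : E ∈ innerEdges S ({z, x, y}, {x, y})) :
    E = {midpoint ℝ x y, z} ∨
      ∃ w, (w = x ∨ w = y) ∧ S {z, w} ∧ E = {midpoint ℝ z w, midpoint ℝ x y} := by
  unfold innerEdges at hE
  simp only [Finset.mem_sdiff, Finset.mem_biUnion, not_exists, not_and] at hE
  obtain ⟨⟨c, hc, hEc⟩, hn⟩ := hE
  obtain ⟨w, hw, hcw⟩ := mem_refineElement h hS hc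
  rcases edge_of_side h hS hw hcw hEc hn with h1 | ⟨h1, h2⟩
  exacts [Or.inl h1, Or.inr ⟨w, hw, h1, h2⟩]

lemma bary_values {z x y : Plane} (h : orient z x y ≠ 0) {b : Plane → Plane →ᵃ[ℝ] ℝ}
    (hb : IsBary {z, x, y} b) : (b z z = 1 ∧ b x z = 0 ∧ b y z = 0) ∧
      (b z x = 0 ∧ b x x = 1 ∧ b y x = 0) ∧ b z y = 0 ∧ b x y = 0 ∧ b y y = 1 := by
  obtain ⟨h1, h2, h3⟩ := orient_ne_of_ne h
  have e := hb.delta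
  simpa only [Finset.mem_insert, Finset.mem_singleton, forall_eq_or_imp, forall_eq, h1, h2, h3,
    h1.symm, h2.symm, h3.symm, if_true, if_false] using e

lemma isInner_median {S : Finset Plane → Prop} {z x y : Plane} (h : orient z x y ≠ 0)
    (hS : S {x, y}) : ∃ c₁ c₂ a d, IsInner S ({z, x, y}, {x, y}) {midpoint ℝ x y, z} c₁ c₂
      (midpoint ℝ x y) z a d := by
  obtain ⟨⟨n1, n2, n3⟩, ⟨n4, n5, n6⟩, ⟨n7, n8, n9⟩, ⟨n10, n11, n12⟩, n13, n14, n15⟩ := nodes_ne h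
  have hint : ∀ b, IsBary ({z, x, y} : Finset Plane) b → ∀ w ∈ ({z, x, y} : Finset Plane),
      0 < b w (mid {midpoint ℝ x y, z}) := by
    intro b hb w hw
    obtain ⟨⟨a1, a2, a3⟩, ⟨a4, a5, a6⟩, a7, a8, a9⟩ := bary_values h hb
    rw [mid_pair, affine_apply_midpoint, affine_apply_midpoint]
    simp only [Finset.mem_insert, Finset.mem_singleton] at hw
    rcases hw with rfl | rfl | rfl <;> simp only [a1, a2, a3, a4, a5, a6, a7, a8, a9] <;> norm_num
  let c : Plane → RefTriangle := fun w => if S {z, w} then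
    ({midpoint ℝ z w, midpoint ℝ x y, z}, {midpoint ℝ x y, z}) else
    ({midpoint ℝ x y, z, w}, {z, w})
  let a : Plane → Plane := fun w => if S {z, w} then midpoint ℝ z w else w
  have hc1 : ∀ w, (c w).1 = {midpoint ℝ x y, z, a w} := by
    intro w
    simp only [c, a]
    split_ifs
    · ext u; simp only [Finset.mem_insert, Finset.mem_singleton]; tauto
    · rfl
  have hcm : ∀ w, c w ∈ sideChildren S z (midpoint ℝ x y) w := by
    intro w
    simp only [c, sideChildren]
    split_ifs <;> simp
  have hax : a x ≠ a y ∧ a x ≠ midpoint ℝ x y ∧ a x ≠ z := by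
    simp only [a]
    split_ifs <;> simp [n1.symm, n3, n5.symm, n7, n9, n13, n15, n11.symm]
  refine ⟨c x, c y, a x, a y, ?_, ?_, ?_, rfl, hc1 x, hc1 y, ?_, ?_, hint⟩
  · rw [refineElement_eq h hS]; exact Finset.mem_union_right _ (hcm x)
  · rw [refineElement_eq h hS]; exact Finset.mem_union_left _ (hcm y)
  · intro e
    have e := congrArg Prod.fst e
    rw [hc1, hc1] at e
    have : a x ∈ ({midpoint ℝ x y, z, a y} : Finset Plane) := e ▸ (by simp)
    simp only [Finset.mem_insert, Finset.mem_singleton] at this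
    tauto
  · simp only [a]
    split_ifs
    · exact ⟨1, 1, one_pos, by apply plane_ext <;> simp [midpoint_apply] <;> ring⟩
    · exact ⟨1 / 2, 1 / 2, by norm_num, by apply plane_ext <;> simp [midpoint_apply] <;> ring⟩
    · exact ⟨2, 1, two_pos, by apply plane_ext <;> simp [midpoint_apply] <;> ring⟩
    · exact ⟨1, 0, one_pos, by apply plane_ext <;> simp [midpoint_apply] <;> ring⟩
  · intro c' hc' hE
    obtain ⟨w, hw, hcw⟩ := mem_refineElement h hS hc'
    have : c' = c w := by
      unfold sideChildren at hcw
      simp only [c]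
      split_ifs at hcw ⊢
      · simp only [Finset.mem_insert, Finset.mem_singleton] at hcw
        rcases hcw with rfl | rfl
        · rcases hw with rfl | rfl <;>
          simp [pair_subset_triple, n1, n2, n4.symm, n7.symm, n10.symm] at hE
        · rfl
      · exact Finset.mem_singleton.1 hcw
    rcases hw with rfl | rfl
    exacts [Or.inl this, Or.inr this]

lemma isInner_side {S : Finset Plane → Prop} {z x y : Plane} (h : orient z x y ≠ 0)
    (hS : S {x, y}) (hSx : S {z, x}) : ∃ c₁ c₂ a d, IsInner S ({z, x, y}, {x, y})
      {midpoint ℝ z x, midpoint ℝ x y} c₁ c₂ (midpoint ℝ z x) (midpoint ℝ x y) a d := by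
  obtain ⟨⟨n1, n2, n3⟩, ⟨n4, n5, n6⟩, ⟨n7, n8, n9⟩, ⟨n10, n11, n12⟩, n13, n14, n15⟩ := nodes_ne h
  have hint : ∀ b, IsBary ({z, x, y} : Finset Plane) b → ∀ w ∈ ({z, x, y} : Finset Plane),
      0 < b w (mid {midpoint ℝ z x, midpoint ℝ x y}) := by
    intro b hb w hw
    obtain ⟨⟨a1, a2, a3⟩, ⟨a4, a5, a6⟩, a7, a8, a9⟩ := bary_values h hb
    rw [mid_pair, affine_apply_midpoint, affine_apply_midpoint, affine_apply_midpoint]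
    simp only [Finset.mem_insert, Finset.mem_singleton] at hw
    rcases hw with rfl | rfl | rfl <;> simp only [a1, a2, a3, a4, a5, a6, a7, a8, a9] <;> norm_num
  refine ⟨({midpoint ℝ z x, midpoint ℝ x y, x}, {midpoint ℝ x y, x}),
    ({midpoint ℝ z x, midpoint ℝ x y, z}, {midpoint ℝ x y, z}), x, z, ?_, ?_, ?_, rfl, rfl, rfl,
    ?_, ?_, hint⟩
  · rw [refineElement_eq h hS]; simp [sideChildren, hSx]
  · rw [refineElement_eq h hS]; simp [sideChildren, hSx]
  · intro e
    have e := congrArg Prod.fst e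
    dsimp only at e
    have : x ∈ ({midpoint ℝ z x, midpoint ℝ x y, z} : Finset Plane) := by
      rw [← e]; simp
    simp [n1.symm, n5.symm, n8.symm] at this
  · exact ⟨1, 0, one_pos, by apply plane_ext <;> simp [midpoint_apply] <;> ring⟩
  · intro c' hc' hE
    obtain ⟨w, hw, hcw⟩ := mem_refineElement h hS hc'
    rcases hw with rfl | rfl
    · simpa [sideChildren, hSx] using hcw
    · unfold sideChildren at hcw
      split_ifs at hcw
      · simp only [Finset.mem_insert, Finset.mem_singleton] at hcw
        rcases hcw with rfl | rfl <;>
        simp [pair_subset_triple, n7, n8, n9, n13, n15] at hE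
      · rw [Finset.mem_singleton] at hcw
        subst hcw
        simp [pair_subset_triple, n7, n8, n9, n13, n15] at hE

lemma exists_isInner {κ : ℝ} {S : Finset Plane → Prop} {p : RefTriangle} {z x y : Plane}
    (h : IsShape κ p z x y) (hS : S p.2) {E : Finset Plane} (hE : E ∈ innerEdges S p) :
    ∃ c₁ c₂ u v a d, IsInner S p E c₁ c₂ u v a d := by
  have e := h.eq
  subst e
  rcases mem_innerEdges h.ne hS hE with rfl | ⟨w, rfl | rfl, hSw, rfl⟩
  · obtain ⟨c₁, c₂, a, d, hi⟩ := isInner_median h.ne hS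
    exact ⟨c₁, c₂, _, _, a, d, hi⟩
  · obtain ⟨c₁, c₂, a, d, hi⟩ := isInner_side h.ne hS hSw
    exact ⟨c₁, c₂, _, _, a, d, hi⟩
  · have hS' : S {w, x} := by rwa [Finset.pair_comm]
    obtain ⟨c₁, c₂, a, d, hi⟩ := isInner_side h.swap.ne hS' hSw
    rw [triangle_swap, midpoint_comm x w]
    exact ⟨c₁, c₂, _, _, a, d, hi⟩

/-! ### Weights of the new edges -/

lemma area_side_sum {κ : ℝ} {S : Finset Plane → Prop} {p : RefTriangle} {z x y w : Plane}
    (h : IsShape κ p z x y) (hw : w = x ∨ w = y) :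
    (∑ c ∈ sideChildren S z (midpoint ℝ x y) w, volume.real (hull c.1) ≤
      volume.real (hull p.1) / 2) ∧
    ∑ c ∈ (sideChildren S z (midpoint ℝ x y) w).filter (fun c => {midpoint ℝ x y, z} ⊆ c.1),
      volume.real (hull c.1) ≤ volume.real (hull p.1) / (if S {z, w} then 4 else 2) := by
  obtain ⟨⟨n1, n2, n3⟩, ⟨n4, n5, n6⟩, ⟨n7, n8, n9⟩, ⟨n10, n11, n12⟩, n13, n14, n15⟩ := nodes_ne h.ne
  have ha : ∀ c ∈ sideChildren S z (midpoint ℝ x y) w, volume.real (hull c.1) =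
      volume.real (hull p.1) / (if S {z, w} then 4 else 2) := by
    intro c hc
    obtain ⟨z', x', y', h', e⟩ := h.child hw hc
    rw [h'.area, h.area, e]; ring
  rw [Finset.sum_congr rfl ha, Finset.sum_congr rfl fun c hc => ha c (Finset.mem_filter.1 hc).1,
    Finset.sum_const, Finset.sum_const, nsmul_eq_mul, nsmul_eq_mul]
  have hp := h.area_pos
  by_cases hS : S {z, w}
  · have e : sideChildren S z (midpoint ℝ x y) w =
        {({midpoint ℝ z w, midpoint ℝ x y, w}, {midpoint ℝ x y, w}),
          ({midpoint ℝ z w, midpoint ℝ x y, z}, {midpoint ℝ x y, z})} := if_pos hS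
    have c1 : ((sideChildren S z (midpoint ℝ x y) w).card : ℝ) ≤ 2 := by
      rw [e]; exact_mod_cast Finset.card_le_two
    have c2 : (((sideChildren S z (midpoint ℝ x y) w).filter
        (fun c => {midpoint ℝ x y, z} ⊆ c.1)).card : ℝ) ≤ 1 := by
      have : (sideChildren S z (midpoint ℝ x y) w).filter
        (fun c => {midpoint ℝ x y, z} ⊆ c.1) ⊆
          {({midpoint ℝ z w, midpoint ℝ x y, z}, {midpoint ℝ x y, z})} := by
        intro c hc
        obtain ⟨hc, hE⟩ := Finset.mem_filter.1 hc
        rw [e] at hc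
        simp only [Finset.mem_insert, Finset.mem_singleton] at hc ⊢
        rcases hc with rfl | rfl
        · exfalso
          rcases hw with rfl | rfl <;>
          simp [pair_subset_triple, n1, n2, n4.symm, n7.symm, n10.symm] at hE
        · rfl
      exact_mod_cast (Finset.card_le_card this)
    simp only [if_pos hS]
    constructor <;> nlinarith
  · have e : sideChildren S z (midpoint ℝ x y) w = {({midpoint ℝ x y, z, w}, {z, w})} := if_neg hS
    have c1 : ((sideChildren S z (midpoint ℝ x y) w).card : ℝ) ≤ 1 := by
      rw [e]; simp
    have c2 : (((sideChildren S z (midpoint ℝ x y) w).filter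
        (fun c => {midpoint ℝ x y, z} ⊆ c.1)).card : ℝ) ≤ 1 :=
      le_trans (by exact_mod_cast Finset.card_filter_le _ _) c1
    simp only [if_neg hS]
    constructor <;> nlinarith

lemma sum_innerEdges_le {κ : ℝ} {S : Finset Plane → Prop} {p : RefTriangle} {z x y : Plane}
    (h : IsShape κ p z x y) (hS : S p.2) (hm : ∀ E, S E → mid p.2 ∉ E) {ν : RefTriangle → ℝ}
    (hν : ∀ c ∈ refineElement S p, 0 ≤ ν c) :
    ∑ E ∈ innerEdges S p, (∑ c ∈ refineElement S p with E ⊆ c.1, volume.real (hull c.1)) *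
      (∑ c ∈ refineElement S p with E ⊆ c.1, ν c) ≤
    5 / 4 * volume.real (hull p.1) * ∑ c ∈ refineElement S p, ν c := by
  have e := h.eq
  subst e
  simp only [mid_pair] at hm
  set t := volume.real (hull ({z, x, y} : Finset Plane)) with ht
  have htp : 0 < t := h.area_pos
  set m := midpoint ℝ x y with hmdef
  have hR := refineElement_eq (S := S) h.ne hS
  have hR' : refineElement S ({z, x, y}, {x, y}) = sideChildren S z m x ∪ sideChildren S z m y := by
    rw [hR, Finset.union_comm]
  have hdisj : Disjoint (sideChildren S z m x) (sideChildren S z m y) := by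
    rw [Finset.disjoint_left]
    intro c hc hc'
    exact (conforming_sides h hm hc hc').1 rfl
  obtain ⟨sx, fx⟩ := area_side_sum (S := S) h (Or.inl rfl)
  obtain ⟨sy, fy⟩ := area_side_sum (S := S) h (Or.inr rfl)
  rw [← hmdef] at sx fx sy fy
  set R := refineElement S ({z, x, y}, {x, y}) with hRdef
  set W : Finset Plane → ℝ := fun E => (∑ c ∈ R with E ⊆ c.1, volume.real (hull c.1)) *
      (∑ c ∈ R with E ⊆ c.1, ν c) with hW
  set Nx := ∑ c ∈ sideChildren S z m x, ν c with hNx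
  set Ny := ∑ c ∈ sideChildren S z m y, ν c with hNy
  have hsubx : sideChildren S z m x ⊆ R := hR' ▸ Finset.subset_union_left
  have hsuby : sideChildren S z m y ⊆ R := hR' ▸ Finset.subset_union_right
  have hNx0 : 0 ≤ Nx := Finset.sum_nonneg fun c hc => hν c (hsubx hc)
  have hNy0 : 0 ≤ Ny := Finset.sum_nonneg fun c hc => hν c (hsuby hc)
  have hN : ∑ c ∈ R, ν c = Nx + Ny := by rw [hR', Finset.sum_union hdisj]
  have hW0 : ∀ E, 0 ≤ W E := fun E => mul_nonneg (Finset.sum_nonneg fun c _ => measureReal_nonneg)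
    (Finset.sum_nonneg fun c hc => hν c (Finset.mem_filter.1 hc).1)
  have hsub : innerEdges S ({z, x, y}, {x, y}) ⊆ {{m, z}} ∪
      ((if S {z, x} then {{midpoint ℝ z x, m}} else ∅) ∪
        (if S {z, y} then {{midpoint ℝ z y, m}} else ∅)) := by
    intro E hE
    rcases mem_innerEdges h.ne hS hE with rfl | ⟨w, rfl | rfl, hSw, rfl⟩
    · simp [hmdef]
    · simp [hSw, hmdef]
    · simp [hSw, hmdef]
  have hmed : W {m, z} ≤ (t / (if S {z, x} then 4 else 2) + t / (if S {z, y} then 4 else 2)) *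
      (Nx + Ny) := by
    refine mul_le_mul ?_ ?_ (Finset.sum_nonneg fun c hc => hν c (Finset.mem_filter.1 hc).1) ?_
    · rw [hR', Finset.filter_union, Finset.sum_union (hdisj.mono (Finset.filter_subset _ _)
        (Finset.filter_subset _ _))]
      exact add_le_add fx fy
    · rw [← hN]
      exact Finset.sum_le_sum_of_subset_of_nonneg (Finset.filter_subset _ _) fun c hc _ => hν c hc
    · split_ifs <;> positivity
  have hside : ∀ w, (w = x ∨ w = y) → S {z, w} →
      W {midpoint ℝ z w, m} ≤ t / 2 * ∑ c ∈ sideChildren S z m w, ν c := by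
    intro w hw hSw
    have hfil : R.filter (fun c => {midpoint ℝ z w, m} ⊆ c.1) ⊆ sideChildren S z m w := by
      intro c hc
      obtain ⟨hc, hE⟩ := Finset.mem_filter.1 hc
      rcases hw with rfl | rfl
      · obtain ⟨c₁, c₂, a, d, hi⟩ := isInner_side h.ne hS hSw
        have e1 := Finset.mem_union.1 (hR' ▸ hc)
        refine e1.resolve_right fun hcy => ?_
        obtain ⟨⟨n1, n2, n3⟩, ⟨n4, n5, n6⟩, ⟨n7, n8, n9⟩, ⟨n10, n11, n12⟩, n13, n14, n15⟩ :=
          nodes_ne h.ne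
        unfold sideChildren at hcy
        split_ifs at hcy
        · simp only [Finset.mem_insert, Finset.mem_singleton] at hcy
          rcases hcy with rfl | rfl <;>
          simp [pair_subset_triple, n7, n8, n9, n13, n15, hmdef] at hE
        · rw [Finset.mem_singleton] at hcy
          subst hcy
          simp [pair_subset_triple, n7, n8, n9, n13, n15, hmdef] at hE
      · have e1 := Finset.mem_union.1 (hR' ▸ hc)
        refine e1.resolve_left fun hcy => ?_
        obtain ⟨⟨n1, n2, n3⟩, ⟨n4, n5, n6⟩, ⟨n7, n8, n9⟩, ⟨n10, n11, n12⟩, n13, n14, n15⟩ :=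
          nodes_ne h.ne
        unfold sideChildren at hcy
        split_ifs at hcy
        · simp only [Finset.mem_insert, Finset.mem_singleton] at hcy
          rcases hcy with rfl | rfl <;>
          simp [pair_subset_triple, n10, n11, n12, n14, n15.symm, hmdef] at hE
        · rw [Finset.mem_singleton] at hcy
          subst hcy
          simp [pair_subset_triple, n10, n11, n12, n14, n15.symm, hmdef] at hE
    have hsw : sideChildren S z m w ⊆ R := by rcases hw with rfl | rfl <;> assumption
    have hs : ∑ c ∈ sideChildren S z m w, volume.real (hull c.1) ≤ t / 2 := by
      rcases hw with rfl | rfl <;> assumption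
    refine mul_le_mul ?_ ?_ (Finset.sum_nonneg fun c hc => hν c (Finset.mem_filter.1 hc).1)
      (by positivity)
    · exact (Finset.sum_le_sum_of_subset_of_nonneg hfil fun c _ _ => measureReal_nonneg).trans hs
    · exact Finset.sum_le_sum_of_subset_of_nonneg hfil fun c hc _ => hν c (hsw hc)
  have hx := hside x (Or.inl rfl)
  have hy := hside y (Or.inr rfl)
  rw [← hNx] at hx
  rw [← hNy] at hy
  have hu : ∀ A B : Finset (Finset Plane), ∑ E ∈ A ∪ B, W E ≤ ∑ E ∈ A, W E + ∑ E ∈ B, W E := by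
    intro A B
    rw [← Finset.sum_union_inter]
    exact le_add_of_nonneg_right (Finset.sum_nonneg fun E _ => hW0 E)
  have total : ∑ E ∈ innerEdges S ({z, x, y}, {x, y}), W E ≤ W {m, z} +
      ((if S {z, x} then W {midpoint ℝ z x, m} else 0) +
        (if S {z, y} then W {midpoint ℝ z y, m} else 0)) := by
    refine (Finset.sum_le_sum_of_subset_of_nonneg hsub fun E _ _ => hW0 E).trans ?_
    refine (hu _ _).trans (add_le_add (by simp) ((hu _ _).trans (add_le_add ?_ ?_))) <;>
    split_ifs <;> simp
  refine total.trans ?_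
  rw [hN]
  have p1 := mul_nonneg htp.le hNx0
  have p2 := mul_nonneg htp.le hNy0
  change _ ≤ 5 / 4 * t * (Nx + Ny)
  by_cases h1 : S {z, x} <;> by_cases h2 : S {z, y} <;>
    simp only [h1, h2, if_true, if_false, forall_true_left] at hmed hx hy ⊢ <;> nlinarith

/-! ### Meshes and their refinement -/

/-- The elements with the edge `E`. -/
def elems (𝒯 : Finset RefTriangle) (E : Finset Plane) : Finset RefTriangle :=
  𝒯.filter fun p => E ⊆ p.1

/-- A set of edges of a mesh that contains the reference edge of each element of which it contains
an edge. -/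
structure IsMarking (𝒯 : Finset RefTriangle) (S : Finset Plane → Prop) : Prop where
  exists_mem : ∀ E, S E → ∃ p ∈ 𝒯, E ∈ p.1.powersetCard 2
  ref : ∀ p ∈ 𝒯, ∀ E ∈ p.1.powersetCard 2, S E → S p.2

/-- The mesh with all the edges in `S` halved. -/
def refineMesh (S : Finset Plane → Prop) (𝒯 : Finset RefTriangle) : Finset RefTriangle :=
  𝒯.biUnion (refineElement S)

/-- A conforming mesh of `Ω` with shape constant `κ` and at most `K` elements at each edge. -/
structure IsMesh (Ω : Set Plane) (κ : ℝ) (K : ℕ) (𝒯 : Finset RefTriangle) : Prop where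
  shape : ∀ p ∈ 𝒯, ∃ z x y, IsShape κ p z x y
  conf : ∀ p ∈ 𝒯, ∀ q ∈ 𝒯, p ≠ q → p.1 ≠ q.1 ∧ hull p.1 ∩ hull q.1 ⊆ hull (p.1 ∩ q.1)
  cover : ⋃ p ∈ 𝒯, hull p.1 = closure Ω
  bdry : ∀ E ∈ boundaryEdges (tris 𝒯), hull E ⊆ frontier Ω
  valence : ∀ E ∈ edges (tris 𝒯), (elems 𝒯 E).card ≤ K

lemma IsShape.isBary {κ : ℝ} {p : RefTriangle} {z x y : Plane} (h : IsShape κ p z x y) :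
    ∃ b, IsBary p.1 b := by
  rw [h.eq]; exact exists_isBary h.ne

lemma IsShape.ref_mem {κ : ℝ} {p : RefTriangle} {z x y : Plane} (h : IsShape κ p z x y) :
    p.2 ∈ p.1.powersetCard 2 := by
  rw [h.eq]
  exact pair_mem_powersetCard (by simp) (by simp) (orient_ne_of_ne h.ne).2.2

lemma mem_edges {𝒯 : Finset RefTriangle} {E : Finset Plane} :
    E ∈ edges (tris 𝒯) ↔ ∃ p ∈ 𝒯, E ∈ p.1.powersetCard 2 := by
  simp [edges, tris]

lemma mem_elems {𝒯 : Finset RefTriangle} {E : Finset Plane} {p : RefTriangle} :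
    p ∈ elems 𝒯 E ↔ p ∈ 𝒯 ∧ E ⊆ p.1 := Finset.mem_filter

lemma card_of_mem_edges {τ : Finset (Finset Plane)} {E : Finset Plane} (h : E ∈ edges τ) :
    E.card = 2 := by
  obtain ⟨T, -, hE⟩ := Finset.mem_biUnion.1 h
  exact (Finset.mem_powersetCard.1 hE).2

lemma mid_mem_hull {E : Finset Plane} (h : E.card = 2) : mid E ∈ hull E := by
  obtain ⟨a, b, -, rfl⟩ := Finset.card_eq_two.1 h
  rw [mid_pair]
  exact midpoint_mem_hull (subset_hull (by simp)) (subset_hull (by simp))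

lemma subEdges_properties {S : Finset Plane → Prop} {E E' : Finset Plane} (hE : E.card = 2)
    (h : E' ∈ subEdges S E) : E'.card = 2 ∧ hull E' ⊆ hull E ∧
      ∀ (T : Finset Plane) (b : Plane → Plane →ᵃ[ℝ] ℝ), IsBary T b → E ⊆ T →
        ∀ v ∈ E, 0 < b v (mid E') := by
  have key : ∀ a c : Plane, a ≠ c → ∀ (T : Finset Plane) (b : Plane → Plane →ᵃ[ℝ] ℝ), IsBary T b →
      {a, c} ⊆ T → ∀ v ∈ ({a, c} : Finset Plane), 0 < b v (midpoint ℝ a c) ∧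
        0 < b v (midpoint ℝ a (midpoint ℝ a c)) := by
    intro a c hac T b hb hT v hv
    have ha : a ∈ T := hT (by simp)
    have hc : c ∈ T := hT (by simp)
    simp only [affine_apply_midpoint]
    simp only [Finset.mem_insert, Finset.mem_singleton] at hv
    rcases hv with rfl | rfl
    · rw [hb.self ha, hb.of_ne hc ha hac.symm]; norm_num
    · rw [hb.self hc, hb.of_ne ha hc hac]; norm_num
  have half : ∀ a c : Plane, a ≠ c → ({a, midpoint ℝ a c} : Finset Plane).card = 2 ∧
      hull {a, midpoint ℝ a c} ⊆ hull {a, c} := by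
    intro a c hac
    refine ⟨Finset.card_pair ?_, hull_subset_hull ?_⟩
    · rwa [ne_eq, left_eq_midpoint_iff]
    · intro v hv
      simp only [Finset.mem_insert, Finset.mem_singleton] at hv
      rcases hv with rfl | rfl
      exacts [subset_hull (by simp), midpoint_mem_hull (subset_hull (by simp)) (subset_hull (by simp))]
  obtain ⟨a, c, hac, rfl⟩ := Finset.card_eq_two.1 hE
  by_cases hS : S {a, c}
  · rw [subEdges_of_mem hS] at h
    simp only [Finset.mem_insert, Finset.mem_singleton] at h
    rcases h with rfl | rfl
    · refine ⟨(half a c hac).1, (half a c hac).2, fun T b hb hT v hv => ?_⟩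
      rw [mid_pair]; exact (key a c hac T b hb hT v hv).2
    · rw [midpoint_comm, Finset.pair_comm a c]
      refine ⟨(half c a hac.symm).1, (half c a hac.symm).2, fun T b hb hT v hv => ?_⟩
      rw [mid_pair]; exact (key c a hac.symm T b hb hT v hv).2
  · rw [subEdges_of_not hS, Finset.mem_singleton] at h
    subst h
    refine ⟨hE, subset_rfl, fun T b hb hT v hv => ?_⟩
    rw [mid_pair]; exact (key a c hac T b hb hT v hv).1

section Step

variable {Ω : Set Plane} {κ : ℝ} {K : ℕ} {𝒯 : Finset RefTriangle} {S : Finset Plane → Prop}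

lemma card_inter_le_two {T T' : Finset Plane} (hT : T.card = 3) (hT' : T'.card = 3)
    (hne : T ≠ T') : (T ∩ T').card ≤ 2 := by
  by_contra! hc
  have h1 : T ∩ T' = T := Finset.eq_of_subset_of_card_le Finset.inter_subset_left (by omega)
  have h2 : T ∩ T' = T' := Finset.eq_of_subset_of_card_le Finset.inter_subset_right (by omega)
  exact hne (h1.symm.trans h2)

lemma IsMesh.card_inter_le (h : IsMesh Ω κ K 𝒯) {p q : RefTriangle} (hp : p ∈ 𝒯) (hq : q ∈ 𝒯)
    (hpq : p ≠ q) : (p.1 ∩ q.1).card ≤ 2 := by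
  obtain ⟨_, _, _, sp⟩ := h.shape p hp
  obtain ⟨_, _, _, sq⟩ := h.shape q hq
  exact card_inter_le_two sp.card sq.card (h.conf p hp q hq hpq).1

/-- If a point of `q` has a nonzero coordinate in `p` with respect to `v`, then `v` is a vertex of
`q`. -/
lemma IsMesh.mem_of_pos (h : IsMesh Ω κ K 𝒯) {p q : RefTriangle} (hp : p ∈ 𝒯) (hq : q ∈ 𝒯)
    {b : Plane → Plane →ᵃ[ℝ] ℝ} (hb : IsBary p.1 b) {v w : Plane} (hv : v ∈ p.1)
    (hwp : w ∈ hull p.1) (hwq : w ∈ hull q.1) (hpos : 0 < b v w) : v ∈ q.1 := by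
  by_cases hpq : p = q
  · exact hpq ▸ hv
  · exact (Finset.mem_inter.1 (hb.mem_of_ne_zero Finset.inter_subset_left hv
      ((h.conf p hp q hq hpq).2 ⟨hwp, hwq⟩) hpos.ne')).2

lemma IsMesh.mid_ref_notMem (h : IsMesh Ω κ K 𝒯) (hS : IsMarking 𝒯 S) {p : RefTriangle}
    (hp : p ∈ 𝒯) : ∀ E, S E → mid p.2 ∉ E := by
  intro E hE hmE
  obtain ⟨q, hq, hEq⟩ := hS.exists_mem E hE
  obtain ⟨z, x, y, sp⟩ := h.shape p hp
  obtain ⟨_, _, _, sq⟩ := h.shape q hq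
  obtain ⟨b, hb⟩ := sp.isBary
  obtain ⟨b', hb'⟩ := sq.isBary
  have hx : x ∈ p.1 := by rw [sp.eq]; simp
  have hy : y ∈ p.1 := by rw [sp.eq]; simp
  have hxy : x ≠ y := (orient_ne_of_ne sp.ne).2.2
  have hm : mid p.2 = midpoint ℝ x y := by rw [sp.eq, mid_pair]
  rw [hm] at hmE
  have hmq : midpoint ℝ x y ∈ q.1 := (Finset.mem_powersetCard.1 hEq).1 hmE
  have hmp : midpoint ℝ x y ∈ hull p.1 := midpoint_mem_hull (subset_hull hx) (subset_hull hy)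
  have hxq : x ∈ q.1 := h.mem_of_pos hp hq hb hx hmp (subset_hull hmq) (by
    rw [affine_apply_midpoint, hb.self hx, hb.of_ne hy hx hxy.symm]; norm_num)
  have hyq : y ∈ q.1 := h.mem_of_pos hp hq hb hy hmp (subset_hull hmq) (by
    rw [affine_apply_midpoint, hb.self hy, hb.of_ne hx hy hxy]; norm_num)
  have e := hb'.self hmq
  rw [affine_apply_midpoint, hb'.of_ne hxq hmq (by rwa [ne_eq, left_eq_midpoint_iff]),
    hb'.of_ne hyq hmq (by rw [ne_eq, right_eq_midpoint_iff]; exact hxy)] at e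
  norm_num at e

lemma IsMesh.edge_subset_of_child (h : IsMesh Ω κ K 𝒯) {E E' : Finset Plane}
    (hE : E ∈ edges (tris 𝒯)) (hE' : E' ∈ subEdges S E) {q c : RefTriangle} (hq : q ∈ 𝒯)
    (hc : c ∈ refineElement S q) (hcE : E' ⊆ c.1) : E ⊆ q.1 := by
  obtain ⟨p, hp, hEp⟩ := mem_edges.1 hE
  obtain ⟨hEp, hcard⟩ := Finset.mem_powersetCard.1 hEp
  obtain ⟨h1, h2, h3⟩ := subEdges_properties hcard hE'
  obtain ⟨_, _, _, sp⟩ := h.shape p hp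
  obtain ⟨_, _, _, sq⟩ := h.shape q hq
  obtain ⟨b, hb⟩ := sp.isBary
  intro v hv
  exact h.mem_of_pos hp hq hb (hEp hv) (hull_mono hEp (h2 (mid_mem_hull h1)))
    (hull_child_subset sq hc (hull_mono hcE (mid_mem_hull h1))) (h3 _ b hb hEp v hv)

lemma IsMesh.eq_of_inner (h : IsMesh Ω κ K 𝒯) {p q c c₁ c₂ : RefTriangle} {E : Finset Plane}
    {u v a d : Plane} (hp : p ∈ 𝒯) (hi : IsInner S p E c₁ c₂ u v a d) (hq : q ∈ 𝒯)
    (hc : c ∈ refineElement S q) (hcE : E ⊆ c.1) : q = p := by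
  obtain ⟨_, _, _, sp⟩ := h.shape p hp
  obtain ⟨_, _, _, sq⟩ := h.shape q hq
  obtain ⟨b, hb⟩ := sp.isBary
  have hm : mid E ∈ hull E := by
    rw [hi.eq, mid_pair]
    exact midpoint_mem_hull (subset_hull (by simp)) (subset_hull (by simp))
  have hE1 : E ⊆ c₁.1 := by
    rw [hi.eq, hi.eq₁, pair_subset_triple]; simp
  have hsub : p.1 ⊆ q.1 := fun w hw => h.mem_of_pos hp hq hb hw
    (hull_child_subset sp hi.mem₁ (hull_mono hE1 hm)) (hull_child_subset sq hc (hull_mono hcE hm))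
    (hi.interior b hb w hw)
  by_contra hne
  exact (h.conf q hq p hp hne).1
    (Finset.eq_of_subset_of_card_le hsub (by rw [sp.card, sq.card])).symm

lemma IsMesh.subordinate (h : IsMesh Ω κ K 𝒯) (hS : IsMarking 𝒯 S) {p c : RefTriangle}
    (hp : p ∈ 𝒯) (hc : c ∈ refineElement S p) : Subordinate S p.1 c.1 := by
  obtain ⟨_, _, _, sp⟩ := h.shape p hp
  exact subordinate_child sp (hS.ref p hp) (fun _ => h.mid_ref_notMem hS hp) hc

lemma IsMesh.conf_children (h : IsMesh Ω κ K 𝒯) (hS : IsMarking 𝒯 S) {p q c c' : RefTriangle}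
    (hp : p ∈ 𝒯) (hq : q ∈ 𝒯) (hc : c ∈ refineElement S p) (hc' : c' ∈ refineElement S q)
    (hne : p ≠ q ∨ c ≠ c') : c.1 ≠ c'.1 ∧ hull c.1 ∩ hull c'.1 ⊆ hull (c.1 ∩ c'.1) := by
  obtain ⟨_, _, _, sp⟩ := h.shape p hp
  obtain ⟨_, _, _, sq⟩ := h.shape q hq
  by_cases hpq : p = q
  · subst hpq
    exact conforming_children sp (fun _ => h.mid_ref_notMem hS hp) hc hc'
      (hne.resolve_left fun h => h rfl)
  · obtain ⟨b, hb⟩ := sp.isBary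
    obtain ⟨b', hb'⟩ := sq.isBary
    obtain ⟨_, _, _, sc⟩ := sp.exists_child hc
    have hcard := h.card_inter_le hp hq hpq
    have hconf := (h.conf p hp q hq hpq).2
    exact ⟨ne_of_hull_inter sc hcard fun u hu =>
      hconf ⟨hull_child_subset sp hc hu.1, hull_child_subset sq hc' hu.2⟩,
      hull_inter_subset_of_subordinate hb hb' hconf hcard (h.subordinate hS hp hc)
        (h.subordinate hS hq hc')⟩

lemma IsMesh.exists_unique_child (h : IsMesh Ω κ K 𝒯) (hS : IsMarking 𝒯 S) {E E' : Finset Plane}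
    {p : RefTriangle} (hp : p ∈ 𝒯) (hE : E ∈ p.1.powersetCard 2) (hE' : E' ∈ subEdges S E) :
    ∃ c ∈ refineElement S p, E' ⊆ c.1 ∧ ∀ c' ∈ refineElement S p, E' ⊆ c'.1 → c' = c := by
  obtain ⟨_, _, _, sp⟩ := h.shape p hp
  exact ObstacleAFEM.exists_unique_child sp (hS.ref p hp) hE hE'

/-- A child of `p` that contains `E`. -/
def childAt (S : Finset Plane → Prop) (E : Finset Plane) (p : RefTriangle) : RefTriangle :=
  Classical.epsilon fun c => c ∈ refineElement S p ∧ E ⊆ c.1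

lemma IsMesh.childAt_spec (h : IsMesh Ω κ K 𝒯) (hS : IsMarking 𝒯 S) {E E' : Finset Plane}
    (hE : E ∈ edges (tris 𝒯)) (hE' : E' ∈ subEdges S E) {p : RefTriangle} (hp : p ∈ elems 𝒯 E) :
    childAt S E' p ∈ refineElement S p ∧ E' ⊆ (childAt S E' p).1 := by
  obtain ⟨hp, hEp⟩ := mem_elems.1 hp
  obtain ⟨c, hc, hcE, -⟩ := h.exists_unique_child hS hp
    (Finset.mem_powersetCard.2 ⟨hEp, card_of_mem_edges hE⟩) hE'
  exact Classical.epsilon_spec (p := fun c => c ∈ refineElement S p ∧ E' ⊆ c.1) ⟨c, hc, hcE⟩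

lemma IsMesh.childAt_injOn (h : IsMesh Ω κ K 𝒯) (hS : IsMarking 𝒯 S) {E E' : Finset Plane}
    (hE : E ∈ edges (tris 𝒯)) (hE' : E' ∈ subEdges S E) :
    Set.InjOn (childAt S E') (elems 𝒯 E) := by
  intro p hp q hq hpq
  have h1 := h.childAt_spec hS hE hE' (Finset.mem_coe.1 hp)
  have h2 := h.childAt_spec hS hE hE' (Finset.mem_coe.1 hq)
  by_contra hne
  exact (h.conf_children hS (mem_elems.1 hp).1 (mem_elems.1 hq).1 h1.1 h2.1 (Or.inl hne)).1
    (congrArg Prod.fst hpq)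

lemma IsMesh.elems_sub (h : IsMesh Ω κ K 𝒯) (hS : IsMarking 𝒯 S) {E E' : Finset Plane}
    (hE : E ∈ edges (tris 𝒯)) (hE' : E' ∈ subEdges S E) :
    elems (refineMesh S 𝒯) E' = (elems 𝒯 E).image (childAt S E') := by
  ext c
  rw [mem_elems, Finset.mem_image, refineMesh, Finset.mem_biUnion]
  constructor
  · rintro ⟨⟨p, hp, hc⟩, hcE⟩
    have hpE : p ∈ elems 𝒯 E := mem_elems.2 ⟨hp, h.edge_subset_of_child hE hE' hp hc hcE⟩
    have h1 := h.childAt_spec hS hE hE' hpE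
    obtain ⟨c', -, -, hu⟩ := h.exists_unique_child hS hp
      (Finset.mem_powersetCard.2 ⟨(mem_elems.1 hpE).2, card_of_mem_edges hE⟩) hE'
    exact ⟨p, hpE, by rw [hu _ h1.1 h1.2, hu c hc hcE]⟩
  · rintro ⟨p, hp, rfl⟩
    have h1 := h.childAt_spec hS hE hE' hp
    exact ⟨⟨p, (mem_elems.1 hp).1, h1.1⟩, h1.2⟩

lemma IsMesh.sum_elems_sub (h : IsMesh Ω κ K 𝒯) (hS : IsMarking 𝒯 S) {E E' : Finset Plane}
    (hE : E ∈ edges (tris 𝒯)) (hE' : E' ∈ subEdges S E) {A : Type*} [AddCommMonoid A]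
    (G : RefTriangle → A) :
    ∑ c ∈ elems (refineMesh S 𝒯) E', G c = ∑ p ∈ elems 𝒯 E, G (childAt S E' p) := by
  rw [h.elems_sub hS hE hE', Finset.sum_image (h.childAt_injOn hS hE hE')]

lemma IsMesh.card_elems_sub (h : IsMesh Ω κ K 𝒯) (hS : IsMarking 𝒯 S) {E E' : Finset Plane}
    (hE : E ∈ edges (tris 𝒯)) (hE' : E' ∈ subEdges S E) :
    (elems (refineMesh S 𝒯) E').card = (elems 𝒯 E).card := by
  rw [h.elems_sub hS hE hE', Finset.card_image_of_injOn (h.childAt_injOn hS hE hE')]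

lemma IsMesh.elems_inner_eq_filter (h : IsMesh Ω κ K 𝒯) {p c₁ c₂ : RefTriangle}
    {E : Finset Plane} {u v a d : Plane} (hp : p ∈ 𝒯) (hi : IsInner S p E c₁ c₂ u v a d) :
    elems (refineMesh S 𝒯) E = (refineElement S p).filter fun c => E ⊆ c.1 := by
  ext c
  rw [mem_elems, refineMesh, Finset.mem_biUnion, Finset.mem_filter]
  constructor
  · rintro ⟨⟨q, hq, hc⟩, hcE⟩
    exact ⟨h.eq_of_inner hp hi hq hc hcE ▸ hc, hcE⟩
  · rintro ⟨hc, hcE⟩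
    exact ⟨⟨p, hp, hc⟩, hcE⟩

lemma IsMesh.elems_inner (h : IsMesh Ω κ K 𝒯) {p c₁ c₂ : RefTriangle}
    {E : Finset Plane} {u v a d : Plane} (hp : p ∈ 𝒯) (hi : IsInner S p E c₁ c₂ u v a d) :
    elems (refineMesh S 𝒯) E = {c₁, c₂} := by
  rw [h.elems_inner_eq_filter hp hi]
  ext c
  rw [Finset.mem_filter, Finset.mem_insert, Finset.mem_singleton]
  constructor
  · rintro ⟨hc, hcE⟩; exact hi.unique c hc hcE
  · rintro (rfl | rfl)
    · exact ⟨hi.mem₁, by rw [hi.eq, hi.eq₁, pair_subset_triple]; simp⟩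
    · exact ⟨hi.mem₂, by rw [hi.eq, hi.eq₂, pair_subset_triple]; simp⟩

lemma IsMesh.exists_isInner (h : IsMesh Ω κ K 𝒯) (hS : IsMarking 𝒯 S) {p : RefTriangle}
    (hp : p ∈ 𝒯) {E : Finset Plane} (hE : E ∈ innerEdges S p) :
    S p.2 ∧ ∃ c₁ c₂ u v a d, IsInner S p E c₁ c₂ u v a d := by
  obtain ⟨_, _, _, sp⟩ := h.shape p hp
  by_cases hSp : S p.2
  · exact ⟨hSp, ObstacleAFEM.exists_isInner sp hSp hE⟩
  · rw [innerEdges_of_not sp (hS.ref p hp) hSp] at hE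
    exact absurd hE (Finset.notMem_empty E)

lemma mem_interiorEdges_of_injOn (hcard : ∀ p ∈ 𝒯, p.1.card = 3)
    (hinj : ∀ p ∈ 𝒯, ∀ q ∈ 𝒯, p ≠ q → p.1 ≠ q.1) {E : Finset Plane} :
    E ∈ interiorEdges (tris 𝒯) ↔ E ∈ edges (tris 𝒯) ∧ 2 ≤ (elems 𝒯 E).card := by
  rw [interiorEdges, Finset.mem_filter]
  refine and_congr_right fun hE => ?_
  constructor
  · rintro ⟨T, hT, T', hT', hne, rfl⟩
    obtain ⟨p, hp, rfl⟩ := Finset.mem_image.1 hT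
    obtain ⟨q, hq, rfl⟩ := Finset.mem_image.1 hT'
    exact Finset.one_lt_card.2 ⟨p, mem_elems.2 ⟨hp, Finset.inter_subset_left⟩, q,
      mem_elems.2 ⟨hq, Finset.inter_subset_right⟩, fun e => hne (congrArg Prod.fst e)⟩
  · intro hc
    obtain ⟨p, hp, q, hq, hne⟩ := Finset.one_lt_card.1 hc
    obtain ⟨hp, hEp⟩ := mem_elems.1 hp
    obtain ⟨hq, hEq⟩ := mem_elems.1 hq
    have hne := hinj p hp q hq hne
    refine ⟨p.1, Finset.mem_image_of_mem _ hp, q.1, Finset.mem_image_of_mem _ hq, hne, ?_⟩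
    exact Finset.eq_of_subset_of_card_le (Finset.subset_inter hEp hEq)
      (by rw [card_of_mem_edges hE]; exact card_inter_le_two (hcard p hp) (hcard q hq) hne)

lemma IsMesh.mem_interiorEdges (h : IsMesh Ω κ K 𝒯) {E : Finset Plane} :
    E ∈ interiorEdges (tris 𝒯) ↔ E ∈ edges (tris 𝒯) ∧ 2 ≤ (elems 𝒯 E).card := by
  refine mem_interiorEdges_of_injOn (fun p hp => ?_) fun p hp q hq hne => (h.conf p hp q hq hne).1
  obtain ⟨_, _, _, sp⟩ := h.shape p hp
  exact sp.card

lemma mem_edges_refineMesh {E' : Finset Plane} (hE' : E' ∈ edges (tris (refineMesh S 𝒯))) :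
    (∃ E ∈ edges (tris 𝒯), E' ∈ subEdges S E) ∨ ∃ p ∈ 𝒯, E' ∈ innerEdges S p := by
  obtain ⟨c, hc, hE'⟩ := mem_edges.1 hE'
  obtain ⟨p, hp, hc⟩ := Finset.mem_biUnion.1 hc
  by_cases hsub : E' ∈ (p.1.powersetCard 2).biUnion (subEdges S)
  · obtain ⟨E, hE, hEE'⟩ := Finset.mem_biUnion.1 hsub
    exact Or.inl ⟨E, mem_edges.2 ⟨p, hp, hE⟩, hEE'⟩
  · exact Or.inr ⟨p, hp, Finset.mem_sdiff.2 ⟨Finset.mem_biUnion.2 ⟨c, hc, hE'⟩, hsub⟩⟩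

lemma IsMesh.refineMesh (h : IsMesh Ω κ K 𝒯) (hS : IsMarking 𝒯 S) (hK : 2 ≤ K) :
    IsMesh Ω κ K (refineMesh S 𝒯) := by
  have hconf : ∀ p ∈ ObstacleAFEM.refineMesh S 𝒯, ∀ q ∈ ObstacleAFEM.refineMesh S 𝒯, p ≠ q →
      p.1 ≠ q.1 ∧ hull p.1 ∩ hull q.1 ⊆ hull (p.1 ∩ q.1) := by
    intro c hc c' hc' hne
    obtain ⟨p, hp, hc⟩ := Finset.mem_biUnion.1 hc
    obtain ⟨q, hq, hc'⟩ := Finset.mem_biUnion.1 hc'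
    exact h.conf_children hS hp hq hc hc' (Or.inr hne)
  have hshape : ∀ p ∈ ObstacleAFEM.refineMesh S 𝒯, ∃ z x y, IsShape κ p z x y := by
    intro c hc
    obtain ⟨p, hp, hc⟩ := Finset.mem_biUnion.1 hc
    obtain ⟨_, _, _, sp⟩ := h.shape p hp
    exact sp.exists_child hc
  have hcover : ⋃ p ∈ ObstacleAFEM.refineMesh S 𝒯, hull p.1 = closure Ω := by
    rw [ObstacleAFEM.refineMesh, Finset.set_biUnion_biUnion, ← h.cover]
    refine Set.iUnion₂_congr fun p hp => ?_
    obtain ⟨_, _, _, sp⟩ := h.shape p hp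
    exact iUnion_hull_refineElement sp
  have hval : ∀ E ∈ edges (tris (ObstacleAFEM.refineMesh S 𝒯)),
      (elems (ObstacleAFEM.refineMesh S 𝒯) E).card ≤ K := by
    intro E' hE'
    rcases mem_edges_refineMesh hE' with ⟨E, hE, hEE'⟩ | ⟨p, hp, hpE⟩
    · rw [h.card_elems_sub hS hE hEE']; exact h.valence E hE
    · obtain ⟨-, _, _, _, _, _, _, hi⟩ := h.exists_isInner hS hp hpE
      rw [h.elems_inner hp hi]; exact Finset.card_le_two.trans hK
  have hint : ∀ E' ∈ edges (tris (ObstacleAFEM.refineMesh S 𝒯)),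
      2 ≤ (elems (ObstacleAFEM.refineMesh S 𝒯) E').card →
      E' ∈ interiorEdges (tris (ObstacleAFEM.refineMesh S 𝒯)) := fun E' hE' hc =>
    (mem_interiorEdges_of_injOn (fun p hp => by obtain ⟨_, _, _, sp⟩ := hshape p hp; exact sp.card)
      fun p hp q hq hne => (hconf p hp q hq hne).1).2 ⟨hE', hc⟩
  refine ⟨hshape, hconf, hcover, ?_, hval⟩
  intro E' hE'
  obtain ⟨hE', hni⟩ := Finset.mem_sdiff.1 hE'
  rcases mem_edges_refineMesh hE' with ⟨E, hE, hEE'⟩ | ⟨p, hp, hpE⟩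
  · refine (subEdges_properties (card_of_mem_edges hE) hEE').2.1.trans (h.bdry E ?_)
    refine Finset.mem_sdiff.2 ⟨hE, fun hi => hni (hint E' hE' ?_)⟩
    rw [h.card_elems_sub hS hE hEE']
    exact (h.mem_interiorEdges.1 hi).2
  · obtain ⟨-, _, _, _, _, _, _, hi⟩ := h.exists_isInner hS hp hpE
    refine absurd (hint E' hE' ?_) hni
    rw [h.elems_inner hp hi, Finset.card_pair hi.ne]

lemma isMarking_markClosure (h : IsMesh Ω κ K 𝒯) {M : Finset (Finset Plane)}
    (hM : M ⊆ edges (tris 𝒯)) : IsMarking 𝒯 (MarkClosure 𝒯 M) := by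
  refine ⟨?_, fun p hp E hE hS => .ref p hp E hE hS⟩
  intro E hE
  cases hE with
  | base _ hE => exact mem_edges.1 (hM hE)
  | ref p hp _ _ _ =>
    obtain ⟨_, _, _, sp⟩ := h.shape p hp
    exact ⟨p, hp, sp.ref_mem⟩

end Step

/-! ### Gradients of piecewise affine functions -/

lemma hasGradientAt_affine (A : Plane →ᵃ[ℝ] ℝ) (x : Plane) :
    HasGradientAt A ((InnerProductSpace.toDual ℝ Plane).symm
      (LinearMap.toContinuousLinearMap A.linear)) x := by
  rw [hasGradientAt_iff_hasFDerivAt, LinearIsometryEquiv.apply_symm_apply]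
  have h : (A : Plane → ℝ) = fun w => LinearMap.toContinuousLinearMap A.linear w + A 0 := by
    funext w
    have := A.map_vadd 0 w
    simpa using this
  rw [h]
  exact (LinearMap.toContinuousLinearMap A.linear).hasFDerivAt.add_const _

/-- The gradient of an affine function. -/
def affGrad (A : Plane →ᵃ[ℝ] ℝ) : Plane := gradient A 0

lemma gradient_affine (A : Plane →ᵃ[ℝ] ℝ) (x : Plane) : gradient A x = affGrad A := by
  unfold affGrad
  rw [(hasGradientAt_affine A x).gradient, (hasGradientAt_affine A 0).gradient]

lemma affGrad_sub (A B : Plane →ᵃ[ℝ] ℝ) : affGrad (A - B) = affGrad A - affGrad B := by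
  unfold affGrad
  rw [(hasGradientAt_affine A 0).gradient, (hasGradientAt_affine B 0).gradient,
    (hasGradientAt_affine (A - B) 0).gradient, ← map_sub]
  rfl

lemma gradient_eq_affGrad {U : Plane → ℝ} {A : Plane →ᵃ[ℝ] ℝ} {s : Set Plane}
    (h : Set.EqOn U A s) {x : Plane} (hx : x ∈ interior s) : gradient U x = affGrad A := by
  have : U =ᶠ[nhds x] A := by
    filter_upwards [mem_interior_iff_mem_nhds.1 hx] with y hy using h hy
  rw [this.gradient_eq, gradient_affine]

lemma IsShape.centroid_mem {κ : ℝ} {p : RefTriangle} {z x y : Plane} (h : IsShape κ p z x y) :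
    p.1.centroid ℝ id ∈ interior (hull p.1) := by
  obtain ⟨b, hb⟩ := h.isBary
  have hw : ∑ v ∈ p.1, p.1.centroidWeights ℝ v = 1 :=
    p.1.sum_centroidWeights_eq_one_of_card_eq_add_one ℝ h.card
  have hc : p.1.centroid ℝ id = ∑ v ∈ p.1, p.1.centroidWeights ℝ v • v := by
    rw [Finset.centroid_def, Finset.affineCombination_eq_linear_combination _ _ _ hw]; rfl
  refine hb.mem_interior fun v hv => ?_
  rw [hc, affine_apply_sum _ _ _ hw]
  have hpos : ∀ u, 0 < p.1.centroidWeights ℝ u := fun u => by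
    rw [Finset.centroidWeights_apply, h.card]; norm_num
  exact Finset.sum_pos' (fun u hu => mul_nonneg (hpos u).le (hb.nonneg_vertex hu hv))
    ⟨v, hv, by rw [hb.self hv, mul_one]; exact hpos v⟩

lemma IsShape.gradOn_eq {κ : ℝ} {p : RefTriangle} {z x y : Plane} (h : IsShape κ p z x y)
    {U : Plane → ℝ} {A : Plane →ᵃ[ℝ] ℝ} (hU : Set.EqOn U A (hull p.1)) :
    gradOn U p.1 = affGrad A := gradient_eq_affGrad hU h.centroid_mem

lemma IsShape.gradOn_child {κ : ℝ} {S : Finset Plane → Prop} {p c : RefTriangle} {z x y : Plane}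
    (h : IsShape κ p z x y) (hc : c ∈ refineElement S p) {U : Plane → ℝ}
    (hU : AffineOn U (hull p.1)) : gradOn U c.1 = gradOn U p.1 := by
  obtain ⟨A, hA⟩ := hU
  obtain ⟨_, _, _, sc⟩ := h.exists_child hc
  rw [h.gradOn_eq hA, sc.gradOn_eq (hA.mono (hull_child_subset h hc))]

lemma IsShape.gradOn_sub {κ : ℝ} {p : RefTriangle} {z x y : Plane}
    (h : IsShape κ p z x y) {U V : Plane → ℝ}
    (hU : AffineOn U (hull p.1)) (hV : AffineOn V (hull p.1)) :
    gradOn (U - V) p.1 = gradOn U p.1 - gradOn V p.1 := by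
  obtain ⟨A, hA⟩ := hU
  obtain ⟨B, hB⟩ := hV
  rw [h.gradOn_eq hA, h.gradOn_eq hB, ← affGrad_sub]
  refine h.gradOn_eq fun x hx => ?_
  change U x - V x = A x - B x
  rw [hA hx, hB hx]

lemma AffineOn.mono {U : Plane → ℝ} {s t : Set Plane} (h : AffineOn U t) (hst : s ⊆ t) :
    AffineOn U s := h.imp fun _ hA => hA.mono hst

lemma AffineOn.sub {U V : Plane → ℝ} {s : Set Plane} (hU : AffineOn U s) (hV : AffineOn V s) :
    AffineOn (U - V) s := by
  obtain ⟨A, hA⟩ := hU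
  obtain ⟨B, hB⟩ := hV
  refine ⟨A - B, fun x hx => ?_⟩
  change U x - V x = A x - B x
  rw [hA hx, hB hx]

/-! ### Normals -/

/-- `n` is the outer unit normal of the triangle `T` on its edge `E`. -/
def IsOuterNormal (T E : Finset Plane) (n : Plane) : Prop :=
  ‖n‖ = 1 ∧ (∀ x ∈ E, ∀ y ∈ E, inner ℝ n (x - y) = 0) ∧ ∀ x ∈ E, ∀ z ∈ T, inner ℝ n (z - x) ≤ 0

lemma inner_plane (u v : Plane) : inner ℝ u v = u 0 * v 0 + u 1 * v 1 := by
  simp [PiLp.inner_apply, mul_comm]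

lemma norm_sq_plane (u : Plane) : ‖u‖ ^ 2 = u 0 ^ 2 + u 1 ^ 2 := by
  rw [EuclideanSpace.norm_sq_eq]; simp

lemma exists_outerNormal {u v a : Plane} (h : orient u v a ≠ 0) :
    ∃ n, IsOuterNormal {u, v, a} {u, v} n := by
  have huv : u ≠ v := (orient_ne_of_ne h).1
  have hd : 0 < dist u v := dist_pos.2 huv
  obtain ⟨s, hs, hs'⟩ : ∃ s : ℝ, s ^ 2 = 1 ∧ s * orient u v a ≤ 0 := by
    rcases lt_or_gt_of_ne h with h' | h'
    · exact ⟨1, by norm_num, by linarith⟩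
    · exact ⟨-1, by norm_num, by linarith⟩
  have hdd := dist_sq_plane u v
  let n : Plane := !₂[s / dist u v * -(v 1 - u 1), s / dist u v * (v 0 - u 0)]
  have n0 : n 0 = s / dist u v * -(v 1 - u 1) := rfl
  have n1 : n 1 = s / dist u v * (v 0 - u 0) := rfl
  have huv0 : inner ℝ n (u - v) = 0 := by
    rw [inner_plane, n0, n1]; simp; ring
  have ha : inner ℝ n (a - u) ≤ 0 := by
    have : inner ℝ n (a - u) = s * orient u v a / dist u v := by
      rw [inner_plane, n0, n1]; simp [orient]; ring
    rw [this]
    exact div_nonpos_of_nonpos_of_nonneg hs' hd.le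
  have hvu0 : inner ℝ n (v - u) = 0 := by rw [← neg_sub, inner_neg_right, huv0, neg_zero]
  refine ⟨n, ?_, ?_, ?_⟩
  · have : ‖n‖ ^ 2 = 1 := by
      rw [norm_sq_plane, n0, n1]
      field_simp
      rw [hdd, hs]; ring
    nlinarith [norm_nonneg n]
  · intro x hx y hy
    simp only [Finset.mem_insert, Finset.mem_singleton] at hx hy
    rcases hx with rfl | rfl <;> rcases hy with rfl | rfl <;> simp [huv0, hvu0]
  · intro x hx z hz
    have hav : inner ℝ n (a - v) ≤ 0 := by
      rw [← sub_add_sub_cancel a u v, inner_add_right, huv0, add_zero]; exact ha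
    simp only [Finset.mem_insert, Finset.mem_singleton] at hx hz
    rcases hx with rfl | rfl <;> rcases hz with rfl | rfl | rfl <;> simp [huv0, hvu0, ha, hav]

lemma outerNormal_unique {u v a n n' : Plane} (h : orient u v a ≠ 0)
    (hn : IsOuterNormal {u, v, a} {u, v} n) (hn' : IsOuterNormal {u, v, a} {u, v} n') : n = n' := by
  have hd : (v 0 - u 0) ^ 2 + (v 1 - u 1) ^ 2 ≠ 0 := by
    intro h0
    have h1 : v 0 - u 0 = 0 := by nlinarith [sq_nonneg (v 0 - u 0), sq_nonneg (v 1 - u 1)]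
    have h2 : v 1 - u 1 = 0 := by nlinarith [sq_nonneg (v 0 - u 0), sq_nonneg (v 1 - u 1)]
    apply h; unfold orient; rw [h1, h2]; ring
  have key : ∀ m : Plane, IsOuterNormal {u, v, a} {u, v} m → ∃ s : ℝ,
      m 0 = s * -(v 1 - u 1) ∧ m 1 = s * (v 0 - u 0) ∧
      s ^ 2 * ((v 0 - u 0) ^ 2 + (v 1 - u 1) ^ 2) = 1 ∧ s * orient u v a ≤ 0 := by
    rintro m ⟨h1, h2, h3⟩
    have e := h2 v (by simp) u (by simp)
    have l := h3 u (by simp) a (by simp)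
    have q : ‖m‖ ^ 2 = 1 := by rw [h1]; norm_num
    rw [norm_sq_plane] at q
    rw [inner_plane] at e l
    simp only [PiLp.sub_apply] at e l
    have m0 : m 0 = (m 1 * (v 0 - u 0) - m 0 * (v 1 - u 1)) /
        ((v 0 - u 0) ^ 2 + (v 1 - u 1) ^ 2) * -(v 1 - u 1) := by
      field_simp
      linear_combination (v 0 - u 0) * e
    have m1 : m 1 = (m 1 * (v 0 - u 0) - m 0 * (v 1 - u 1)) /
        ((v 0 - u 0) ^ 2 + (v 1 - u 1) ^ 2) * (v 0 - u 0) := by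
      field_simp
      linear_combination (v 1 - u 1) * e
    generalize (m 1 * (v 0 - u 0) - m 0 * (v 1 - u 1)) /
        ((v 0 - u 0) ^ 2 + (v 1 - u 1) ^ 2) = s at m0 m1
    refine ⟨s, m0, m1, ?_, ?_⟩
    · rw [m0, m1] at q; linear_combination q
    · rw [m0, m1] at l; unfold orient; linarith
  obtain ⟨s, a0, a1, a2, a3⟩ := key n hn
  obtain ⟨t, b0, b1, b2, b3⟩ := key n' hn'
  have hst : s = t := by
    have : s ^ 2 = t ^ 2 := mul_right_cancel₀ hd (a2.trans b2.symm)
    rcases sq_eq_sq_iff_eq_or_eq_neg.1 this with h' | h'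
    · exact h'
    · exfalso
      have h0 : s * orient u v a = 0 := by
        rw [h'] at a3 ⊢; linarith
      rcases mul_eq_zero.1 h0 with h0 | h0
      · rw [h0] at a2; norm_num at a2
      · exact h h0
  subst hst
  exact plane_ext (a0.trans b0.symm) (a1.trans b1.symm)

lemma IsShape.exists_edge {κ : ℝ} {p : RefTriangle} {z x y : Plane} (h : IsShape κ p z x y)
    {E : Finset Plane} (hE : E ∈ p.1.powersetCard 2) :
    ∃ u v a, E = {u, v} ∧ p.1 = {u, v, a} ∧ orient u v a ≠ 0 := by
  have e := h.eq
  subst e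
  rcases powersetCard_two_triple hE with rfl | rfl | rfl
  · exact ⟨z, x, y, rfl, rfl, h.ne⟩
  · exact ⟨z, y, x, rfl, by simp [Finset.pair_comm], h.swap.ne⟩
  · exact ⟨x, y, z, rfl, by ext w; simp; tauto, by rw [orient_cycle]; exact h.ne⟩

lemma IsShape.outerNormal_spec {κ : ℝ} {p : RefTriangle} {z x y : Plane} (h : IsShape κ p z x y)
    {E : Finset Plane} (hE : E ∈ p.1.powersetCard 2) :
    IsOuterNormal p.1 E (outerNormal p.1 E) := by
  obtain ⟨u, v, a, rfl, e, ho⟩ := h.exists_edge hE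
  rw [e]
  exact Classical.epsilon_spec (p := fun n => IsOuterNormal {u, v, a} {u, v} n)
    (exists_outerNormal ho)

lemma IsShape.outerNormal_eq {κ : ℝ} {p : RefTriangle} {z x y : Plane} (h : IsShape κ p z x y)
    {E : Finset Plane} (hE : E ∈ p.1.powersetCard 2) {n : Plane} (hn : IsOuterNormal p.1 E n) :
    outerNormal p.1 E = n := by
  have hs := h.outerNormal_spec hE
  obtain ⟨u, v, a, rfl, e, ho⟩ := h.exists_edge hE
  rw [e] at hs hn ⊢
  exact outerNormal_unique ho hs hn

/-- The affine function `w ↦ ⟪n, w - x⟫`. -/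
def innerMap (n x : Plane) : Plane →ᵃ[ℝ] ℝ where
  toFun w := inner ℝ n (w - x)
  linear := (innerSL ℝ n).toLinearMap
  map_vadd' p v := by simp [inner_add_right, inner_sub_right]; ring

/-- A triangle in `T` with an edge in the edge `E` of `T` has the same normal there. -/
lemma IsOuterNormal.mono {T E T' E' : Finset Plane} {n : Plane} (h : IsOuterNormal T E n)
    (hE : E.Nonempty) (hT : hull T' ⊆ hull T) (hE' : hull E' ⊆ hull E) : IsOuterNormal T' E' n := by
  obtain ⟨h1, h2, h3⟩ := h
  obtain ⟨x, hx⟩ := hE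
  have e1 : ∀ w ∈ E', inner ℝ n (w - x) = 0 := fun w hw =>
    eq_zero_on_hull (φ := innerMap n x) (fun v hv => h2 v hv x hx) (hE' (subset_hull hw))
  have e2 : ∀ w ∈ T', 0 ≤ (-innerMap n x) w := fun w hw =>
    nonneg_on_hull (φ := -innerMap n x) (fun v hv => by
      change 0 ≤ -inner ℝ n (v - x)
      linarith [h3 x hx v hv]) (hT (subset_hull hw))
  refine ⟨h1, fun u hu v hv => ?_, fun u hu v hv => ?_⟩
  · rw [← sub_sub_sub_cancel_right u v x, inner_sub_right, e1 u hu, e1 v hv, sub_zero]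
  · have := e2 v hv
    change 0 ≤ -inner ℝ n (v - x) at this
    rw [← sub_sub_sub_cancel_right v u x, inner_sub_right, e1 u hu]
    linarith

/-! ### Jumps of the normal derivative -/

section Step

variable {Ω : Set Plane} {κ : ℝ} {K : ℕ} {𝒯 : Finset RefTriangle} {S : Finset Plane → Prop}

lemma IsMesh.fst_injOn (h : IsMesh Ω κ K 𝒯) : Set.InjOn Prod.fst (𝒯 : Set RefTriangle) := by
  intro p hp q hq e
  by_contra hne
  exact (h.conf p hp q hq hne).1 e

lemma IsMesh.sum_tris (h : IsMesh Ω κ K 𝒯) (E : Finset Plane) (G : Finset Plane → ℝ) :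
    ∑ T ∈ tris 𝒯 with E ⊆ T, G T = ∑ p ∈ elems 𝒯 E, G p.1 := by
  unfold tris elems
  rw [Finset.filter_image, Finset.sum_image]
  exact h.fst_injOn.mono (by exact_mod_cast Finset.filter_subset _ _)

lemma IsMesh.normalJump_eq (h : IsMesh Ω κ K 𝒯) (U : Plane → ℝ) (E : Finset Plane) :
    normalJump (tris 𝒯) U E =
      ∑ p ∈ elems 𝒯 E, inner ℝ (gradOn U p.1) (outerNormal p.1 E) :=
  h.sum_tris E _

lemma IsMesh.normalJump_sub (h : IsMesh Ω κ K 𝒯) {U V : Plane → ℝ}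
    (hU : ∀ p ∈ 𝒯, AffineOn U (hull p.1)) (hV : ∀ p ∈ 𝒯, AffineOn V (hull p.1))
    (E : Finset Plane) :
    normalJump (tris 𝒯) (U - V) E = normalJump (tris 𝒯) U E - normalJump (tris 𝒯) V E := by
  rw [h.normalJump_eq, h.normalJump_eq, h.normalJump_eq, ← Finset.sum_sub_distrib]
  refine Finset.sum_congr rfl fun p hp => ?_
  have hp := (mem_elems.1 hp).1
  obtain ⟨_, _, _, sp⟩ := h.shape p hp
  rw [sp.gradOn_sub (hU p hp) (hV p hp), inner_sub_left]

lemma IsMesh.normalJump_sq_le (h : IsMesh Ω κ K 𝒯) (U : Plane → ℝ) {E : Finset Plane}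
    (hE : E ∈ edges (tris 𝒯)) :
    normalJump (tris 𝒯) U E ^ 2 ≤ K * ∑ p ∈ elems 𝒯 E, ‖gradOn U p.1‖ ^ 2 := by
  rw [h.normalJump_eq]
  refine sq_sum_le_card_mul_sum_sq.trans ?_
  refine mul_le_mul (by exact_mod_cast h.valence E hE) (Finset.sum_le_sum fun p hp => ?_)
    (Finset.sum_nonneg fun _ _ => sq_nonneg _) (Nat.cast_nonneg _)
  obtain ⟨hp, hEp⟩ := mem_elems.1 hp
  obtain ⟨_, _, _, sp⟩ := h.shape p hp
  have hn := (sp.outerNormal_spec (Finset.mem_powersetCard.2 ⟨hEp, card_of_mem_edges hE⟩)).1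
  rw [← sq_abs]
  have := abs_real_inner_le_norm (gradOn U p.1) (outerNormal p.1 E)
  rw [hn, mul_one] at this
  exact pow_le_pow_left₀ (abs_nonneg _) this 2

lemma IsMesh.normalJump_subEdge (h : IsMesh Ω κ K 𝒯) (hS : IsMarking 𝒯 S)
    (h' : IsMesh Ω κ K (ObstacleAFEM.refineMesh S 𝒯)) {U : Plane → ℝ}
    (hU : ∀ p ∈ 𝒯, AffineOn U (hull p.1)) {E E' : Finset Plane} (hE : E ∈ edges (tris 𝒯))
    (hE' : E' ∈ subEdges S E) :
    normalJump (tris (ObstacleAFEM.refineMesh S 𝒯)) U E' = normalJump (tris 𝒯) U E := by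
  rw [h.normalJump_eq, h'.normalJump_eq, h.sum_elems_sub hS hE hE']
  refine Finset.sum_congr rfl fun p hp => ?_
  obtain ⟨hc, hcE⟩ := h.childAt_spec hS hE hE' hp
  obtain ⟨hp, hEp⟩ := mem_elems.1 hp
  obtain ⟨_, _, _, sp⟩ := h.shape p hp
  obtain ⟨_, _, _, sc⟩ := sp.exists_child hc
  have hcard := card_of_mem_edges hE
  obtain ⟨h1, h2, -⟩ := subEdges_properties hcard hE'
  have hn := sp.outerNormal_spec (Finset.mem_powersetCard.2 ⟨hEp, hcard⟩)
  rw [sp.gradOn_child hc (hU p hp), sc.outerNormal_eq (Finset.mem_powersetCard.2 ⟨hcE, h1⟩)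
    (hn.mono (Finset.card_pos.1 (by omega)) (hull_child_subset sp hc) h2)]

lemma IsMesh.normalJump_innerEdge (h : IsMesh Ω κ K 𝒯) (hS : IsMarking 𝒯 S)
    (h' : IsMesh Ω κ K (ObstacleAFEM.refineMesh S 𝒯)) {U : Plane → ℝ}
    (hU : ∀ p ∈ 𝒯, AffineOn U (hull p.1)) {p : RefTriangle} (hp : p ∈ 𝒯) {E : Finset Plane}
    (hE : E ∈ innerEdges S p) : normalJump (tris (ObstacleAFEM.refineMesh S 𝒯)) U E = 0 := by
  obtain ⟨-, c₁, c₂, u, v, a, d, hi⟩ := h.exists_isInner hS hp hE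
  obtain ⟨_, _, _, sp⟩ := h.shape p hp
  obtain ⟨_, _, _, s1⟩ := sp.exists_child hi.mem₁
  obtain ⟨_, _, _, s2⟩ := sp.exists_child hi.mem₂
  rw [h'.normalJump_eq, h.elems_inner hp hi, Finset.sum_pair hi.ne,
    sp.gradOn_child hi.mem₁ (hU p hp), sp.gradOn_child hi.mem₂ (hU p hp), ← inner_add_right]
  have huv : u ≠ v := by
    rintro rfl
    have := s1.card
    rw [hi.eq₁, Finset.insert_eq_of_mem (Finset.mem_insert_self _ _)] at this
    have := Finset.card_le_two (a := u) (b := a)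
    omega
  have hE1 : E ∈ c₁.1.powersetCard 2 := by
    rw [hi.eq, hi.eq₁]; exact pair_mem_powersetCard (by simp) (by simp) huv
  have hE2 : E ∈ c₂.1.powersetCard 2 := by
    rw [hi.eq, hi.eq₂]; exact pair_mem_powersetCard (by simp) (by simp) huv
  obtain ⟨n1, n2, n3⟩ := s1.outerNormal_spec hE1
  have hn : IsOuterNormal c₂.1 E (-outerNormal c₁.1 E) := by
    generalize outerNormal c₁.1 E = n at *
    refine ⟨by rw [norm_neg, n1], fun x hx y hy => by rw [inner_neg_left, n2 x hx y hy, neg_zero],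
      fun x hx w hw => ?_⟩
    have huE : u ∈ E := by rw [hi.eq]; simp
    have hvE : v ∈ E := by rw [hi.eq]; simp
    have key : ∀ w ∈ c₂.1, 0 ≤ inner ℝ n (w - u) := by
      intro w hw
      rw [hi.eq₂] at hw
      simp only [Finset.mem_insert, Finset.mem_singleton] at hw
      rcases hw with rfl | rfl | rfl
      · simp
      · exact (n2 _ hvE _ huE).ge
      · obtain ⟨β, γ, hβ, e⟩ := hi.opposite
        rw [e, inner_add_right, inner_neg_right, inner_smul_right, inner_smul_right,
          n2 _ hvE _ huE]
        have := n3 u huE a (by rw [hi.eq₁]; simp)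
        nlinarith
    rw [inner_neg_left, ← sub_sub_sub_cancel_right w x u, inner_sub_right, n2 x hx u huE]
    linarith [key w hw]
  rw [s2.outerNormal_eq hE2 hn, add_neg_cancel, inner_zero_right]

end Step

/-! ### Edge lengths -/

lemma len_pair (a b : Plane) : len {a, b} = dist a b := by
  unfold len hull
  rw [convexHull_diam]
  simp [Metric.diam_pair]

lemma len_nonneg (E : Finset Plane) : 0 ≤ len E := Metric.diam_nonneg

lemma etaSq_eq (τ : Finset (Finset Plane)) (U : Plane → ℝ) (E : Finset Plane) :
    etaSq τ U E = len E ^ 2 * normalJump τ U E ^ 2 := by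
  unfold etaSq
  rw [intervalIntegral.integral_const]
  simp; ring

lemma len_subEdge {S : Finset Plane → Prop} {E E' : Finset Plane} (hE : E.card = 2)
    (h : E' ∈ subEdges S E) : len E' = if S E then len E / 2 else len E := by
  obtain ⟨a, b, -, rfl⟩ := Finset.card_eq_two.1 hE
  by_cases hS : S {a, b}
  · rw [if_pos hS]
    rw [subEdges_of_mem hS] at h
    simp only [Finset.mem_insert, Finset.mem_singleton] at h
    rcases h with rfl | rfl
    · rw [len_pair, len_pair, dist_left_midpoint]; simp; ring
    · rw [len_pair, len_pair, dist_right_midpoint]; simp; ring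
  · rw [if_neg hS]
    rw [subEdges_of_not hS, Finset.mem_singleton] at h
    rw [h]

/-- The squared edge length is bounded by the area. -/
lemma IsShape.len_sq_le {κ : ℝ} {p : RefTriangle} {z x y : Plane} (h : IsShape κ p z x y)
    {E : Finset Plane} (hE : E ∈ p.1.powersetCard 2) :
    len E ^ 2 ≤ 2 * κ / stdArea * volume.real (hull p.1) := by
  rw [h.area]
  have e : 2 * κ / stdArea * (|orient z x y| * stdArea) = 2 * (κ * |orient z x y|) := by
    field_simp [stdArea_pos.ne']
  rw [e]
  have hle := h.le
  have e := h.eq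
  subst e
  rcases powersetCard_two_triple hE with rfl | rfl | rfl
  · rw [len_pair, dist_comm]; nlinarith [sq_nonneg (dist x z), sq_nonneg (dist y z)]
  · rw [len_pair, dist_comm]; nlinarith [sq_nonneg (dist x z), sq_nonneg (dist y z)]
  · rw [len_pair]
    have := dist_triangle_right x y z
    have h0 : 0 ≤ dist x y := dist_nonneg
    nlinarith [sq_nonneg (dist x z - dist y z)]

/-! ### Integrals over unions of elements -/

lemma setIntegral_iUnion_hull {s : Finset RefTriangle}
    (hd : ∀ p ∈ s, ∀ q ∈ s, p ≠ q → volume (hull p.1 ∩ hull q.1) = 0) {F : Plane → ℝ}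
    (hF : ∀ p ∈ s, IntegrableOn F (hull p.1)) :
    ∫ x in ⋃ p ∈ s, hull p.1, F x = ∑ p ∈ s, ∫ x in hull p.1, F x := by
  induction s using Finset.induction_on with
  | empty => simp
  | insert a s ha ih =>
    have hF' : ∀ p ∈ s, IntegrableOn F (hull p.1) := fun p hp => hF p (Finset.mem_insert_of_mem hp)
    rw [Finset.set_biUnion_insert, Finset.sum_insert ha, ← ih
      (fun p hp q hq => hd p (Finset.mem_insert_of_mem hp) q (Finset.mem_insert_of_mem hq)) hF']
    refine setIntegral_union₀ ?_ (Finset.measurableSet_biUnion _ fun p _ =>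
      measurableSet_hull p.1).nullMeasurableSet (hF a (Finset.mem_insert_self _ _))
      (integrableOn_finset_iUnion.2 hF')
    change volume _ = 0
    rw [Set.inter_iUnion₂]
    refine (measure_biUnion_null_iff s.countable_toSet).2 fun p hp => ?_
    exact hd a (Finset.mem_insert_self _ _) p (Finset.mem_insert_of_mem hp)
      (fun e => ha (e ▸ hp))

section Mesh

variable {Ω : Set Plane} {κ : ℝ} {K : ℕ} {𝒯 : Finset RefTriangle} {S : Finset Plane → Prop}

lemma IsMesh.volume_inter (h : IsMesh Ω κ K 𝒯) : ∀ p ∈ 𝒯, ∀ q ∈ 𝒯, p ≠ q →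
    volume (hull p.1 ∩ hull q.1) = 0 := fun p hp q hq hpq =>
  measure_mono_null (h.conf p hp q hq hpq).2 (volume_hull_of_card_le (h.card_inter_le hp hq hpq))

lemma IsMesh.setIntegral_iUnion (h : IsMesh Ω κ K 𝒯) {s : Finset RefTriangle} (hs : s ⊆ 𝒯)
    {F : Plane → ℝ} (hF : ∀ p ∈ s, IntegrableOn F (hull p.1)) :
    ∫ x in ⋃ p ∈ s, hull p.1, F x = ∑ p ∈ s, ∫ x in hull p.1, F x :=
  setIntegral_iUnion_hull (fun p hp q hq => h.volume_inter p (hs hp) q (hs hq)) hF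

lemma IsMesh.hull_subset (h : IsMesh Ω κ K 𝒯) {p : RefTriangle} (hp : p ∈ 𝒯) :
    hull p.1 ⊆ closure Ω := by
  rw [← h.cover]
  exact Set.subset_biUnion_of_mem (u := fun c : RefTriangle => hull c.1) hp

lemma closure_ae_eq (h0 : volume (frontier Ω) = 0) :
    closure Ω =ᵐ[volume] Ω := by
  rw [closure_eq_self_union_frontier]
  exact union_ae_eq_left_of_ae_eq_empty (ae_eq_empty.2 h0)

/-! ### The energy -/

lemma IsShape.integrableOn_gradient {p : RefTriangle} {z x y : Plane} (h : IsShape κ p z x y)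
    {W : Plane → ℝ} (hW : AffineOn W (hull p.1)) :
    IntegrableOn (fun x => inner ℝ (gradient W x) (gradient W x)) (hull p.1) ∧
    ∫ x in hull p.1, inner ℝ (gradient W x) (gradient W x) =
      volume.real (hull p.1) * ‖gradOn W p.1‖ ^ 2 := by
  obtain ⟨A, hA⟩ := hW
  rw [h.gradOn_eq hA]
  have hae : (fun x => inner ℝ (gradient W x) (gradient W x)) =ᵐ[volume.restrict (hull p.1)]
      fun _ => ‖affGrad A‖ ^ 2 := by
    rw [Filter.EventuallyEq, ae_restrict_iff' (measurableSet_hull _)]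
    have hn : volume (frontier (hull p.1)) = 0 := (convex_hull p.1).addHaar_frontier volume
    filter_upwards [measure_eq_zero_iff_ae_notMem.1 hn] with x hx hxT
    have hi : x ∈ interior (hull p.1) := by
      by_contra hni
      exact hx ⟨subset_closure hxT, hni⟩
    rw [gradient_eq_affGrad hA hi, real_inner_self_eq_norm_sq]
  constructor
  · refine IntegrableOn.congr_fun_ae ?_ hae.symm
    exact integrableOn_const (volume_hull_lt_top _).ne
  · rw [integral_congr_ae hae, setIntegral_const, smul_eq_mul]

lemma IsMesh.energyForm_eq (h : IsMesh Ω κ K 𝒯) (h0 : volume (frontier Ω) = 0)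
    {W : Plane → ℝ} (hW : ∀ p ∈ 𝒯, AffineOn W (hull p.1)) :
    energyForm Ω W W = ∑ p ∈ 𝒯, volume.real (hull p.1) * ‖gradOn W p.1‖ ^ 2 := by
  have hs : ∀ p ∈ 𝒯, IntegrableOn (fun x => inner ℝ (gradient W x) (gradient W x)) (hull p.1) ∧
    ∫ x in hull p.1, inner ℝ (gradient W x) (gradient W x) =
      volume.real (hull p.1) * ‖gradOn W p.1‖ ^ 2 := fun p hp => by
    obtain ⟨_, _, _, sp⟩ := h.shape p hp
    exact sp.integrableOn_gradient (hW p hp)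
  unfold energyForm
  rw [← setIntegral_congr_set (closure_ae_eq h0), ← h.cover,
    h.setIntegral_iUnion subset_rfl fun p hp => (hs p hp).1]
  exact Finset.sum_congr rfl fun p hp => (hs p hp).2

lemma IsMesh.sum_elems (h : IsMesh Ω κ K 𝒯) (G : RefTriangle → ℝ) :
    ∑ E ∈ edges (tris 𝒯), ∑ p ∈ elems 𝒯 E, G p = ∑ p ∈ 𝒯, 3 * G p := by
  rw [Finset.sum_comm' (t' := 𝒯) (s' := fun p => p.1.powersetCard 2)]
  · refine Finset.sum_congr rfl fun p hp => ?_
    obtain ⟨_, _, _, sp⟩ := h.shape p hp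
    rw [Finset.sum_const, Finset.card_powersetCard, sp.card]
    simp [Nat.choose]
  · intro E p
    rw [mem_elems, Finset.mem_powersetCard]
    constructor
    · rintro ⟨hE, hp, hEp⟩; exact ⟨⟨hEp, card_of_mem_edges hE⟩, hp⟩
    · rintro ⟨hE, hp⟩
      exact ⟨mem_edges.2 ⟨p, hp, Finset.mem_powersetCard.2 hE⟩, hp, hE.1⟩

/-- The squared jumps of a piecewise affine function are controlled by its energy. -/
lemma IsMesh.sum_jump_le (h : IsMesh Ω κ K 𝒯) (h0 : volume (frontier Ω) = 0)
    {W : Plane → ℝ} (hW : ∀ p ∈ 𝒯, AffineOn W (hull p.1)) :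
    ∑ E ∈ edges (tris 𝒯), len E ^ 2 * normalJump (tris 𝒯) W E ^ 2 ≤
      K * (3 * (2 * κ / stdArea)) * energyForm Ω W W := by
  calc ∑ E ∈ edges (tris 𝒯), len E ^ 2 * normalJump (tris 𝒯) W E ^ 2
      ≤ ∑ E ∈ edges (tris 𝒯), ∑ p ∈ elems 𝒯 E,
          K * (2 * κ / stdArea) * (volume.real (hull p.1) * ‖gradOn W p.1‖ ^ 2) := by
        refine Finset.sum_le_sum fun E hE => ?_
        refine (mul_le_mul_of_nonneg_left (h.normalJump_sq_le W hE) (sq_nonneg _)).trans ?_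
        rw [mul_left_comm, Finset.mul_sum, Finset.mul_sum]
        refine Finset.sum_le_sum fun p hp => ?_
        obtain ⟨hp, hEp⟩ := mem_elems.1 hp
        obtain ⟨_, _, _, sp⟩ := h.shape p hp
        have := sp.len_sq_le (Finset.mem_powersetCard.2 ⟨hEp, card_of_mem_edges hE⟩)
        have h1 := mul_le_mul_of_nonneg_right this (sq_nonneg ‖gradOn W p.1‖)
        calc (K : ℝ) * (len E ^ 2 * ‖gradOn W p.1‖ ^ 2)
            ≤ K * (2 * κ / stdArea * volume.real (hull p.1) * ‖gradOn W p.1‖ ^ 2) :=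
              mul_le_mul_of_nonneg_left h1 (Nat.cast_nonneg _)
          _ = _ := by ring
    _ = K * (3 * (2 * κ / stdArea)) * energyForm Ω W W := by
        rw [h.sum_elems, h.energyForm_eq h0 hW, Finset.mul_sum]
        exact Finset.sum_congr rfl fun p _ => by ring

/-! ### Oscillations -/

/-- The squared deviation of `f` from the constant `μ` on `s`. -/
def dev (f : Plane → ℝ) (μ : ℝ) (s : Set Plane) : ℝ := ∫ x in s, (f x - μ) ^ 2

lemma dev_nonneg (f : Plane → ℝ) (μ : ℝ) (s : Set Plane) : 0 ≤ dev f μ s :=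
  integral_nonneg fun _ => sq_nonneg _

/-- The integral mean is the best approximation by constants. -/
lemma dev_average_le {f : Plane → ℝ} {s : Set Plane} (hs : volume s < ⊤)
    (hf : MemLp f 2 (volume.restrict s)) (μ : ℝ) : dev f (⨍ y in s, f y) s ≤ dev f μ s := by
  have : IsFiniteMeasure (volume.restrict s) := ⟨by simpa using hs⟩
  set m := ⨍ y in s, f y with hm
  have h0 : ∫ x in s, (f x - m) = 0 := integral_sub_average _ f
  have hi : Integrable (fun x => f x - m) (volume.restrict s) :=
    (hf.integrable one_le_two).sub (integrable_const _)
  have hi2 : Integrable (fun x => (f x - m) ^ 2) (volume.restrict s) :=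
    (hf.sub (memLp_const m)).integrable_sq
  have e : dev f μ s = dev f m s + volume.real s * (m - μ) ^ 2 := by
    unfold dev
    have : ∀ x, (f x - μ) ^ 2 = ((f x - m) ^ 2 + 2 * (m - μ) * (f x - m)) + (m - μ) ^ 2 :=
      fun x => by ring
    simp_rw [this]
    have e1 : Integrable (fun x => (f x - m) ^ 2 + 2 * (m - μ) * (f x - m))
        (volume.restrict s) := hi2.add (hi.const_mul _)
    rw [integral_add e1 (integrable_const _),
      integral_add hi2 (hi.const_mul _), integral_const_mul, h0, integral_const]
    simp
  rw [e]
  exact le_add_of_nonneg_right (mul_nonneg measureReal_nonneg (sq_nonneg _))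

/-- The constant to which `f` is compared at the edge `E`. -/
def edgeMean (𝒯 : Finset RefTriangle) (f : Plane → ℝ) (E : Finset Plane) : ℝ :=
  if 2 ≤ (elems 𝒯 E).card then ⨍ y in patch (tris 𝒯) E, f y else 0

/-- The squared oscillation at an interior or boundary edge. -/
def edgeOsc (𝒯 : Finset RefTriangle) (f : Plane → ℝ) (E : Finset Plane) : ℝ :=
  volume.real (patch (tris 𝒯) E) * dev f (edgeMean 𝒯 f E) (patch (tris 𝒯) E)

/-- The squared deviation of `f` from its mean on the element `p`. -/
def elemDev (f : Plane → ℝ) (p : RefTriangle) : ℝ := dev f (⨍ y in hull p.1, f y) (hull p.1)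

lemma patch_eq (E : Finset Plane) : patch (tris 𝒯) E = ⋃ p ∈ elems 𝒯 E, hull p.1 := by
  ext x
  simp only [patch, tris, elems, Set.mem_iUnion, Finset.mem_image, Finset.mem_filter, exists_prop]
  constructor
  · rintro ⟨_, ⟨p, hp, rfl⟩, hE, hx⟩; exact ⟨p, ⟨hp, hE⟩, hx⟩
  · rintro ⟨p, ⟨hp, hE⟩, hx⟩; exact ⟨_, ⟨p, hp, rfl⟩, hE, hx⟩

lemma IsMesh.memLp (h : IsMesh Ω κ K 𝒯) {f : Plane → ℝ}
    (hf : MemLp f 2 (volume.restrict (closure Ω))) {p : RefTriangle} (hp : p ∈ 𝒯) :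
    MemLp f 2 (volume.restrict (hull p.1)) :=
  hf.mono_measure (Measure.restrict_mono (h.hull_subset hp) le_rfl)

lemma IsMesh.integrableOn_sq (h : IsMesh Ω κ K 𝒯) {f : Plane → ℝ}
    (hf : MemLp f 2 (volume.restrict (closure Ω))) (μ : ℝ) {p : RefTriangle} (hp : p ∈ 𝒯) :
    IntegrableOn (fun x => (f x - μ) ^ 2) (hull p.1) := by
  have : IsFiniteMeasure (volume.restrict (hull p.1)) := ⟨by simpa using volume_hull_lt_top p.1⟩
  exact ((h.memLp hf hp).sub (memLp_const μ)).integrable_sq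

lemma IsMesh.patch_subset (h : IsMesh Ω κ K 𝒯) (E : Finset Plane) :
    patch (tris 𝒯) E ⊆ closure Ω := by
  rw [patch_eq]
  exact Set.iUnion₂_subset fun p hp => h.hull_subset (mem_elems.1 hp).1

lemma volume_patch_lt_top (E : Finset Plane) : volume (patch (tris 𝒯) E) < ⊤ := by
  rw [patch_eq]
  exact measure_biUnion_lt_top (Finset.finite_toSet _) fun p _ => volume_hull_lt_top p.1

lemma IsMesh.volume_patch (h : IsMesh Ω κ K 𝒯) (E : Finset Plane) :
    volume.real (patch (tris 𝒯) E) = ∑ p ∈ elems 𝒯 E, volume.real (hull p.1) := by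
  have := h.setIntegral_iUnion (s := elems 𝒯 E) (F := fun _ => 1) (Finset.filter_subset _ _)
    fun p _ => integrableOn_const (volume_hull_lt_top _).ne
  simpa [patch_eq] using this

lemma IsMesh.dev_patch (h : IsMesh Ω κ K 𝒯) {f : Plane → ℝ}
    (hf : MemLp f 2 (volume.restrict (closure Ω))) (μ : ℝ) (E : Finset Plane) :
    dev f μ (patch (tris 𝒯) E) = ∑ p ∈ elems 𝒯 E, dev f μ (hull p.1) := by
  unfold dev
  rw [patch_eq, h.setIntegral_iUnion (s := elems 𝒯 E) (Finset.filter_subset _ _)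
    fun p hp => h.integrableOn_sq hf μ (mem_elems.1 hp).1]

lemma IsMesh.edgeOsc_eq (h : IsMesh Ω κ K 𝒯) {f : Plane → ℝ}
    (hf : MemLp f 2 (volume.restrict (closure Ω))) (E : Finset Plane) :
    edgeOsc 𝒯 f E = (∑ p ∈ elems 𝒯 E, volume.real (hull p.1)) *
      ∑ p ∈ elems 𝒯 E, dev f (edgeMean 𝒯 f E) (hull p.1) := by
  rw [edgeOsc, h.volume_patch, h.dev_patch hf]

lemma edgeOsc_nonneg (𝒯 : Finset RefTriangle) (f : Plane → ℝ) (E : Finset Plane) :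
    0 ≤ edgeOsc 𝒯 f E := mul_nonneg measureReal_nonneg (dev_nonneg _ _ _)

lemma IsMesh.edgeOsc_le (h : IsMesh Ω κ K 𝒯) {f : Plane → ℝ}
    (hf : MemLp f 2 (volume.restrict (closure Ω))) (E : Finset Plane) {μ : ℝ}
    (hμ : (elems 𝒯 E).card < 2 → μ = 0) :
    edgeOsc 𝒯 f E ≤ (∑ p ∈ elems 𝒯 E, volume.real (hull p.1)) *
      ∑ p ∈ elems 𝒯 E, dev f μ (hull p.1) := by
  rw [edgeOsc, h.volume_patch, ← h.dev_patch hf μ E]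
  refine mul_le_mul_of_nonneg_left ?_ (Finset.sum_nonneg fun _ _ => measureReal_nonneg)
  unfold edgeMean
  split_ifs with hc
  · exact dev_average_le (volume_patch_lt_top E)
      (hf.mono_measure (Measure.restrict_mono (h.patch_subset E) le_rfl)) μ
  · rw [hμ (by omega)]

lemma IsMesh.elemDev_le (h : IsMesh Ω κ K 𝒯) {f : Plane → ℝ}
    (hf : MemLp f 2 (volume.restrict (closure Ω))) (μ : ℝ) {p : RefTriangle} (hp : p ∈ 𝒯) :
    elemDev f p ≤ dev f μ (hull p.1) :=
  dev_average_le (volume_hull_lt_top _) (h.memLp hf hp) μ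

lemma refineElement_subset {p : RefTriangle} (hp : p ∈ 𝒯) :
    refineElement S p ⊆ refineMesh S 𝒯 := Finset.subset_biUnion_of_mem _ hp

lemma IsMesh.sum_dev_children (h : IsMesh Ω κ K 𝒯)
    (h' : IsMesh Ω κ K (ObstacleAFEM.refineMesh S 𝒯)) {f : Plane → ℝ}
    (hf : MemLp f 2 (volume.restrict (closure Ω))) (μ : ℝ) {p : RefTriangle} (hp : p ∈ 𝒯) :
    ∑ c ∈ refineElement S p, dev f μ (hull c.1) = dev f μ (hull p.1) := by
  obtain ⟨_, _, _, sp⟩ := h.shape p hp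
  unfold dev
  rw [← iUnion_hull_refineElement (S := S) sp, h'.setIntegral_iUnion (refineElement_subset hp)
    fun c hc => h'.integrableOn_sq hf μ (refineElement_subset hp hc)]

lemma IsMesh.childAt_injOn_subEdges (h : IsMesh Ω κ K 𝒯) (hS : IsMarking 𝒯 S) {E : Finset Plane}
    (hE : E ∈ edges (tris 𝒯)) {p : RefTriangle} (hp : p ∈ elems 𝒯 E) :
    Set.InjOn (fun E' => childAt S E' p) (subEdges S E) := by
  intro E₁ hE₁ E₂ hE₂ e
  obtain ⟨c1, e1⟩ := h.childAt_spec hS hE hE₁ hp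
  obtain ⟨-, e2⟩ := h.childAt_spec hS hE hE₂ hp
  have e : childAt S E₁ p = childAt S E₂ p := e
  rw [← e] at e2
  obtain ⟨hp, hEp⟩ := mem_elems.1 hp
  have hsub := h.subordinate hS hp c1
  obtain ⟨a, b, hab, rfl⟩ := Finset.card_eq_two.1 (card_of_mem_edges hE)
  have ha : a ∈ p.1 := hEp (by simp)
  have hb : b ∈ p.1 := hEp (by simp)
  by_cases hSE : S {a, b}
  · have hnb := hsub.not_both a ha b hb hab hSE
    rw [subEdges_of_mem hSE] at hE₁ hE₂
    simp only [Finset.coe_insert, Finset.coe_singleton, Set.mem_insert_iff,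
      Set.mem_singleton_iff] at hE₁ hE₂
    rcases hE₁ with rfl | rfl <;> rcases hE₂ with rfl | rfl
    · rfl
    · exact absurd (e2 (by simp)) (hnb (e1 (by simp)))
    · exact absurd (e1 (by simp)) (hnb (e2 (by simp)))
    · rfl
  · rw [subEdges_of_not hSE] at hE₁ hE₂
    simp only [Finset.coe_singleton, Set.mem_singleton_iff] at hE₁ hE₂
    rw [hE₁, hE₂]

lemma IsMesh.area_childAt_le (h : IsMesh Ω κ K 𝒯) (hS : IsMarking 𝒯 S) {E E' : Finset Plane}
    (hE : E ∈ edges (tris 𝒯)) (hE' : E' ∈ subEdges S E) {p : RefTriangle} (hp : p ∈ elems 𝒯 E) :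
    volume.real (hull (childAt S E' p).1) ≤
      volume.real (hull p.1) - (if S p.2 then volume.real (hull p.1) / 2 else 0) := by
  obtain ⟨c1, -⟩ := h.childAt_spec hS hE hE' hp
  obtain ⟨_, _, _, sp⟩ := h.shape p (mem_elems.1 hp).1
  split_ifs with hSp
  · have := sp.area_child_le hSp c1
    linarith
  · rw [refineElement_of_not hSp, Finset.mem_singleton] at c1
    rw [c1, sub_zero]

/-- The oscillations on the parts of an edge of the coarse mesh. -/
lemma IsMesh.sum_edgeOsc_subEdges_le (h : IsMesh Ω κ K 𝒯) (hS : IsMarking 𝒯 S)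
    (h' : IsMesh Ω κ K (ObstacleAFEM.refineMesh S 𝒯)) {f : Plane → ℝ}
    (hf : MemLp f 2 (volume.restrict (closure Ω))) {E : Finset Plane} (hE : E ∈ edges (tris 𝒯)) :
    ∑ E' ∈ subEdges S E, edgeOsc (ObstacleAFEM.refineMesh S 𝒯) f E' ≤
      edgeOsc 𝒯 f E - (if S E then edgeOsc 𝒯 f E / 12 else 0) -
      5 / 12 * ∑ p ∈ elems 𝒯 E, if S p.2 then volume.real (hull p.1) * elemDev f p else 0 := by
  set μ := edgeMean 𝒯 f E with hμ
  set t : RefTriangle → ℝ := fun p => volume.real (hull p.1) with ht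
  set X : RefTriangle → ℝ := fun p => dev f μ (hull p.1) with hX
  have ht0 : ∀ p, 0 ≤ t p := fun p => measureReal_nonneg
  have hX0 : ∀ p, 0 ≤ X p := fun p => dev_nonneg _ _ _
  have hosc : edgeOsc 𝒯 f E = (∑ p ∈ elems 𝒯 E, t p) * ∑ p ∈ elems 𝒯 E, X p := h.edgeOsc_eq hf E
  have hsumX0 : 0 ≤ ∑ p ∈ elems 𝒯 E, X p := Finset.sum_nonneg fun p _ => hX0 p
  have hsub : ∀ E' ∈ subEdges S E, edgeOsc (ObstacleAFEM.refineMesh S 𝒯) f E' ≤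
      (∑ p ∈ elems 𝒯 E, (t p - if S p.2 then t p / 2 else 0)) *
        ∑ p ∈ elems 𝒯 E, X (childAt S E' p) := by
    intro E' hE'
    have hle := h'.edgeOsc_le hf E' (μ := μ) (fun hc => by
      rw [h.card_elems_sub hS hE hE'] at hc
      rw [hμ, edgeMean, if_neg (by omega)])
    rw [h.sum_elems_sub hS hE hE', h.sum_elems_sub hS hE hE'] at hle
    refine hle.trans (mul_le_mul_of_nonneg_right ?_ (Finset.sum_nonneg fun p _ => hX0 _))
    exact Finset.sum_le_sum fun p hp => h.area_childAt_le hS hE hE' hp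
  have hchild : ∑ E' ∈ subEdges S E, ∑ p ∈ elems 𝒯 E, X (childAt S E' p) ≤
      ∑ p ∈ elems 𝒯 E, X p := by
    rw [Finset.sum_comm]
    refine Finset.sum_le_sum fun p hp => ?_
    rw [← Finset.sum_image (f := X) (h.childAt_injOn_subEdges hS hE hp)]
    refine le_trans ?_ (h.sum_dev_children h' hf μ (mem_elems.1 hp).1).le
    refine Finset.sum_le_sum_of_subset_of_nonneg ?_ fun c _ _ => hX0 c
    intro c hc
    obtain ⟨E', hE', rfl⟩ := Finset.mem_image.1 hc
    exact (h.childAt_spec hS hE hE' hp).1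
  have hts0 : 0 ≤ ∑ p ∈ elems 𝒯 E, (t p - if S p.2 then t p / 2 else 0) :=
    Finset.sum_nonneg fun p _ => by split_ifs <;> linarith [ht0 p]
  have htotal : ∑ E' ∈ subEdges S E, edgeOsc (ObstacleAFEM.refineMesh S 𝒯) f E' ≤
      (∑ p ∈ elems 𝒯 E, (t p - if S p.2 then t p / 2 else 0)) * ∑ p ∈ elems 𝒯 E, X p := by
    refine (Finset.sum_le_sum hsub).trans ?_
    rw [← Finset.mul_sum]
    exact mul_le_mul_of_nonneg_left hchild hts0
  have hD : ∑ p ∈ elems 𝒯 E, (if S p.2 then t p * elemDev f p else 0) ≤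
      (∑ p ∈ elems 𝒯 E, if S p.2 then t p else 0) * ∑ p ∈ elems 𝒯 E, X p := by
    rw [Finset.sum_mul]
    refine Finset.sum_le_sum fun p hp => ?_
    split_ifs
    · refine mul_le_mul_of_nonneg_left ?_ (ht0 p)
      exact (h.elemDev_le hf μ (mem_elems.1 hp).1).trans
        (Finset.single_le_sum (f := X) (fun q _ => hX0 q) hp)
    · simp
  have hhalf : ∑ p ∈ elems 𝒯 E, (t p - if S p.2 then t p / 2 else 0) =
      ∑ p ∈ elems 𝒯 E, t p - (∑ p ∈ elems 𝒯 E, if S p.2 then t p else 0) / 2 := by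
    rw [Finset.sum_sub_distrib, Finset.sum_div]
    congr 1
    refine Finset.sum_congr rfl fun p _ => ?_
    split_ifs <;> simp
  rw [hhalf] at htotal
  refine htotal.trans ?_
  rw [hosc]
  have hr0 : 0 ≤ ∑ p ∈ elems 𝒯 E, if S p.2 then t p else 0 :=
    Finset.sum_nonneg fun p _ => by split_ifs <;> simp [ht0 p]
  split_ifs with hSE
  · have e : ∑ p ∈ elems 𝒯 E, (if S p.2 then t p else 0) = ∑ p ∈ elems 𝒯 E, t p := by
      refine Finset.sum_congr rfl fun p hp => if_pos ?_
      obtain ⟨hp, hEp⟩ := mem_elems.1 hp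
      exact hS.ref p hp E (Finset.mem_powersetCard.2 ⟨hEp, card_of_mem_edges hE⟩) hSE
    rw [e] at hD ⊢
    nlinarith
  · nlinarith [mul_nonneg hr0 hsumX0]

/-- The oscillations on the new edges inside of an element of the coarse mesh. -/
lemma IsMesh.sum_edgeOsc_innerEdges_le (h : IsMesh Ω κ K 𝒯) (hS : IsMarking 𝒯 S)
    (h' : IsMesh Ω κ K (ObstacleAFEM.refineMesh S 𝒯)) {f : Plane → ℝ}
    (hf : MemLp f 2 (volume.restrict (closure Ω))) {p : RefTriangle} (hp : p ∈ 𝒯) :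
    ∑ E ∈ innerEdges S p, edgeOsc (ObstacleAFEM.refineMesh S 𝒯) f E ≤
      if S p.2 then 5 / 4 * (volume.real (hull p.1) * elemDev f p) else 0 := by
  obtain ⟨_, _, _, sp⟩ := h.shape p hp
  split_ifs with hSp
  · rw [← mul_assoc, elemDev, ← h.sum_dev_children h' hf _ hp]
    refine le_trans (Finset.sum_le_sum fun E hE => ?_)
      (sum_innerEdges_le sp hSp (h.mid_ref_notMem hS hp) fun c _ => dev_nonneg _ _ _)
    obtain ⟨-, _, _, _, _, _, _, hi⟩ := h.exists_isInner hS hp hE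
    rw [← h.elems_inner_eq_filter hp hi]
    refine h'.edgeOsc_le hf E fun hc => ?_
    rw [h.elems_inner hp hi, Finset.card_pair hi.ne] at hc
    omega
  · rw [innerEdges_of_not sp (hS.ref p hp) hSp, Finset.sum_empty]

end Mesh

/-! ### Approximation of the boundary data -/

lemma ae_deriv_sub_affine {G u : ℝ → ℝ} {k α β : ℝ} (hk : 0 ≤ k)
    (hG : AbsolutelyContinuousOnInterval G 0 k) (hu : ∀ t ∈ Set.Icc 0 k, u t = α + β * t) :
    ∀ᵐ s, s ∈ Set.uIoc 0 k → deriv (fun t => G t - u t) s = deriv G s - β := by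
  have hne : ∀ᵐ s : ℝ, s ≠ k := by simp [ae_iff, measure_singleton]
  filter_upwards [hG.ae_differentiableAt, hne] with s hs hsk hmem
  rw [Set.uIoc_of_le hk] at hmem
  have hd : DifferentiableAt ℝ G s := hs (by
    rw [Set.uIcc_of_le hk]; exact ⟨hmem.1.le, hmem.2⟩)
  have hu' : HasDerivAt u β s := by
    have h1 : HasDerivAt (fun t : ℝ => α + β * t) β s := by
      simpa using ((hasDerivAt_id s).const_mul β).const_add α
    refine h1.congr_of_eventuallyEq ?_
    filter_upwards [Ioo_mem_nhds hmem.1 (lt_of_le_of_ne hmem.2 hsk)] with t ht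
    exact hu t ⟨ht.1.le, ht.2.le⟩
  exact (hd.hasDerivAt.sub hu').deriv

lemma intervalIntegrable_deriv_sub_sq {G u : ℝ → ℝ} {k α β : ℝ} (hk : 0 ≤ k)
    (hG : AbsolutelyContinuousOnInterval G 0 k)
    (hG2 : MemLp (deriv G) 2 (volume.restrict (Set.Ioo 0 k)))
    (hu : ∀ t ∈ Set.Icc 0 k, u t = α + β * t) :
    IntervalIntegrable (fun s => deriv (fun t => G t - u t) s ^ 2) volume 0 k := by
  rw [intervalIntegrable_iff_integrableOn_Ioo_of_le hk]
  have h1 : IntegrableOn (fun s => (deriv G s - β) ^ 2) (Set.Ioo 0 k) :=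
    (hG2.sub (memLp_const β)).integrable_sq
  refine IntegrableOn.congr_fun_ae h1 ?_
  rw [Filter.EventuallyEq, ae_restrict_iff' measurableSet_Ioo]
  filter_upwards [ae_deriv_sub_affine hk hG hu] with s hs hmem
  rw [hs (by rw [Set.uIoc_of_le hk]; exact Set.Ioo_subset_Ioc_self hmem)]

/-- The derivative of the affine interpolant is the best approximation of the derivative by
constants. -/
lemma integral_deriv_sub_interpolant_le {G u v : ℝ → ℝ} {k α β α' β' : ℝ} (hk : 0 < k)
    (hG : AbsolutelyContinuousOnInterval G 0 k)
    (hG2 : MemLp (deriv G) 2 (volume.restrict (Set.Ioo 0 k)))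
    (hu : ∀ t ∈ Set.Icc 0 k, u t = α + β * t) (hv : ∀ t ∈ Set.Icc 0 k, v t = α' + β' * t)
    (hv0 : v 0 = G 0) (hvk : v k = G k) :
    ∫ s in (0 : ℝ)..k, deriv (fun t => G t - v t) s ^ 2 ≤
      ∫ s in (0 : ℝ)..k, deriv (fun t => G t - u t) s ^ 2 := by
  have eu : ∫ s in (0 : ℝ)..k, deriv (fun t => G t - u t) s ^ 2 =
      ∫ s in (0 : ℝ)..k, (deriv G s - β) ^ 2 := by
    refine intervalIntegral.integral_congr_ae ?_
    filter_upwards [ae_deriv_sub_affine hk.le hG hu] with s hs hmem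
    rw [hs hmem]
  have ev : ∫ s in (0 : ℝ)..k, deriv (fun t => G t - v t) s ^ 2 =
      ∫ s in (0 : ℝ)..k, (deriv G s - β') ^ 2 := by
    refine intervalIntegral.integral_congr_ae ?_
    filter_upwards [ae_deriv_sub_affine hk.le hG hv] with s hs hmem
    rw [hs hmem]
  have hI : IntervalIntegrable (deriv G) volume 0 k := hG.intervalIntegrable_deriv
  have hI2 : IntervalIntegrable (fun s => (deriv G s - β') ^ 2) volume 0 k := by
    rw [intervalIntegrable_iff_integrableOn_Ioo_of_le hk.le]
    exact (hG2.sub (memLp_const β')).integrable_sq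
  have hI1 : IntervalIntegrable (fun s => deriv G s - β') volume 0 k :=
    hI.sub intervalIntegrable_const
  have hmean : ∫ s in (0 : ℝ)..k, (deriv G s - β') = 0 := by
    rw [intervalIntegral.integral_sub hI intervalIntegrable_const, hG.integral_deriv_eq_sub,
      intervalIntegral.integral_const, ← hv0, ← hvk, hv 0 ⟨le_rfl, hk.le⟩, hv k ⟨hk.le, le_rfl⟩]
    simp; ring
  rw [eu, ev]
  have e : ∀ s, (deriv G s - β) ^ 2 =
      ((deriv G s - β') ^ 2 + 2 * (β' - β) * (deriv G s - β')) + (β' - β) ^ 2 := fun s => by ring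
  simp_rw [e]
  rw [intervalIntegral.integral_add (hI2.add (hI1.const_mul _)) intervalIntegrable_const,
    intervalIntegral.integral_add hI2 (hI1.const_mul _), intervalIntegral.integral_const_mul, hmean,
    intervalIntegral.integral_const]
  have := mul_nonneg hk.le (sq_nonneg (β' - β))
  simp only [mul_zero, add_zero, sub_zero, smul_eq_mul]
  linarith

lemma arc_zero (a b : Plane) : arc a b 0 = a := by simp [arc]

lemma arc_dist {a b : Plane} (h : a ≠ b) : arc a b (dist a b) = b := by
  simp [arc, div_self (dist_pos.2 h).ne']

lemma arc_swap {a b : Plane} (h : a ≠ b) (t : ℝ) : arc b a t = arc a b (dist a b - t) := by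
  have hd := (dist_pos.2 h).ne'
  unfold arc
  rw [dist_comm b a]
  apply plane_ext <;> simp <;> field_simp <;> ring

lemma arc_midpoint {a b : Plane} (h : a ≠ b) (t : ℝ) :
    arc a (midpoint ℝ a b) t = arc a b t := by
  have hd := (dist_pos.2 h).ne'
  unfold arc
  rw [dist_left_midpoint]
  apply plane_ext <;> simp <;> field_simp

lemma arc_mem_hull {a b : Plane} {t : ℝ} (ht : t ∈ Set.Icc 0 (dist a b)) :
    arc a b t ∈ hull {a, b} := by
  rw [hull_pair, segment_eq_image']
  exact ⟨t / dist a b, ⟨div_nonneg ht.1 dist_nonneg, div_le_one_of_le₀ ht.2 dist_nonneg⟩, rfl⟩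

lemma AffineOn.along_arc {u : Plane → ℝ} {a b : Plane} (hu : AffineOn u (hull {a, b})) :
    ∃ α β : ℝ, ∀ t ∈ Set.Icc 0 (dist a b), u (arc a b t) = α + β * t := by
  obtain ⟨A, hA⟩ := hu
  refine ⟨A a, A.linear (b - a) / dist a b, fun t ht => ?_⟩
  rw [hA (arc_mem_hull ht)]
  have : arc a b t = (t / dist a b) • (b - a) +ᵥ a := by
    rw [vadd_eq_add, add_comm]; rfl
  rw [this, A.map_vadd, A.linear.map_smul]
  simp; ring

/-- The weighted deviation of the arclength derivatives on the segment from `a` to `b`. -/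
def segApx (g u : Plane → ℝ) (a b : Plane) : ℝ :=
  dist a b * ∫ s in (0 : ℝ)..dist a b, deriv (fun t => g (arc a b t) - u (arc a b t)) s ^ 2

lemma integral_segment_swap (g u : Plane → ℝ) {a b : Plane} (h : a ≠ b) (k : ℝ) :
    ∫ s in (0 : ℝ)..k, deriv (fun t => g (arc b a t) - u (arc b a t)) s ^ 2 =
      ∫ s in (dist a b - k)..dist a b,
        deriv (fun t => g (arc a b t) - u (arc a b t)) s ^ 2 := by
  have e : (fun t => g (arc b a t) - u (arc b a t)) =
      fun t => (fun t => g (arc a b t) - u (arc a b t)) (dist a b - t) := by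
    funext t; rw [arc_swap h]
  rw [e]
  simp_rw [deriv_comp_const_sub (fun t => g (arc a b t) - u (arc a b t)), neg_sq]
  rw [intervalIntegral.integral_comp_sub_left
    (fun s => deriv (fun t => g (arc a b t) - u (arc a b t)) s ^ 2) (dist a b), sub_zero]

lemma segApx_swap (g u : Plane → ℝ) {a b : Plane} (h : a ≠ b) :
    segApx g u b a = segApx g u a b := by
  unfold segApx
  rw [dist_comm b a, integral_segment_swap g u h, sub_self]

lemma apxSq_pair (g u : Plane → ℝ) {a b : Plane} (h : a ≠ b) :
    apxSq g u {a, b} = segApx g u a b := by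
  have hs : (endpoints {a, b}).1 ≠ (endpoints {a, b}).2 ∧
      ({a, b} : Finset Plane) = {(endpoints {a, b}).1, (endpoints {a, b}).2} :=
    Classical.epsilon_spec (p := fun p : Plane × Plane => p.1 ≠ p.2 ∧
      ({a, b} : Finset Plane) = {p.1, p.2}) ⟨(a, b), h, rfl⟩
  unfold apxSq
  obtain ⟨h1, h2⟩ := hs
  generalize (endpoints {a, b}).1 = p at *
  generalize (endpoints {a, b}).2 = q at *
  have hp : p ∈ ({a, b} : Finset Plane) := by rw [h2]; simp
  have hq : q ∈ ({a, b} : Finset Plane) := by rw [h2]; simp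
  simp only [Finset.mem_insert, Finset.mem_singleton] at hp hq
  rw [len_pair]
  rcases hp with rfl | rfl <;> rcases hq with rfl | rfl
  · exact absurd rfl h1
  · rfl
  · rw [← segApx_swap g u h, segApx, dist_comm]
  · exact absurd rfl h1

/-- `g` is absolutely continuous on the segment from `a` to `b`, with a square integrable
derivative. -/
def SegmentH1 (g : Plane → ℝ) (a b : Plane) : Prop :=
  AbsolutelyContinuousOnInterval (fun s => g (arc a b s)) 0 (dist a b) ∧
    MemLp (deriv fun s => g (arc a b s)) 2 (volume.restrict (Set.Ioo 0 (dist a b)))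

/-- Interpolation on an initial part of a segment reduces the deviation there. -/
lemma integral_initial_le {g u v : Plane → ℝ} {a b : Plane} {k : ℝ} (hk : 0 < k)
    (hkd : k ≤ dist a b) (hg : SegmentH1 g a b) (hu : AffineOn u (hull {a, b}))
    (hv : ∃ α β : ℝ, ∀ t ∈ Set.Icc 0 k, v (arc a b t) = α + β * t)
    (hva : v a = g a) (hvk : v (arc a b k) = g (arc a b k)) :
    ∫ s in (0 : ℝ)..k, deriv (fun t => g (arc a b t) - v (arc a b t)) s ^ 2 ≤
      ∫ s in (0 : ℝ)..k, deriv (fun t => g (arc a b t) - u (arc a b t)) s ^ 2 := by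
  obtain ⟨α, β, hu⟩ := hu.along_arc
  obtain ⟨α', β', hv⟩ := hv
  refine integral_deriv_sub_interpolant_le (G := fun t => g (arc a b t))
    (u := fun t => u (arc a b t)) (v := fun t => v (arc a b t)) hk (hg.1.mono ?_)
    (hg.2.mono_measure (Measure.restrict_mono (Set.Ioo_subset_Ioo_right hkd) le_rfl))
    (fun t ht => hu t ⟨ht.1, ht.2.trans hkd⟩) hv ?_ hvk
  · rw [Set.uIcc_of_le hk.le, Set.uIcc_of_le (hk.le.trans hkd)]
    exact Set.Icc_subset_Icc_right hkd
  · simp only [arc_zero, hva]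

lemma segApx_le {g u v : Plane → ℝ} {a b : Plane} (hab : a ≠ b) (hg : SegmentH1 g a b)
    (hu : AffineOn u (hull {a, b})) (hv : AffineOn v (hull {a, b})) (hva : v a = g a)
    (hvb : v b = g b) : segApx g v a b ≤ segApx g u a b := by
  refine mul_le_mul_of_nonneg_left ?_ dist_nonneg
  exact integral_initial_le (dist_pos.2 hab) le_rfl hg hu hv.along_arc hva
    (by rw [arc_dist hab, hvb])

lemma segApx_half_le {g u v : Plane → ℝ} {a b : Plane} (hab : a ≠ b) (hg : SegmentH1 g a b)
    (hu : AffineOn u (hull {a, b})) (hv : AffineOn v (hull {a, midpoint ℝ a b}))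
    (hva : v a = g a) (hvm : v (midpoint ℝ a b) = g (midpoint ℝ a b)) :
    segApx g v a (midpoint ℝ a b) ≤ dist a b / 2 *
      ∫ s in (0 : ℝ)..(dist a b / 2), deriv (fun t => g (arc a b t) - u (arc a b t)) s ^ 2 := by
  have hd : dist a (midpoint ℝ a b) = dist a b / 2 := by
    rw [dist_left_midpoint]; simp; ring
  have hpos := dist_pos.2 hab
  have hv := hv.along_arc
  have ham : a ≠ midpoint ℝ a b := by rwa [ne_eq, left_eq_midpoint_iff]
  have hk : arc a b (dist a b / 2) = midpoint ℝ a b := by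
    rw [← hd, ← arc_midpoint hab, arc_dist ham]
  unfold segApx
  simp only [arc_midpoint hab, hd] at hv ⊢
  exact mul_le_mul_of_nonneg_left (integral_initial_le (by linarith) (by linarith) hg hu hv hva
    (by rw [hk, hvm])) (by linarith)

lemma segApx_halves_le {g u v : Plane → ℝ} {a b : Plane} (hab : a ≠ b) (hg : SegmentH1 g a b)
    (hg' : SegmentH1 g b a)
    (hu : AffineOn u (hull {a, b})) (hv : AffineOn v (hull {a, midpoint ℝ a b}))
    (hv' : AffineOn v (hull {b, midpoint ℝ a b}))
    (hva : v a = g a) (hvb : v b = g b) (hvm : v (midpoint ℝ a b) = g (midpoint ℝ a b)) :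
    segApx g v a (midpoint ℝ a b) + segApx g v b (midpoint ℝ a b) ≤ segApx g u a b / 2 := by
  have h1 := segApx_half_le hab hg hu hv hva hvm
  rw [midpoint_comm] at hv' hvm
  rw [Finset.pair_comm] at hu
  have h2 := segApx_half_le hab.symm hg' hu hv' hvb hvm
  rw [Finset.pair_comm] at hu
  rw [integral_segment_swap g u hab, dist_comm b a, sub_half, midpoint_comm b a] at h2
  obtain ⟨α, β, hu⟩ := hu.along_arc
  have hpos := dist_pos.2 hab
  have hi := intervalIntegrable_deriv_sub_sq dist_nonneg hg.1 hg.2 hu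
  have hadd := intervalIntegral.integral_add_adjacent_intervals
    (hi.mono_set (c := 0) (d := dist a b / 2) (by
      rw [Set.uIcc_of_le (by linarith), Set.uIcc_of_le (by linarith)]
      exact Set.Icc_subset_Icc_right (by linarith)))
    (hi.mono_set (c := dist a b / 2) (d := dist a b) (by
      rw [Set.uIcc_of_le (by linarith), Set.uIcc_of_le (by linarith)]
      exact Set.Icc_subset_Icc_left (by linarith)))
  unfold segApx at h1 h2 ⊢
  rw [← hadd]
  linarith

lemma apxSq_nonneg (g u : Plane → ℝ) (E : Finset Plane) : 0 ≤ apxSq g u E :=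
  mul_nonneg (len_nonneg E) (intervalIntegral.integral_nonneg (len_nonneg E) fun _ _ => sq_nonneg _)

/-- The approximation terms on the parts of a boundary edge. -/
lemma sum_apxSq_subEdges_le {Ω : Set Plane} {S : Finset Plane → Prop} {g u v : Plane → ℝ}
    (hg : H1Boundary Ω g) {E : Finset Plane} (hE : E.card = 2) (hEΩ : hull E ⊆ frontier Ω)
    (hu : AffineOn u (hull E)) (hv : ∀ E' ∈ subEdges S E, AffineOn v (hull E'))
    (hvg : ∀ E' ∈ subEdges S E, ∀ z ∈ E', v z = g z) :
    ∑ E' ∈ subEdges S E, apxSq g v E' ≤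
      apxSq g u E - if S E then apxSq g u E / 2 else 0 := by
  obtain ⟨a, b, hab, rfl⟩ := Finset.card_eq_two.1 hE
  have h1 : SegmentH1 g a b := hg.2 a b hab (by rwa [← hull_pair])
  have h2 : SegmentH1 g b a := hg.2 b a hab.symm (by rwa [segment_symm, ← hull_pair])
  split_ifs with hS
  · have ham : a ≠ midpoint ℝ a b := by rwa [ne_eq, left_eq_midpoint_iff]
    have hbm : b ≠ midpoint ℝ a b := by rw [ne_eq, right_eq_midpoint_iff]; exact hab
    rw [subEdges_of_mem hS] at hv hvg ⊢
    have hne : ({a, midpoint ℝ a b} : Finset Plane) ≠ {b, midpoint ℝ a b} := by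
      intro e
      have : a ∈ ({b, midpoint ℝ a b} : Finset Plane) := e ▸ (by simp)
      simp only [Finset.mem_insert, Finset.mem_singleton] at this
      tauto
    rw [Finset.sum_pair hne, apxSq_pair g v ham, apxSq_pair g v hbm, apxSq_pair g u hab]
    have := segApx_halves_le hab h1 h2 hu (hv _ (by simp)) (hv _ (by simp))
      (hvg _ (Finset.mem_insert_self _ _) a (by simp))
      (hvg {b, midpoint ℝ a b} (by simp) b (by simp))
      (hvg _ (Finset.mem_insert_self _ _) _ (by simp))
    linarith
  · rw [subEdges_of_not hS] at hv hvg ⊢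
    rw [Finset.sum_singleton, apxSq_pair g v hab, apxSq_pair g u hab, sub_zero]
    exact segApx_le hab h1 hu (hv _ (Finset.mem_singleton_self _))
      (hvg _ (Finset.mem_singleton_self _) a (by simp))
      (hvg _ (Finset.mem_singleton_self _) b (by simp))

/-! ### The estimator as a sum over all edges -/

/-- The squared jump or approximation term at an interior or boundary edge. -/
def edgeApx (𝒯 : Finset RefTriangle) (g gh U : Plane → ℝ) (E : Finset Plane) : ℝ :=
  if 2 ≤ (elems 𝒯 E).card then etaSq (tris 𝒯) U E else apxSq g gh E

/-- The squared estimator at an interior or boundary edge. -/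
def edgeTerm (𝒯 : Finset RefTriangle) (f g gh U : Plane → ℝ) (E : Finset Plane) : ℝ :=
  edgeApx 𝒯 g gh U E + edgeOsc 𝒯 f E

lemma etaSq_nonneg (τ : Finset (Finset Plane)) (U : Plane → ℝ) (E : Finset Plane) :
    0 ≤ etaSq τ U E := by
  rw [etaSq_eq]; positivity

lemma edgeApx_nonneg (𝒯 : Finset RefTriangle) (g gh U : Plane → ℝ) (E : Finset Plane) :
    0 ≤ edgeApx 𝒯 g gh U E := by
  unfold edgeApx
  split_ifs
  exacts [etaSq_nonneg _ _ _, apxSq_nonneg _ _ _]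

lemma edgeTerm_nonneg (𝒯 : Finset RefTriangle) (f g gh U : Plane → ℝ) (E : Finset Plane) :
    0 ≤ edgeTerm 𝒯 f g gh U E := add_nonneg (edgeApx_nonneg _ _ _ _ _) (edgeOsc_nonneg _ _ _)

section Mesh

variable {Ω : Set Plane} {κ : ℝ} {K : ℕ} {𝒯 : Finset RefTriangle} {S : Finset Plane → Prop}

lemma IsMesh.mem_boundaryEdges (h : IsMesh Ω κ K 𝒯) {E : Finset Plane} :
    E ∈ boundaryEdges (tris 𝒯) ↔ E ∈ edges (tris 𝒯) ∧ ¬ 2 ≤ (elems 𝒯 E).card := by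
  rw [boundaryEdges, Finset.mem_sdiff, h.mem_interiorEdges]
  tauto

lemma IsMesh.contribution_eq (h : IsMesh Ω κ K 𝒯) (f g gh U : Plane → ℝ)
    (M : Finset (Finset Plane)) :
    contribution (tris 𝒯) f g gh U M = ∑ E ∈ edges (tris 𝒯) ∩ M, edgeTerm 𝒯 f g gh U E := by
  have hi : interiorEdges (tris 𝒯) ∩ M =
      (edges (tris 𝒯) ∩ M).filter fun E => 2 ≤ (elems 𝒯 E).card := by
    ext E
    simp only [Finset.mem_inter, Finset.mem_filter, h.mem_interiorEdges]
    tauto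
  have hb : boundaryEdges (tris 𝒯) ∩ M =
      (edges (tris 𝒯) ∩ M).filter fun E => ¬ 2 ≤ (elems 𝒯 E).card := by
    ext E
    simp only [Finset.mem_inter, Finset.mem_filter, h.mem_boundaryEdges]
    tauto
  rw [contribution, hi, hb, ← Finset.sum_filter_add_sum_filter_not (edges (tris 𝒯) ∩ M)
    (fun E => 2 ≤ (elems 𝒯 E).card)]
  congr 1 <;> refine Finset.sum_congr rfl fun E hE => ?_
  · have hc := (Finset.mem_filter.1 hE).2
    simp only [edgeTerm, edgeApx, edgeOsc, edgeMean, if_pos hc]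
    rfl
  · have hc := (Finset.mem_filter.1 hE).2
    simp only [edgeTerm, edgeApx, edgeOsc, edgeMean, if_neg hc, dev, sub_zero]
    rfl

lemma IsMesh.estimatorSq_eq (h : IsMesh Ω κ K 𝒯) (f g gh U : Plane → ℝ) :
    estimatorSq (tris 𝒯) f g gh U = ∑ E ∈ edges (tris 𝒯), edgeTerm 𝒯 f g gh U E := by
  have e := h.contribution_eq f g gh U (edges (tris 𝒯))
  rwa [Finset.inter_self, contribution,
    Finset.inter_eq_left.2 (show interiorEdges (tris 𝒯) ⊆ _ from Finset.filter_subset _ _),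
    Finset.inter_eq_left.2 (show boundaryEdges (tris 𝒯) ⊆ _ from Finset.sdiff_subset)] at e

/-! ### Reduction of the estimator on the refined mesh -/

lemma IsMesh.subEdges_subset (h : IsMesh Ω κ K 𝒯) (hS : IsMarking 𝒯 S) {E : Finset Plane}
    (hE : E ∈ edges (tris 𝒯)) : subEdges S E ⊆ edges (tris (ObstacleAFEM.refineMesh S 𝒯)) := by
  intro E' hE'
  obtain ⟨p, hp, hEp⟩ := mem_edges.1 hE
  have hspec := h.childAt_spec hS hE hE'
    (mem_elems.2 ⟨hp, (Finset.mem_powersetCard.1 hEp).1⟩)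
  exact mem_edges.2 ⟨_, Finset.mem_biUnion.2 ⟨p, hp, hspec.1⟩, Finset.mem_powersetCard.2
    ⟨hspec.2, (subEdges_properties (card_of_mem_edges hE) hE').1⟩⟩

lemma card_subEdges_le {E : Finset Plane} (hE : E.card = 2) : (subEdges S E).card ≤ 2 := by
  unfold subEdges
  split_ifs
  · exact Finset.card_image_le.trans hE.le
  · simp

lemma IsMesh.sum_edgeApx_subEdges_le (h : IsMesh Ω κ K 𝒯) (hS : IsMarking 𝒯 S)
    (h' : IsMesh Ω κ K (ObstacleAFEM.refineMesh S 𝒯)) {g gh gh' U : Plane → ℝ}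
    (hg : H1Boundary Ω g) (hgh : IsNodalInterpolant Ω (tris 𝒯) g gh)
    (hgh' : IsNodalInterpolant Ω (tris (ObstacleAFEM.refineMesh S 𝒯)) g gh')
    (hU : ∀ p ∈ 𝒯, AffineOn U (hull p.1)) {E : Finset Plane} (hE : E ∈ edges (tris 𝒯)) :
    ∑ E' ∈ subEdges S E, edgeApx (ObstacleAFEM.refineMesh S 𝒯) g gh' U E' ≤
      edgeApx 𝒯 g gh U E - if S E then edgeApx 𝒯 g gh U E / 2 else 0 := by
  have hcard := card_of_mem_edges hE
  by_cases hc : 2 ≤ (elems 𝒯 E).card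
  · have e : ∀ E' ∈ subEdges S E, edgeApx (ObstacleAFEM.refineMesh S 𝒯) g gh' U E' =
        (if S E then len E / 2 else len E) ^ 2 * normalJump (tris 𝒯) U E ^ 2 := by
      intro E' hE'
      rw [edgeApx, h.card_elems_sub hS hE hE', if_pos hc, etaSq_eq,
        h.normalJump_subEdge hS h' hU hE hE', len_subEdge hcard hE']
    rw [Finset.sum_congr rfl e, Finset.sum_const, nsmul_eq_mul, edgeApx, if_pos hc, etaSq_eq]
    have hJ : 0 ≤ len E ^ 2 * normalJump (tris 𝒯) U E ^ 2 := by positivity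
    split_ifs with hSE
    · have h2 : ((subEdges S E).card : ℝ) ≤ 2 := by exact_mod_cast card_subEdges_le hcard
      nlinarith
    · rw [subEdges, if_neg hSE]; simp
  · have e : ∀ E' ∈ subEdges S E, edgeApx (ObstacleAFEM.refineMesh S 𝒯) g gh' U E' =
        apxSq g gh' E' := fun E' hE' => by
      rw [edgeApx, h.card_elems_sub hS hE hE', if_neg hc]
    have hb : E ∈ boundaryEdges (tris 𝒯) := h.mem_boundaryEdges.2 ⟨hE, hc⟩
    have hb' : ∀ E' ∈ subEdges S E,
        E' ∈ boundaryEdges (tris (ObstacleAFEM.refineMesh S 𝒯)) := fun E' hE' =>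
      h'.mem_boundaryEdges.2
        ⟨h.subEdges_subset hS hE hE', by rwa [h.card_elems_sub hS hE hE']⟩
    rw [Finset.sum_congr rfl e, edgeApx, if_neg hc]
    exact sum_apxSq_subEdges_le hg hcard (h.bdry E hb) (hgh.affineOn E hb)
      (fun E' hE' => hgh'.affineOn E' (hb' E' hE'))
      (fun E' hE' => hgh'.interpolates E' (hb' E' hE'))

lemma IsMesh.edgeApx_innerEdge (h : IsMesh Ω κ K 𝒯) (hS : IsMarking 𝒯 S)
    (h' : IsMesh Ω κ K (ObstacleAFEM.refineMesh S 𝒯)) {U : Plane → ℝ} (g gh : Plane → ℝ)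
    (hU : ∀ p ∈ 𝒯, AffineOn U (hull p.1)) {p : RefTriangle} (hp : p ∈ 𝒯) {E : Finset Plane}
    (hE : E ∈ innerEdges S p) : edgeApx (ObstacleAFEM.refineMesh S 𝒯) g gh U E = 0 := by
  obtain ⟨-, _, _, _, _, _, _, hi⟩ := h.exists_isInner hS hp hE
  rw [edgeApx, h.elems_inner hp hi, if_pos (Finset.card_pair hi.ne).ge, etaSq_eq,
    h.normalJump_innerEdge hS h' hU hp hE]
  ring

lemma sum_biUnion_le {ι α : Type*} [DecidableEq α] (s : Finset ι) (t : ι → Finset α) {F : α → ℝ}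
    (hF : ∀ a, 0 ≤ F a) : ∑ a ∈ s.biUnion t, F a ≤ ∑ i ∈ s, ∑ a ∈ t i, F a := by
  induction s using Finset.induction_on with
  | empty => simp
  | insert i s hi ih =>
    rw [Finset.biUnion_insert, Finset.sum_insert hi]
    have := Finset.sum_union_inter (s₁ := t i) (s₂ := s.biUnion t) (f := F)
    have := Finset.sum_nonneg (s := t i ∩ s.biUnion t) fun a _ => hF a
    linarith

/-- The estimator of a discrete function of the coarse mesh is reduced on the halved edges. -/
lemma IsMesh.sum_edgeTerm_refine_le (h : IsMesh Ω κ K 𝒯) (hS : IsMarking 𝒯 S)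
    (h' : IsMesh Ω κ K (ObstacleAFEM.refineMesh S 𝒯)) {f g gh gh' U : Plane → ℝ}
    (hf : MemLp f 2 (volume.restrict (closure Ω)))
    (hg : H1Boundary Ω g) (hgh : IsNodalInterpolant Ω (tris 𝒯) g gh)
    (hgh' : IsNodalInterpolant Ω (tris (ObstacleAFEM.refineMesh S 𝒯)) g gh')
    (hU : ∀ p ∈ 𝒯, AffineOn U (hull p.1)) :
    ∑ E ∈ edges (tris (ObstacleAFEM.refineMesh S 𝒯)),
        edgeTerm (ObstacleAFEM.refineMesh S 𝒯) f g gh' U E ≤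
      ∑ E ∈ edges (tris 𝒯), edgeTerm 𝒯 f g gh U E -
        (∑ E ∈ edges (tris 𝒯), if S E then edgeTerm 𝒯 f g gh U E else 0) / 12 := by
  set D : RefTriangle → ℝ := fun p =>
    if S p.2 then volume.real (hull p.1) * elemDev f p else 0 with hD
  set Ψ := edgeTerm (ObstacleAFEM.refineMesh S 𝒯) f g gh' U with hΨ
  have hΨ0 : ∀ E, 0 ≤ Ψ E := fun E => edgeTerm_nonneg _ _ _ _ _ _
  have hsplit : ∑ E ∈ edges (tris (ObstacleAFEM.refineMesh S 𝒯)), Ψ E ≤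
      ∑ E ∈ edges (tris 𝒯), ∑ E' ∈ subEdges S E, Ψ E' +
        ∑ p ∈ 𝒯, ∑ E ∈ innerEdges S p, Ψ E := by
    have hsub : edges (tris (ObstacleAFEM.refineMesh S 𝒯)) ⊆
        (edges (tris 𝒯)).biUnion (subEdges S) ∪ 𝒯.biUnion (innerEdges S) := by
      intro E hE
      simpa only [Finset.mem_union, Finset.mem_biUnion] using mem_edges_refineMesh hE
    refine (Finset.sum_le_sum_of_subset_of_nonneg hsub fun E _ _ => hΨ0 E).trans ?_
    have hun := Finset.sum_union_inter (s₁ := (edges (tris 𝒯)).biUnion (subEdges S))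
      (s₂ := 𝒯.biUnion (innerEdges S)) (f := Ψ)
    have hn := Finset.sum_nonneg (s := (edges (tris 𝒯)).biUnion (subEdges S) ∩
      𝒯.biUnion (innerEdges S)) fun E _ => hΨ0 E
    have b1 := sum_biUnion_le (edges (tris 𝒯)) (subEdges S) hΨ0
    have b2 := sum_biUnion_le 𝒯 (innerEdges S) hΨ0
    linarith
  have hedge : ∀ E ∈ edges (tris 𝒯), ∑ E' ∈ subEdges S E, Ψ E' ≤
      edgeTerm 𝒯 f g gh U E - (if S E then edgeTerm 𝒯 f g gh U E else 0) / 12 -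
        5 / 12 * ∑ p ∈ elems 𝒯 E, D p := by
    intro E hE
    have h1 := h.sum_edgeApx_subEdges_le hS h' hg hgh hgh' hU hE
    have h2 := h.sum_edgeOsc_subEdges_le hS h' hf hE
    have h3 := edgeApx_nonneg 𝒯 g gh U E
    simp only [hΨ, edgeTerm, Finset.sum_add_distrib]
    split_ifs at h1 h2 ⊢ <;> linarith
  have hinner : ∀ p ∈ 𝒯, ∑ E ∈ innerEdges S p, Ψ E ≤ 5 / 4 * D p := by
    intro p hp
    have h2 := h.sum_edgeOsc_innerEdges_le hS h' hf hp
    rw [Finset.sum_congr rfl fun E hE => by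
      rw [hΨ, edgeTerm, h.edgeApx_innerEdge hS h' g gh' hU hp hE, zero_add]]
    refine h2.trans (le_of_eq ?_)
    simp only [hD, mul_ite, mul_zero]
  have hs1 := Finset.sum_le_sum hedge
  have hs2 := Finset.sum_le_sum hinner
  rw [Finset.sum_sub_distrib, Finset.sum_sub_distrib, ← Finset.mul_sum, h.sum_elems,
    ← Finset.sum_div, ← Finset.mul_sum] at hs1
  rw [← Finset.mul_sum] at hs2
  linarith

/-- Perturbation of the discrete function in the estimator. -/
lemma IsMesh.sum_edgeTerm_le (h : IsMesh Ω κ K 𝒯) (h0 : volume (frontier Ω) = 0)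
    {f g gh U V : Plane → ℝ} (hU : ∀ p ∈ 𝒯, AffineOn U (hull p.1))
    (hV : ∀ p ∈ 𝒯, AffineOn V (hull p.1)) {δ : ℝ} (hδ : 0 < δ) :
    ∑ E ∈ edges (tris 𝒯), edgeTerm 𝒯 f g gh V E ≤
      (1 + δ) * ∑ E ∈ edges (tris 𝒯), edgeTerm 𝒯 f g gh U E +
        (1 + δ⁻¹) * (K * (3 * (2 * κ / stdArea)) * energyForm Ω (V - U) (V - U)) := by
  have hjump := h.sum_jump_le h0 (W := V - U) fun p hp => (hV p hp).sub (hU p hp)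
  have hδ' : 0 < 1 + δ⁻¹ := by positivity
  refine le_trans ?_ (add_le_add_right (mul_le_mul_of_nonneg_left hjump hδ'.le) _)
  rw [Finset.mul_sum, Finset.mul_sum, ← Finset.sum_add_distrib]
  refine Finset.sum_le_sum fun E _ => ?_
  have hosc := mul_nonneg hδ.le (edgeOsc_nonneg 𝒯 f E)
  have hpos : 0 ≤ (1 + δ⁻¹) * (len E ^ 2 * normalJump (tris 𝒯) (V - U) E ^ 2) := by positivity
  unfold edgeTerm edgeApx
  split_ifs
  · rw [etaSq_eq, etaSq_eq, h.normalJump_sub hV hU]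
    generalize normalJump (tris 𝒯) U E = a
    generalize normalJump (tris 𝒯) V E = b
    have key : b ^ 2 ≤ (1 + δ) * a ^ 2 + (1 + δ⁻¹) * (b - a) ^ 2 := by
      have e : (1 + δ) * a ^ 2 + (1 + δ⁻¹) * (b - a) ^ 2 - b ^ 2 =
          δ⁻¹ * (δ * a - (b - a)) ^ 2 := by field_simp; ring
      have : 0 ≤ δ⁻¹ * (δ * a - (b - a)) ^ 2 := by positivity
      linarith
    have := mul_le_mul_of_nonneg_left key (sq_nonneg (len E))
    linarith
  · have := mul_nonneg hδ.le (apxSq_nonneg g gh E)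
    linarith

end Mesh

/-! ### The initial mesh -/

/-- A bound for the shape constants of the triangles in `τ`. -/
def shapeConst (τ : Finset (Finset Plane)) : ℝ :=
  ∑ T ∈ τ, ∑ z ∈ T, ∑ x ∈ T, ∑ y ∈ T, (dist x z ^ 2 + dist y z ^ 2) / |orient z x y|

lemma le_shapeConst {τ : Finset (Finset Plane)} {T : Finset Plane} (hT : T ∈ τ) {z x y : Plane}
    (hz : z ∈ T) (hx : x ∈ T) (hy : y ∈ T) (h : orient z x y ≠ 0) :
    dist x z ^ 2 + dist y z ^ 2 ≤ shapeConst τ * |orient z x y| := by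
  have h0 : ∀ z x y : Plane, 0 ≤ (dist x z ^ 2 + dist y z ^ 2) / |orient z x y| := fun z x y => by
    positivity
  rw [← div_le_iff₀ (abs_pos.2 h)]
  calc _ ≤ ∑ y ∈ T, (dist x z ^ 2 + dist y z ^ 2) / |orient z x y| :=
        Finset.single_le_sum (fun y _ => h0 z x y) hy
    _ ≤ ∑ x ∈ T, ∑ y ∈ T, (dist x z ^ 2 + dist y z ^ 2) / |orient z x y| :=
        Finset.single_le_sum (f := fun x => ∑ y ∈ T, (dist x z ^ 2 + dist y z ^ 2) / |orient z x y|)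
          (fun x _ => Finset.sum_nonneg fun y _ => h0 z x y) hx
    _ ≤ ∑ z ∈ T, ∑ x ∈ T, ∑ y ∈ T, (dist x z ^ 2 + dist y z ^ 2) / |orient z x y| :=
        Finset.single_le_sum
          (f := fun z => ∑ x ∈ T, ∑ y ∈ T, (dist x z ^ 2 + dist y z ^ 2) / |orient z x y|)
          (fun z _ => Finset.sum_nonneg fun x _ => Finset.sum_nonneg fun y _ => h0 z x y) hz
    _ ≤ shapeConst τ :=
        Finset.single_le_sum (f := fun T => ∑ z ∈ T, ∑ x ∈ T, ∑ y ∈ T,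
            (dist x z ^ 2 + dist y z ^ 2) / |orient z x y|)
          (fun T _ => Finset.sum_nonneg fun z _ => Finset.sum_nonneg fun x _ =>
            Finset.sum_nonneg fun y _ => h0 z x y) hT

lemma IsTriangulation.exists_isShape {Ω : Set Plane} {τ : Finset (Finset Plane)}
    (h : IsTriangulation Ω τ) {T R : Finset Plane} (hT : T ∈ τ) (hR : R ∈ T.powersetCard 2) :
    ∃ z x y, IsShape (shapeConst τ) (T, R) z x y := by
  obtain ⟨hRT, hR2⟩ := Finset.mem_powersetCard.1 hR
  obtain ⟨x, y, hxy, rfl⟩ := Finset.card_eq_two.1 hR2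
  have hd : (T \ {x, y}).card = 1 := by
    rw [Finset.card_sdiff_of_subset hRT, h.card_eq T hT, hR2]
  obtain ⟨z, hz⟩ := Finset.card_eq_one.1 hd
  have hzT : z ∈ T \ {x, y} := hz ▸ Finset.mem_singleton_self z
  obtain ⟨-, hzn⟩ := Finset.mem_sdiff.1 hzT
  have e : T = {z, x, y} := by
    rw [← Finset.sdiff_union_of_subset hRT, hz]; rfl
  simp only [Finset.mem_insert, Finset.mem_singleton, not_or] at hzn
  have hn := h.nondegenerate T hT
  subst e
  have ho := orient_ne_zero_of_affineIndependent hn hzn.1 hzn.2 hxy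
  exact ⟨z, x, y, rfl, ho, le_shapeConst hT (by simp) (by simp) (by simp) ho⟩

lemma tris_withRefEdges (τ : Finset (Finset Plane)) (r : Finset Plane → Finset Plane) :
    tris (withRefEdges τ r) = τ := by
  simp [tris, withRefEdges, Finset.image_image, Function.comp_def]

lemma IsTriangulation.isMesh {Ω : Set Plane} {τ : Finset (Finset Plane)}
    (h : IsTriangulation Ω τ) {r : Finset Plane → Finset Plane}
    (hr : ∀ T ∈ τ, r T ∈ T.powersetCard 2) :
    IsMesh Ω (shapeConst τ) (max 2 τ.card) (withRefEdges τ r) where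
  shape p hp := by
    obtain ⟨T, hT, rfl⟩ := Finset.mem_image.1 hp
    exact h.exists_isShape hT (hr T hT)
  conf p hp q hq hne := by
    obtain ⟨T, hT, rfl⟩ := Finset.mem_image.1 hp
    obtain ⟨T', hT', rfl⟩ := Finset.mem_image.1 hq
    refine ⟨?_, (h.conforming T hT T' hT').le⟩
    rintro (rfl : T = T')
    exact hne rfl
  cover := by
    rw [← h.cover, withRefEdges, Finset.set_biUnion_finset_image]
  bdry E hE := by
    rw [tris_withRefEdges] at hE
    rw [← h.boundary]
    exact Set.subset_biUnion_of_mem (u := fun E : Finset Plane => hull E) hE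
  valence E _ := ((Finset.card_filter_le _ _).trans Finset.card_image_le).trans (le_max_right _ _)

lemma IsTriangulation.volume_frontier {Ω : Set Plane} {τ : Finset (Finset Plane)}
    (h : IsTriangulation Ω τ) : volume (frontier Ω) = 0 := by
  rw [← h.boundary]
  refine (measure_biUnion_null_iff (boundaryEdges τ).countable_toSet).2 fun E hE => ?_
  exact volume_hull_of_card_le (card_of_mem_edges (Finset.mem_sdiff.1 hE).1).le

lemma energyForm_self_nonneg (Ω : Set Plane) (v : Plane → ℝ) : 0 ≤ energyForm Ω v v :=
  integral_nonneg fun _ => real_inner_self_nonneg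

end

end ObstacleAFEM

theorem mainTheorem5 (θ : ℝ) (hθ₀ : 0 < θ) (hθ₁ : θ < 1) :
    ∃ q : ℝ, 0 < q ∧ q < 1 ∧
      ∀ (Ω : Set Plane) (T₀ : Finset (Finset Plane)),
        IsOpen Ω → IsConnected Ω → Bornology.IsBounded Ω → IsTriangulation Ω T₀ →
        ∃ C : ℝ, 0 < C ∧
          -- the reference edges of the initial mesh, the meshes, and the sets of marked edges
          ∀ (r : Finset Plane → Finset Plane) (𝒯 : ℕ → Finset RefTriangle)
            (M : ℕ → Finset (Finset Plane)),
            (∀ T ∈ T₀, r T ∈ T.powersetCard 2) →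
            𝒯 0 = withRefEdges T₀ r →
            (∀ ℓ, M ℓ ⊆ edges (tris (𝒯 ℓ))) →
            (∀ ℓ, 𝒯 (ℓ + 1) = newestVertexBisection (𝒯 ℓ) (M ℓ)) →
            -- the data
            ∀ (f g : Plane → ℝ) (χ : Plane →ᵃ[ℝ] ℝ),
              MemLp f 2 (volume.restrict Ω) →
              H1Boundary Ω g →
              (∀ x ∈ frontier Ω, χ x ≤ g x) →
              -- the nodal interpolants of the boundary data and the discrete solutions
              ∀ gh U : ℕ → Plane → ℝ,
                (∀ ℓ, IsNodalInterpolant Ω (tris (𝒯 ℓ)) g (gh ℓ)) →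
                (∀ ℓ, IsDiscreteSolution Ω (tris (𝒯 ℓ)) f χ (gh ℓ) (U ℓ)) →
                ∀ ℓ : ℕ,
                  -- marking at step `ℓ`
                  θ * estimatorSq (tris (𝒯 ℓ)) f g (gh ℓ) (U ℓ) ≤
                    contribution (tris (𝒯 ℓ)) f g (gh ℓ) (U ℓ) (M ℓ) →
                  estimatorSq (tris (𝒯 (ℓ + 1))) f g (gh (ℓ + 1)) (U (ℓ + 1)) ≤
                    q * estimatorSq (tris (𝒯 ℓ)) f g (gh ℓ) (U ℓ) +
                      C * energyForm Ω (U (ℓ + 1) - U ℓ) (U (ℓ + 1) - U ℓ) := by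
  classical
  refine ⟨1 - θ ^ 2 / 144, by nlinarith, by nlinarith, fun Ω T₀ _ _ _ hT => ?_⟩
  set c : ℝ := (1 + (θ / 12)⁻¹) *
    ((max 2 T₀.card : ℕ) * (3 * (2 * shapeConst T₀ / stdArea))) with hc
  refine ⟨|c| + 1, by positivity, ?_⟩
  intro r 𝒯 M hr h𝒯₀ hM h𝒯 f g χ hf hg _ gh U hgh hU ℓ hmark
  have h0 := hT.volume_frontier
  have hmesh : ∀ ℓ, IsMesh Ω (shapeConst T₀) (max 2 T₀.card) (𝒯 ℓ) := by
    intro ℓ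
    induction ℓ with
    | zero => rw [h𝒯₀]; exact hT.isMesh hr
    | succ ℓ ih =>
      rw [h𝒯]
      exact ih.refineMesh (isMarking_markClosure ih (hM ℓ)) (le_max_left _ _)
  have h := hmesh ℓ
  have h' := hmesh (ℓ + 1)
  have hS := isMarking_markClosure h (hM ℓ)
  have hgh' := hgh (ℓ + 1)
  have haff : ∀ ℓ, ∀ p ∈ 𝒯 ℓ, AffineOn (U ℓ) (hull p.1) := fun ℓ p hp =>
    (hU ℓ).1.1.2 p.1 (Finset.mem_image_of_mem _ hp)
  have hV := haff (ℓ + 1)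
  have hfΩ : MemLp f 2 (volume.restrict (closure Ω)) := by
    rwa [Measure.restrict_congr_set (closure_ae_eq h0)]
  rw [h.estimatorSq_eq] at hmark ⊢
  rw [h'.estimatorSq_eq]
  rw [h.contribution_eq] at hmark
  have e : 𝒯 (ℓ + 1) = refineMesh (MarkClosure (𝒯 ℓ) (M ℓ)) (𝒯 ℓ) := h𝒯 ℓ
  have hUfine : ∀ p ∈ 𝒯 (ℓ + 1), AffineOn (U ℓ) (hull p.1) := by
    intro p' hp'
    rw [e] at hp'
    obtain ⟨p, hp, hp'⟩ := Finset.mem_biUnion.1 hp'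
    obtain ⟨_, _, _, sp⟩ := h.shape p hp
    exact (haff ℓ p hp).mono (hull_child_subset sp hp')
  have hpert := h'.sum_edgeTerm_le h0 (f := f) (g := g) (gh := gh (ℓ + 1)) hUfine hV
    (δ := θ / 12) (by positivity)
  have hred : ∑ E ∈ edges (tris (𝒯 (ℓ + 1))), edgeTerm (𝒯 (ℓ + 1)) f g (gh (ℓ + 1)) (U ℓ) E ≤
      ∑ E ∈ edges (tris (𝒯 ℓ)), edgeTerm (𝒯 ℓ) f g (gh ℓ) (U ℓ) E -
        (∑ E ∈ edges (tris (𝒯 ℓ)), if MarkClosure (𝒯 ℓ) (M ℓ) E then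
          edgeTerm (𝒯 ℓ) f g (gh ℓ) (U ℓ) E else 0) / 12 := by
    rw [e] at h' hgh' ⊢
    exact h.sum_edgeTerm_refine_le hS h' hfΩ hg (hgh ℓ) hgh' (haff ℓ)
  have hmark' : ∑ E ∈ edges (tris (𝒯 ℓ)) ∩ M ℓ, edgeTerm (𝒯 ℓ) f g (gh ℓ) (U ℓ) E ≤
      ∑ E ∈ edges (tris (𝒯 ℓ)), if MarkClosure (𝒯 ℓ) (M ℓ) E then
        edgeTerm (𝒯 ℓ) f g (gh ℓ) (U ℓ) E else 0 := by
    rw [← Finset.sum_filter]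
    refine Finset.sum_le_sum_of_subset_of_nonneg (fun E hE => ?_) fun E _ _ =>
      edgeTerm_nonneg _ _ _ _ _ _
    obtain ⟨hE, hEM⟩ := Finset.mem_inter.1 hE
    exact Finset.mem_filter.2 ⟨hE, .base E hEM⟩
  have hen := energyForm_self_nonneg Ω (U (ℓ + 1) - U ℓ)
  have hce := mul_le_mul_of_nonneg_right ((le_abs_self c).trans (le_add_of_nonneg_right
    (zero_le_one (α := ℝ)))) hen
  rw [← mul_assoc, ← hc] at hpert
  generalize ∑ E ∈ edges (tris (𝒯 ℓ)), edgeTerm (𝒯 ℓ) f g (gh ℓ) (U ℓ) E = ρ at *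
  have hred' : ∑ E ∈ edges (tris (𝒯 (ℓ + 1))),
      edgeTerm (𝒯 (ℓ + 1)) f g (gh (ℓ + 1)) (U ℓ) E ≤ (1 - θ / 12) * ρ := by linarith
  have := mul_le_mul_of_nonneg_left hred' (by positivity : 0 ≤ 1 + θ / 12)
  linarith
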